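/- Let $M\subset\mathbb R^3$ be a compact two-dimensional embedded $C^3$ surface without boundary and let $X=\{x_1,\dots,x_N\}\subset M$. Put $h_{X,M}=\sup_{y\in M}\min_j\|y-x_j\|$ and $q_X=\frac12\min_{i\ne j}\|x_i-x_j\|$. For each $i$ let $t^{(i)}_1,t^{(i)}_2,t^{(i)}_3$ be an orthonormal basis of $\mathbb R^3$ with $t^{(i)}_1,t^{(i)}_2\in T_{x_i}M$, let $K(i)\ni i$ be (the indices of) $k$ nearest neighbours of $x_i$ in $X$ ($x_i$ included), $v^{(i)}_j=(t^{(i)}_1\cdot(x_j-x_i),\,t^{(i)}_2\cdot(x_j-x_i))$, $r_i=\max_{j\in K(i)}\|v_j^{(i)}\|$, and let $R(i)$ be the set of those triangles of a Delaunay triangulation of $\{v^{(i)}_j\}_{j\in K(i)}$ that have $0=v_i^{(i)}$ as a vertex. Let $p_i$ be a polynomial of degree at most $2$ on $\mathbb R^2$ minimizing $\sum_{j\in K(i)}\omega_{ij}\,(p(v^{(i)}_j)-t^{(i)}_3\cdot(x_j-x_i))^2$, where $\omega_{ii}=1$ and $\omega_{ij}=1/k$ for $j\neq i$. Let $z_i$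 be the $C^3$ function on a disc about $0$ of radius larger than $r_i$ with $z_i(0)=0$ whose graph $v\mapsto x_i+v_1t^{(i)}_1+v_2t^{(i)}_2+z_i(v)t_3^{(i)}$ lies in $M$. For a triangle $[0,v_j,v_l]\in R(i)$ and a height function $f_i$, let $\Phi(u)=x_i+w_1t_1^{(i)}+w_2t_2^{(i)}+f_i(w)t_3^{(i)}$, $w=u_1v_j+u_2v_l$, for $u$ in the reference triangle $T=\{u_1,u_2\ge0,\ u_1+u_2\le1\}$, with metric $g_{ab}=\partial_a\Phi\cdot\partial_b\Phi$. On this patch the hat functions $e_i,e_j,e_l$ are $1-u_1-u_2$, $u_1$, $u_2$, the other $e_m$ vanish, and the nodal field $e_mt^{(m)}_\kappa$ ($\kappa=1,2$) is $e_m\sum_q a_q\partial_q\Phi$, where the constants $a=(a_1,a_2)$ are the least-squares coefficients of $t_\kappa^{(m)}$ in the basis $\partial_1\Phi,\partial_2\Phi$ evaluated at the vertex $m$. The $2N\times 2N$ mass and stiffness matrices built from $f=(f_i)$ are $$\mathbf M_{(i,\kappa),(m,\kappa')}=\sum_{R(i)}\int_T\langle e_it^{(i)}_\kappa,e_mt^{(m)}_{\kappa'}\rangle_g\sqrt{\det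 g}\,du,\qquad \mathbf S_{(i,\kappa),(m,\kappa')}=\sum_{R(i)}\int_T\langle \mathrm{grad}_g(e_it^{(i)}_\kappa),\mathrm{grad}_g(e_mt^{(m)}_{\kappa'})\rangle_g\sqrt{\det g}\,du,$$ where $\mathrm{grad}_g(V^a\partial_a)=g^{cb}(\partial_cV^a+V^d\Gamma^a_{dc})\,\partial_a\otimes\partial_b$ (the Bochner case). Let $\mathbf A=\frac12(\mathbf S+\mathbf S^\top)$ and $\mathbf B=\frac12(\mathbf M+\mathbf M^\top)$ for the exact heights $f_i=z_i$, and let $\widehat{\mathbf A},\widehat{\mathbf B}$ be the same matrices for the fitted heights $f_i=p_i$ (the curved mesh). Put $$\varepsilon=\big(\|\widehat{\mathbf A}-\mathbf A\|_2^2+\|\widehat{\mathbf B}-\mathbf B\|_2^2\big)^{1/2},\qquad c(\mathbf A,\mathbf B)=\min_{\|\mathbf x\|=1}\ (\mathbf x^\top\mathbf A\mathbf x)^2+(\mathbf x^\top\mathbf B\mathbf x)^2 .$$ **Lemma.** Let $c_q,c_r\in\mathbb R$. There are $h_0>0$, $k_0\in\mathbb N$, $C_0>0$ and $\kappa_0\ge1$,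 depending only on $M,c_q,c_r$, such that the following holds for all $N$, $k\ge k_0$, all $X$ with $h_{X,M}\le h_0$, $q_X\le h_{X,M}\le c_q\,q_X$ and $r_i^2\le c_r\,h_{X,M}$ for all $i$, and all choices of the objects above. 1. $\kappa_0\,\varepsilon\le C_0\,h_{X,M}$; in particular $\|\mathbf A-\widehat{\mathbf A}\|_2$ and $\|\mathbf B-\widehat{\mathbf B}\|_2$ are $O(h_{X,M})$. 2. Suppose that $\mathbf A$, $\mathbf B$ and $\widehat{\mathbf B}$ are positive definite. Let $a_1\ge\dots\ge a_{2N}$ and $b_1\ge\dots\ge b_{2N}$ be the eigenvalues of $\mathbf A$ and $\mathbf B$, and let $\lambda_{1,N}\ge\dots\ge\lambda_{2N,N}$ and $\widehat\lambda_{1,N}\ge\dots\ge\widehat\lambda_{2N,N}$ be the eigenvalues of the pencils $\mathbf A-\lambda\mathbf B$ and $\widehat{\mathbf A}-\lambda\widehat{\mathbf B}$, all with multiplicity. Let $C$ be any number with $\kappa_0\,\varepsilon\le C\,h_{X,M}$ (for instance $C=C_0$). If $\min_{\ell=1,\dots,2N}(a_\ell^2+b_\ell^2)>C^2h_{X,M}^2$,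 then for every $\ell=1,\dots,2N$ $$|\lambda_{\ell,N}-\widehat\lambda_{\ell,N}|\le\frac{C\,h_{X,M}}{c(\mathbf A,\mathbf B)}\,\big|1+\lambda_{\ell,N}\widehat\lambda_{\ell,N}\big| .$$ -/

import Mathlib

open Metric

/-- The ambient Euclidean space. -/
abbrev E3 : Type := EuclideanSpace ℝ (Fin 3)

/-- The parameter plane (tangent-plane coordinates and reference-triangle coordinates). -/
abbrev E2 : Type := EuclideanSpace ℝ (Fin 2)

/-- `M` is a two-dimensional embedded `C³` submanifold of `ℝ³` without boundary: near each of its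
points it is a regular level set of a `C³` function. -/
def IsC3Surface (M : Set E3) : Prop :=
  ∀ x ∈ M, ∃ (U : Set E3) (F : E3 → ℝ), IsOpen U ∧ x ∈ U ∧ ContDiffOn ℝ 3 F U ∧
    (∀ y ∈ U, fderiv ℝ F y ≠ 0) ∧ M ∩ U = {y ∈ U | F y = 0}

/-! ### Riemannian quantities of a parameterization `Φ : ℝ² → ℝ³` -/

namespace Param

noncomputable section

/-- Partial derivative in the `k`-th coordinate. -/
def pd {F : Type*} [NormedAddCommGroup F] [NormedSpace ℝ F] (k : Fin 2) (f : E2 → F) (u : E2) : F :=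
  fderiv ℝ f u (EuclideanSpace.single k 1)

/-- The induced metric `g_{kl} = ⟨∂_k Φ, ∂_l Φ⟩`. -/
def metric (Φ : E2 → E3) (u : E2) : Matrix (Fin 2) (Fin 2) ℝ :=
  Matrix.of fun k l => inner ℝ (pd k Φ u) (pd l Φ u)

/-- The Christoffel symbols `Γ^i_{pk}` of the induced metric. -/
def christoffel (Φ : E2 → E3) (i p k : Fin 2) (u : E2) : ℝ :=
  (1 / 2) * ∑ m, (metric Φ u)⁻¹ i m *
    (pd k (fun w => metric Φ w m p) u + pd p (fun w => metric Φ w m k) u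
      - pd m (fun w => metric Φ w p k) u)

/-- The gradient of the vector field `V^i ∂_i`, a `(2,0)` tensor field with components
`∑_k g^{kj} (∂_k V^i + V^p Γ^i_{pk})`. -/
def gradVec (Φ : E2 → E3) (V : Fin 2 → E2 → ℝ) (u : E2) : Matrix (Fin 2) (Fin 2) ℝ :=
  Matrix.of fun i j => ∑ k, (metric Φ u)⁻¹ k j *
    (pd k (V i) u + ∑ p, V p u * christoffel Φ i p k u)

/-- The Riemannian inner product of two vector fields. -/
def vecInner (Φ : E2 → E3) (V W : Fin 2 → E2 → ℝ) (u : E2) : ℝ :=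
  ∑ i, ∑ j, V i u * metric Φ u i j * W j u

/-- The Riemannian inner product `tr (a g bᵀ g)` of two `(2,0)` tensors. -/
def tensorInner (Φ : E2 → E3) (u : E2) (a b : Matrix (Fin 2) (Fin 2) ℝ) : ℝ :=
  (a * metric Φ u * b.transpose * metric Φ u).trace

/-- The Riemannian area density. -/
def density (Φ : E2 → E3) (u : E2) : ℝ := Real.sqrt (metric Φ u).det

/-- Least-squares coefficients of an ambient vector `τ` in the coordinate basis
`∂₁Φ, ∂₂Φ` at the parameter `w`, i.e. `(RᵀR)⁻¹ Rᵀ τ` with `R = [∂₁Φ(w), ∂₂Φ(w)]`. -/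
def lsCoeff (Φ : E2 → E3) (w : E2) (τ : E3) : Fin 2 → ℝ :=
  (metric Φ w)⁻¹.mulVec fun q => inner ℝ (pd q Φ w) τ

/-- The reference triangle. -/
def refTriangle : Set E2 := {u | 0 ≤ u 0 ∧ 0 ≤ u 1 ∧ u 0 + u 1 ≤ 1}

end

end Param

/-! ### Delaunay triangulations and least squares -/

/-- `𝒯` is (the set of triangles of) a Delaunay triangulation of the planar points
`v j`, `j ∈ K`. -/
structure IsDelaunay {ι : Type*} [DecidableEq ι] (v : ι → E2) (K : Finset ι)
    (𝒯 : Finset (Finset ι)) : Prop where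
  subset : ∀ s ∈ 𝒯, s ⊆ K
  card : ∀ s ∈ 𝒯, s.card = 3
  nondegenerate : ∀ s ∈ 𝒯, AffineIndependent ℝ (fun j : s => v j)
  cover : (⋃ s ∈ 𝒯, convexHull ℝ (v '' (s : Set ι))) = convexHull ℝ (v '' (K : Set ι))
  faces : ∀ s ∈ 𝒯, ∀ s' ∈ 𝒯, convexHull ℝ (v '' (s : Set ι)) ∩ convexHull ℝ (v '' (s' : Set ι))
    = convexHull ℝ (v '' ((s ∩ s' : Finset ι) : Set ι))
  emptyCircle : ∀ s ∈ 𝒯, ∃ (c : E2) (ρ : ℝ), (∀ j ∈ s, dist (v j) c = ρ) ∧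
    ∀ j ∈ K, ρ ≤ dist (v j) c

/-- The quadratic polynomial with the given coefficients. -/
noncomputable def quadPoly (c : Fin 6 → ℝ) (v : E2) : ℝ :=
  c 0 * v 0 ^ 2 + c 1 * v 1 ^ 2 + c 2 * (v 0 * v 1) + c 3 * v 0 + c 4 * v 1 + c 5

/-- The least-squares weight: `1` at the base point and `1/k` at the other neighbours. -/
noncomputable def lsWeight (k : ℕ) (s : ℝ) : ℝ := if s = 0 then 1 else 1 / (k : ℝ)

/-! ### The local curved mesh of a point cloud -/

/-- Tangent-plane coordinates, in the frame `t`, of the point `y` relative to the base point `x`. -/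
noncomputable def tangentCoord (t : OrthonormalBasis (Fin 3) ℝ E3) (x y : E3) : E2 :=
  !₂[inner ℝ (t 0) (y - x), inner ℝ (t 1) (y - x)]

/-- The graph parameterization `v ↦ x + v₁ t₁ + v₂ t₂ + f(v) t₃`. -/
noncomputable def graphMap (t : OrthonormalBasis (Fin 3) ℝ E3) (x : E3) (f : E2 → ℝ) (v : E2) :
    E3 :=
  x + v 0 • t 0 + v 1 • t 1 + f v • t 2

/-- A point cloud of `N` points on the surface `M`, together with everything that is constructed
from it: adapted orthonormal frames, `k` nearest neighbours, Delaunay triangulations of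
the projected neighbours, quadratic weighted least-squares fits, and the exact local graph charts
of `M`. Ties (equidistant neighbours, cocircular points) may be broken in any way. -/
structure CurvedMesh (M : Set E3) (N k : ℕ) where
  /-- the sample points -/
  x : Fin N → E3
  x_mem : ∀ i, x i ∈ M
  /-- orthonormal frames; the first two vectors are tangent to `M`, the third is normal -/
  t : Fin N → OrthonormalBasis (Fin 3) ℝ E3
  t_tangent : ∀ i, t i 0 ∈ tangentConeAt ℝ M (x i) ∧ t i 1 ∈ tangentConeAt ℝ M (x i)
  /-- the `k` nearest neighbours, the point itself included -/
  K : Fin N → Finset (Fin N)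
  self_mem : ∀ i, i ∈ K i
  K_card : ∀ i, (K i).card = k
  K_nearest : ∀ i, ∀ a ∈ K i, ∀ b ∉ K i, dist (x i) (x a) ≤ dist (x i) (x b)
  /-- the triangles of a Delaunay triangulation of the projected neighbours -/
  tri : Fin N → Finset (Finset (Fin N))
  tri_delaunay : ∀ i, IsDelaunay (fun j => tangentCoord (t i) (x i) (x j)) (K i) (tri i)
  /-- coefficients of the quadratic weighted least-squares fit of the normal components -/
  coef : Fin N → Fin 6 → ℝ
  coef_min : ∀ i, ∀ c : Fin 6 → ℝ,
    ∑ j ∈ K i, lsWeight k ‖x i - x j‖ *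
        (quadPoly (coef i) (tangentCoord (t i) (x i) (x j)) - inner ℝ (t i 2) (x j - x i)) ^ 2
      ≤ ∑ j ∈ K i, lsWeight k ‖x i - x j‖ *
        (quadPoly c (tangentCoord (t i) (x i) (x j)) - inner ℝ (t i 2) (x j - x i)) ^ 2
  /-- the height functions of the exact local graph charts of `M` -/
  z : Fin N → E2 → ℝ
  z_zero : ∀ i, z i 0 = 0
  z_chart : ∀ i, ∃ ρ : ℝ, (∀ j ∈ K i, ‖tangentCoord (t i) (x i) (x j)‖ < ρ) ∧
    ContDiffOn ℝ 3 (z i) (ball 0 ρ) ∧ ∀ v ∈ ball (0 : E2) ρ, graphMap (t i) (x i) (z i) v ∈ M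

namespace CurvedMesh

noncomputable section

variable {M : Set E3} {N k : ℕ} (X : CurvedMesh M N k)

/-- The fill distance `sup_{y ∈ M} min_j ‖y - x_j‖`. -/
def fill : ℝ := sSup ((fun y => infDist y (Set.range X.x)) '' M)

/-- The separation distance `½ min_{i ≠ j} ‖x_i - x_j‖`. -/
def sep : ℝ := (1 / 2) * sInf {d | ∃ i j, i ≠ j ∧ d = ‖X.x i - X.x j‖}

/-- The projection of `x_j` to the tangent plane at `x_i`. -/
def v (i j : Fin N) : E2 := tangentCoord (X.t i) (X.x i) (X.x j)

/-- The radius of the projected neighbourhood of `x_i`. -/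
def rad (i : Fin N) : ℝ := (X.K i).sup' ⟨i, X.self_mem i⟩ fun j => ‖X.v i j‖

/-- The first ring at `x_i`: the triangles `[0, v_j, v_l]` of the triangulation with vertex `x_i`,
each listed once, with `j < l`. -/
def ring (i : Fin N) : Finset (Fin N × Fin N) :=
  Finset.univ.filter fun p => p.1 < p.2 ∧ ({i, p.1, p.2} : Finset (Fin N)) ∈ X.tri i

/-- The patch over the triangle `[0, v_j, v_l]` of the graph of the height function `f i`,
parameterized by the reference triangle. -/
def patch (f : Fin N → E2 → ℝ) (i : Fin N) (p : Fin N × Fin N) (u : E2) : E3 :=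
  graphMap (X.t i) (X.x i) (f i) (u 0 • X.v i p.1 + u 1 • X.v i p.2)

/-- The hat function of node `m` on the triangle with vertices `i, p.1, p.2`. -/
def hat (i : Fin N) (p : Fin N × Fin N) (m : Fin N) (u : E2) : ℝ :=
  if m = i then 1 - u 0 - u 1 else if m = p.1 then u 0 else if m = p.2 then u 1 else 0

/-- The parameter of the vertex `m` of the triangle with vertices `i, p.1, p.2`. -/
def vertexParam (i : Fin N) (p : Fin N × Fin N) (m : Fin N) : E2 :=
  if m = i then 0 else if m = p.1 then EuclideanSpace.single 0 1
  else if m = p.2 then EuclideanSpace.single 1 1 else 0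

/-- Components, in the coordinates of the patch, of the nodal vector field `e_m t_κ^{(m)}`:
the hat function times the coefficients of `t_κ^{(m)}` in the coordinate basis at the node. -/
def nodalField (f : Fin N → E2 → ℝ) (i : Fin N) (p : Fin N × Fin N) (m : Fin N) (κ : Fin 2) :
    Fin 2 → E2 → ℝ :=
  fun q u => hat i p m u *
    Param.lsCoeff (X.patch f i p) (vertexParam i p m) (X.t m (Fin.castSucc κ)) q

/-- The mass matrix built from the patches of the height functions `f`. -/
def massMatrix (f : Fin N → E2 → ℝ) : Matrix (Fin N × Fin 2) (Fin N × Fin 2) ℝ :=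
  Matrix.of fun a b => ∑ p ∈ X.ring a.1, ∫ u in Param.refTriangle,
    Param.vecInner (X.patch f a.1 p)
      (X.nodalField f a.1 p a.1 a.2) (X.nodalField f a.1 p b.1 b.2) u
    * Param.density (X.patch f a.1 p) u

/-- The Bochner stiffness matrix built from the patches of the height functions `f`. -/
def stiffnessMatrix (f : Fin N → E2 → ℝ) : Matrix (Fin N × Fin 2) (Fin N × Fin 2) ℝ :=
  Matrix.of fun a b => ∑ p ∈ X.ring a.1, ∫ u in Param.refTriangle,
    Param.tensorInner (X.patch f a.1 p) u
      (Param.gradVec (X.patch f a.1 p) (X.nodalField f a.1 p a.1 a.2) u)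
      (Param.gradVec (X.patch f a.1 p) (X.nodalField f a.1 p b.1 b.2) u)
    * Param.density (X.patch f a.1 p) u

/-- Symmetrized stiffness matrix of the exact charts. -/
def A : Matrix (Fin N × Fin 2) (Fin N × Fin 2) ℝ :=
  (1 / 2 : ℝ) • (X.stiffnessMatrix X.z + (X.stiffnessMatrix X.z).transpose)

/-- Symmetrized mass matrix of the exact charts. -/
def B : Matrix (Fin N × Fin 2) (Fin N × Fin 2) ℝ :=
  (1 / 2 : ℝ) • (X.massMatrix X.z + (X.massMatrix X.z).transpose)

/-- The fitted quadratic height functions. -/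
def fit (i : Fin N) : E2 → ℝ := quadPoly (X.coef i)

/-- Symmetrized stiffness matrix of the curved mesh. -/
def Ahat : Matrix (Fin N × Fin 2) (Fin N × Fin 2) ℝ :=
  (1 / 2 : ℝ) • (X.stiffnessMatrix X.fit + (X.stiffnessMatrix X.fit).transpose)

/-- Symmetrized mass matrix of the curved mesh. -/
def Bhat : Matrix (Fin N × Fin 2) (Fin N × Fin 2) ℝ :=
  (1 / 2 : ℝ) • (X.massMatrix X.fit + (X.massMatrix X.fit).transpose)

end

end CurvedMesh

/-! ### Symmetric-definite pencils -/

/-- The spectral norm of a square matrix. -/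
noncomputable def specNorm {n : Type*} [Fintype n] [DecidableEq n] (A : Matrix n n ℝ) : ℝ :=
  ‖Matrix.toEuclideanCLM (n := n) (𝕜 := ℝ) A‖

/-- The size `(‖Â - A‖₂² + ‖B̂ - B‖₂²)^{1/2}` of the perturbation of the pencil `A - λ B`. -/
noncomputable def pencilDist {n : Type*} [Fintype n] [DecidableEq n] (A B A' B' : Matrix n n ℝ) :
    ℝ :=
  Real.sqrt (specNorm (A' - A) ^ 2 + specNorm (B' - B) ^ 2)

/-- The number `min_{‖x‖ = 1} (xᵀ A x)² + (xᵀ B x)²`. -/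
noncomputable def crawford {n : Type*} [Fintype n] (A B : Matrix n n ℝ) : ℝ :=
  sInf ((fun x : EuclideanSpace ℝ n =>
    (x.ofLp ⬝ᵥ A.mulVec x.ofLp) ^ 2 + (x.ofLp ⬝ᵥ B.mulVec x.ofLp) ^ 2) '' sphere 0 1)

/-- `μ` lists the eigenvalues of the pencil `A - λ B` in non-increasing order, with multiplicity:
there is a basis of generalized eigenvectors `A w_ℓ = μ_ℓ B w_ℓ`. With `B = 1`, these are the
ordinary eigenvalues of `A`. -/
def IsPencilSpectrum {N : ℕ} (A B : Matrix (Fin N × Fin 2) (Fin N × Fin 2) ℝ)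
    (μ : Fin (2 * N) → ℝ) : Prop :=
  Antitone μ ∧ ∃ w : Fin (2 * N) → Fin N × Fin 2 → ℝ,
    LinearIndependent ℝ w ∧ ∀ l, A.mulVec (w l) = μ l • B.mulVec (w l)

/-! The exact and the fitted mesh are both compared with the mesh of flat triangles, given by the
height function `0` over the same rings. Let `h` be the fill distance. Quasi-uniformity and the
empty circumcircles of the Delaunay triangles make the first ring of a vertex shape regular of
size `O(h)`. Over it the exact heights and the fitted quadratics have bounded Hessians and
gradients `O(√h)`: for the exact heights this is the implicit function theorem, for the fits it
follows from the minimality of the fit and the equivalence of the discrete and the coefficient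
norms of quadratic polynomials on a quasi-uniform cloud. The gradient enters the metric
quadratically, so the metric, its inverse, its density, the Christoffel symbols and the nodal
fields all agree with their flat counterparts up to a relative error `O(h)`, and so do the entries
of the two matrices. A vertex interacts with boundedly many others, hence the Schur test turns the
bound on the entries into a bound on the spectral norm.

For the eigenvalues, the span of the eigenvectors of the first pencil with the `l` largest
eigenvalues meets the span of the eigenvectors of the second pencil with the remaining ones and the
`l`-th. On a common unit vector the points `(xᵀAx, xᵀBx)` of the two pencils are at distance at most
`ε`, and are separated by the lines whose slopes are the two `l`-th eigenvalues, which bounds the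
angle between these lines. The factor `κ` absorbs the passage from the sine to the tangent of that
angle; it exists since the Crawford number is at most a sum of squared diagonal entries, which are
`O(1)`. -/

/-! ### Eigenvalues of definite pencils -/

open scoped Matrix

section Pencil

variable {n ι κ : Type*} [Fintype n] {A B : Matrix n n ℝ}

lemma dotProduct_mulVec_comm_of_isHermitian (hA : A.IsHermitian) (x y : n → ℝ) :
    x ⬝ᵥ A *ᵥ y = y ⬝ᵥ A *ᵥ x := by
  rw [← Matrix.dotProduct_transpose_mulVec, ← Matrix.conjTranspose_eq_transpose_of_trivial, hA.eq]

lemma dotProduct_mulVec_eq_zero_of_pencil_eigenvalue_ne (hA : A.IsHermitian) (hB : B.IsHermitian)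
    {x y : n → ℝ} {μ ν : ℝ} (hx : A *ᵥ x = μ • B *ᵥ x) (hy : A *ᵥ y = ν • B *ᵥ y) (h : μ ≠ ν) :
    x ⬝ᵥ B *ᵥ y = 0 := by
  have hcomm := dotProduct_mulVec_comm_of_isHermitian hA x y
  rw [hx, hy, dotProduct_smul, dotProduct_smul, dotProduct_mulVec_comm_of_isHermitian hB y x,
    smul_eq_mul, smul_eq_mul] at hcomm
  have hprod : (ν - μ) * (x ⬝ᵥ B *ᵥ y) = 0 := by linarith
  exact (mul_eq_zero.1 hprod).resolve_left (sub_ne_zero.2 h.symm)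

lemma quadForm_sum_smul [Fintype ι] (B : Matrix n n ℝ) (w : ι → n → ℝ) (c : ι → ℝ) :
    (∑ l, c l • w l) ⬝ᵥ B *ᵥ (∑ l, c l • w l)
      = ∑ l, ∑ m, c l * c m * (w l ⬝ᵥ B *ᵥ w m) := by
  rw [Matrix.mulVec_sum, sum_dotProduct]
  refine Finset.sum_congr rfl fun l _ => ?_
  rw [dotProduct_sum]
  refine Finset.sum_congr rfl fun m _ => ?_
  rw [Matrix.mulVec_smul, dotProduct_smul, smul_dotProduct, smul_eq_mul, smul_eq_mul]
  ring

lemma quadForm_le_of_mem_span_pencil_eigenvectors [Finite ι] (hA : A.IsHermitian)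
    (hB : B.PosSemidef) {w : ι → n → ℝ} {μ : ι → ℝ} (hw : ∀ l, A *ᵥ w l = μ l • B *ᵥ w l)
    {s : ℝ} (hs : ∀ l, μ l ≤ s) {x : n → ℝ} (hx : x ∈ Submodule.span ℝ (Set.range w)) :
    x ⬝ᵥ A *ᵥ x ≤ s * (x ⬝ᵥ B *ᵥ x) := by
  cases nonempty_fintype ι
  obtain ⟨c, rfl⟩ := (Submodule.mem_span_range_iff_exists_fun ℝ).1 hx
  -- Since eigenvectors of different eigenvalues are `B`-orthogonal, the difference of the two sides
  -- is the quadratic form of `B` at the combination with coefficients `√(s - μ l) * c l`.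
  have hnonneg := hB.dotProduct_mulVec_nonneg (∑ l, (√(s - μ l) * c l) • w l)
  rw [star_trivial, quadForm_sum_smul] at hnonneg
  rw [quadForm_sum_smul, quadForm_sum_smul, ← sub_nonneg, Finset.mul_sum,
    ← Finset.sum_sub_distrib]
  refine hnonneg.trans_eq (Finset.sum_congr rfl fun l _ => ?_)
  rw [Finset.mul_sum, ← Finset.sum_sub_distrib]
  refine Finset.sum_congr rfl fun m _ => ?_
  rw [hw m, dotProduct_smul, smul_eq_mul]
  by_cases h : μ l = μ m
  · have hsqrt : √(s - μ l) * √(s - μ m) = s - μ m := by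
      rw [h, Real.mul_self_sqrt (sub_nonneg.2 (hs m))]
    linear_combination (c l * c m * (w l ⬝ᵥ B *ᵥ w m)) * hsqrt
  · rw [dotProduct_mulVec_eq_zero_of_pencil_eigenvalue_ne hA hB.1 (hw l) (hw m) h]
    ring

lemma le_quadForm_of_mem_span_pencil_eigenvectors [Finite ι] (hA : A.IsHermitian)
    (hB : B.PosSemidef) {w : ι → n → ℝ} {μ : ι → ℝ} (hw : ∀ l, A *ᵥ w l = μ l • B *ᵥ w l)
    {s : ℝ} (hs : ∀ l, s ≤ μ l) {x : n → ℝ} (hx : x ∈ Submodule.span ℝ (Set.range w)) :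
    s * (x ⬝ᵥ B *ᵥ x) ≤ x ⬝ᵥ A *ᵥ x := by
  have h := quadForm_le_of_mem_span_pencil_eigenvectors hA.neg hB (μ := fun l => -μ l)
    (fun l => by rw [Matrix.neg_mulVec, hw, neg_smul]) (fun l => neg_le_neg (hs l)) hx
  rw [Matrix.neg_mulVec, dotProduct_neg] at h
  linarith

lemma exists_ne_zero_mem_span_inter_span {K V : Type*} [Fintype ι] [Fintype κ] [Field K]
    [AddCommGroup V] [Module K V] [FiniteDimensional K V] {w : ι → V} {w' : κ → V}
    (hw : LinearIndependent K w) (hw' : LinearIndependent K w')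
    (h : Module.finrank K V < Fintype.card ι + Fintype.card κ) :
    ∃ x ≠ 0, x ∈ Submodule.span K (Set.range w) ∧ x ∈ Submodule.span K (Set.range w') := by
  by_contra! hc
  have hdisj : Disjoint (Submodule.span K (Set.range w)) (Submodule.span K (Set.range w')) :=
    Submodule.disjoint_def.2 fun x hx hx' => by_contra fun h0 => hc x h0 hx hx'
  have hle := Submodule.finrank_add_finrank_le_of_disjoint hdisj
  rw [finrank_span_eq_card hw, finrank_span_eq_card hw'] at hle
  omega

end Pencil

section SpecNorm

variable {n : Type*} [Fintype n]

lemma ofLp_ne_zero_of_norm_eq_one {x : EuclideanSpace ℝ n} (hx : ‖x‖ = 1) : x.ofLp ≠ 0 := by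
  rw [Ne, WithLp.ofLp_eq_zero, ← norm_eq_zero, hx]
  exact one_ne_zero

lemma quadForm_pos_of_norm_eq_one {A : Matrix n n ℝ} (hA : A.PosDef) {x : EuclideanSpace ℝ n}
    (hx : ‖x‖ = 1) : 0 < x.ofLp ⬝ᵥ A *ᵥ x.ofLp := by
  simpa only [star_trivial] using hA.dotProduct_mulVec_pos (ofLp_ne_zero_of_norm_eq_one hx)

lemma crawford_le (A B : Matrix n n ℝ) {x : EuclideanSpace ℝ n} (hx : ‖x‖ = 1) :
    crawford A B ≤ (x.ofLp ⬝ᵥ A *ᵥ x.ofLp) ^ 2 + (x.ofLp ⬝ᵥ B *ᵥ x.ofLp) ^ 2 :=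
  csInf_le ⟨0, by rintro _ ⟨y, -, rfl⟩; positivity⟩ ⟨x, mem_sphere_zero_iff_norm.2 hx, rfl⟩

lemma mulVec_sq_le_of_sparse {E : Matrix n n ℝ} {near : n → n → Prop} [DecidableRel near] {δ r : ℝ}
    (hcard : ∀ a, ((Finset.univ.filter (near a)).card : ℝ) ≤ r)
    (hE : ∀ a b, |E a b| ≤ δ) (hE0 : ∀ a b, ¬ near a b → E a b = 0) (x : n → ℝ) (a : n) :
    (E *ᵥ x) a ^ 2 ≤ r * δ ^ 2 * ∑ b with near a b, x b ^ 2 := by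
  have hrow : (E *ᵥ x) a = ∑ b with near a b, E a b * x b :=
    (Finset.sum_filter_of_ne fun b _ hb =>
      by_contra fun h => hb (mul_eq_zero_of_left (hE0 a b h) _)).symm
  have hentry (b : n) : (E a b * x b) ^ 2 ≤ δ ^ 2 * x b ^ 2 := by
    rw [mul_pow]
    exact mul_le_mul_of_nonneg_right (sq_le_sq' (neg_le_of_abs_le (hE a b))
      (le_of_abs_le (hE a b))) (sq_nonneg _)
  calc (E *ᵥ x) a ^ 2
      ≤ ((Finset.univ.filter (near a)).card : ℝ) * ∑ b with near a b, (E a b * x b) ^ 2 := by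
        rw [hrow]
        exact sq_sum_le_card_mul_sum_sq
    _ ≤ r * ∑ b with near a b, δ ^ 2 * x b ^ 2 := by
        exact mul_le_mul (hcard a) (Finset.sum_le_sum fun b _ => hentry b)
          (Finset.sum_nonneg fun b _ => sq_nonneg _) ((Nat.cast_nonneg _).trans (hcard a))
    _ = r * δ ^ 2 * ∑ b with near a b, x b ^ 2 := by rw [← Finset.mul_sum, mul_assoc]

variable [DecidableEq n]

lemma quadForm_one_of_norm_eq_one {x : EuclideanSpace ℝ n} (hx : ‖x‖ = 1) :
    x.ofLp ⬝ᵥ (1 : Matrix n n ℝ) *ᵥ x.ofLp = 1 := by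
  rw [Matrix.one_mulVec, ← one_pow 2, ← hx, EuclideanSpace.real_norm_sq_eq, dotProduct]
  exact Finset.sum_congr rfl fun i _ => (sq _).symm

lemma quadForm_eq_inner_toEuclideanCLM (E : Matrix n n ℝ) (x : EuclideanSpace ℝ n) :
    x.ofLp ⬝ᵥ E *ᵥ x.ofLp = inner ℝ x (Matrix.toEuclideanCLM (n := n) (𝕜 := ℝ) E x) := by
  rw [PiLp.inner_apply, Matrix.ofLp_toEuclideanCLM, dotProduct]
  exact Finset.sum_congr rfl fun i _ => mul_comm _ _

lemma specNorm_nonneg (E : Matrix n n ℝ) : 0 ≤ specNorm E := norm_nonneg _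

lemma pencilDist_nonneg (A B A' B' : Matrix n n ℝ) : 0 ≤ pencilDist A B A' B' :=
  Real.sqrt_nonneg _

lemma pencilDist_le_add (A B A' B' : Matrix n n ℝ) :
    pencilDist A B A' B' ≤ specNorm (A' - A) + specNorm (B' - B) := by
  rw [pencilDist, Real.sqrt_le_left (add_nonneg (specNorm_nonneg _) (specNorm_nonneg _))]
  nlinarith [mul_nonneg (specNorm_nonneg (A' - A)) (specNorm_nonneg (B' - B))]

lemma abs_quadForm_le_specNorm (E : Matrix n n ℝ) (x : EuclideanSpace ℝ n) :
    |x.ofLp ⬝ᵥ E *ᵥ x.ofLp| ≤ specNorm E * ‖x‖ ^ 2 := by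
  rw [quadForm_eq_inner_toEuclideanCLM]
  calc _ ≤ ‖x‖ * ‖Matrix.toEuclideanCLM (n := n) (𝕜 := ℝ) E x‖ := abs_real_inner_le_norm _ _
    _ ≤ ‖x‖ * (specNorm E * ‖x‖) := by gcongr; exact ContinuousLinearMap.le_opNorm _ _
    _ = specNorm E * ‖x‖ ^ 2 := by ring

lemma quadForm_sub_sq_add_sq_le_pencilDist_sq (A B A' B' : Matrix n n ℝ) {x : EuclideanSpace ℝ n}
    (hx : ‖x‖ = 1) :
    (x.ofLp ⬝ᵥ A' *ᵥ x.ofLp - x.ofLp ⬝ᵥ A *ᵥ x.ofLp) ^ 2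
      + (x.ofLp ⬝ᵥ B' *ᵥ x.ofLp - x.ofLp ⬝ᵥ B *ᵥ x.ofLp) ^ 2 ≤ pencilDist A B A' B' ^ 2 := by
  have sq_le (E E' : Matrix n n ℝ) : (x.ofLp ⬝ᵥ E' *ᵥ x.ofLp - x.ofLp ⬝ᵥ E *ᵥ x.ofLp) ^ 2
      ≤ specNorm (E' - E) ^ 2 := by
    have h := abs_quadForm_le_specNorm (E' - E) x
    rw [hx, one_pow, mul_one, Matrix.sub_mulVec, dotProduct_sub] at h
    exact sq_le_sq' (neg_le_of_abs_le h) (le_of_abs_le h)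
  rw [pencilDist, Real.sq_sqrt (by positivity)]
  exact add_le_add (sq_le A A') (sq_le B B')

lemma specNorm_le_of_sparse {E : Matrix n n ℝ} {near : n → n → Prop} [DecidableRel near] {δ r : ℝ}
    (hsymm : ∀ a b, near a b ↔ near b a) (hδ : 0 ≤ δ) (hr : 0 ≤ r)
    (hcard : ∀ a, ((Finset.univ.filter (near a)).card : ℝ) ≤ r)
    (hE : ∀ a b, |E a b| ≤ δ) (hE0 : ∀ a b, ¬ near a b → E a b = 0) :
    specNorm E ≤ r * δ := by
  refine ContinuousLinearMap.opNorm_le_bound _ (by positivity) fun x => ?_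
  refine le_of_sq_le_sq ?_ (by positivity)
  rw [mul_pow, EuclideanSpace.real_norm_sq_eq, EuclideanSpace.real_norm_sq_eq,
    Matrix.ofLp_toEuclideanCLM]
  have hcolumn (b : n) : ∑ a, (if near a b then x.ofLp b ^ 2 else 0) ≤ r * x.ofLp b ^ 2 := by
    rw [← Finset.sum_filter, Finset.sum_const, nsmul_eq_mul]
    gcongr
    simpa only [hsymm b] using hcard b
  calc ∑ a, (E *ᵥ x.ofLp) a ^ 2
      ≤ ∑ a, r * δ ^ 2 * ∑ b with near a b, x.ofLp b ^ 2 :=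
        Finset.sum_le_sum fun a _ => mulVec_sq_le_of_sparse hcard hE hE0 x.ofLp a
    _ = r * δ ^ 2 * ∑ b, ∑ a, (if near a b then x.ofLp b ^ 2 else 0) := by
        simp only [← Finset.mul_sum, Finset.sum_filter]
        rw [Finset.sum_comm]
    _ ≤ r * δ ^ 2 * ∑ b, r * x.ofLp b ^ 2 := by
        gcongr with b
        exact hcolumn b
    _ = (r * δ) ^ 2 * ∑ b, x.ofLp b ^ 2 := by rw [← Finset.mul_sum]; ring

end SpecNorm

section Slope

variable {α β α' β' ν s ε γ : ℝ}

lemma sq_sub_mul_le_of_mul_nonpos (h : (α - ν * β) * (α' - ν * β') ≤ 0) :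
    (α - ν * β) ^ 2 ≤ ((α' - α) ^ 2 + (β' - β) ^ 2) * (1 + ν ^ 2) := by
  calc (α - ν * β) ^ 2 ≤ ((α' - α) - ν * (β' - β)) ^ 2 := by nlinarith [sq_nonneg (α' - ν * β')]
    _ ≤ ((α' - α) ^ 2 + (β' - β) ^ 2) * (1 + ν ^ 2) := by
      nlinarith [sq_nonneg (ν * (α' - α) + (β' - β))]

lemma abs_slope_sub_mul_le (hβ : 0 < β) (hs : 0 < s) (hν : 0 < β + ν * α)
    (h : (s < ν ∧ α ≤ s * β) ∨ (ν < s ∧ s * β ≤ α)) :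
    0 < 1 + s * ν ∧ |s - ν| * (β + ν * α) ≤ |α - ν * β| * (1 + s * ν) := by
  rcases h with ⟨hlt, hle⟩ | ⟨hlt, hle⟩
  · have hν0 : 0 < ν := hs.trans hlt
    refine ⟨by positivity, ?_⟩
    rw [abs_of_neg (sub_neg.2 hlt), abs_of_neg (by nlinarith)]
    nlinarith [mul_nonneg (sub_nonneg.2 hle) (by positivity : 0 ≤ 1 + ν ^ 2)]
  · refine ⟨?_, ?_⟩
    · by_contra! hneg
      have hν0 : ν ≤ 0 := by by_contra! h0; nlinarith [mul_pos hs h0]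
      nlinarith [mul_nonneg_of_nonpos_of_nonpos hν0 (sub_nonpos.2 hle)]
    · rw [abs_of_pos (sub_pos.2 hlt), abs_of_pos (by nlinarith)]
      nlinarith [mul_nonneg (sub_nonneg.2 hle) (by positivity : 0 ≤ 1 + ν ^ 2)]

/-- A perturbation of size `ε` turns a vector of length at least `√γ` by an angle whose tangent is
at most `ε / √(γ - ε ^ 2)`, and `|s - ν| / |1 + s * ν|` is the tangent of the angle between the
lines of slopes `s` and `ν`, which separate the two points. -/
lemma abs_slope_sub_mul_sqrt_le (hβ : 0 < β) (hα : 0 < α) (hβ' : 0 < β') (hs : 0 < s)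
    (hε : 0 ≤ ε) (hεγ : ε ^ 2 < γ) (hdist : (α' - α) ^ 2 + (β' - β) ^ 2 ≤ ε ^ 2)
    (hγ : γ ≤ α ^ 2 + β ^ 2)
    (h : (s < ν ∧ α ≤ s * β ∧ ν * β' ≤ α') ∨ (ν < s ∧ s * β ≤ α ∧ α' ≤ ν * β')) :
    |s - ν| * √(γ - ε ^ 2) ≤ ε * |1 + s * ν| := by
  have hpos : 0 < β + ν * α := by
    rcases h with ⟨hlt, -, -⟩ | ⟨-, -, hle⟩
    · have := hs.trans hlt
      positivity
    · have hinner : 0 < β * β' + α * α' := by nlinarith [sq_nonneg α', sq_nonneg β']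
      have hle' : β * β' + α * α' ≤ β' * (β + ν * α) := by nlinarith
      exact pos_of_mul_pos_right (hinner.trans_le hle') hβ'.le
  have hopposite : (α - ν * β) * (α' - ν * β') ≤ 0 := by
    rcases h with ⟨hlt, h1, h2⟩ | ⟨hlt, h1, h2⟩
    · exact mul_nonpos_of_nonpos_of_nonneg (by nlinarith) (sub_nonneg.2 h2)
    · exact mul_nonpos_of_nonneg_of_nonpos (by nlinarith) (sub_nonpos.2 h2)
  obtain ⟨hden, hslope⟩ := abs_slope_sub_mul_le hβ hs hpos
    (h.imp (fun h => ⟨h.1, h.2.1⟩) fun h => ⟨h.1, h.2.1⟩)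
  have hdev : |α - ν * β| * √(γ - ε ^ 2) ≤ ε * (β + ν * α) := by
    refine le_of_sq_le_sq ?_ (by positivity)
    rw [mul_pow, sq_abs, Real.sq_sqrt (sub_nonneg.2 hεγ.le)]
    have hsq : (α - ν * β) ^ 2 ≤ ε ^ 2 * (1 + ν ^ 2) :=
      (sq_sub_mul_le_of_mul_nonpos hopposite).trans (by gcongr)
    calc (α - ν * β) ^ 2 * (γ - ε ^ 2)
        ≤ ε ^ 2 * ((1 + ν ^ 2) * (α ^ 2 + β ^ 2)) - ε ^ 2 * (α - ν * β) ^ 2 := by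
          nlinarith [mul_le_mul_of_nonneg_right hsq ((sq_nonneg ε).trans hεγ.le),
            mul_le_mul_of_nonneg_left hγ (by positivity : 0 ≤ ε ^ 2 * (1 + ν ^ 2))]
      _ = (ε * (β + ν * α)) ^ 2 := by ring
  rw [abs_of_pos hden]
  refine le_of_mul_le_mul_right ?_ hpos
  calc |s - ν| * √(γ - ε ^ 2) * (β + ν * α)
      = |s - ν| * (β + ν * α) * √(γ - ε ^ 2) := by ring
    _ ≤ |α - ν * β| * (1 + s * ν) * √(γ - ε ^ 2) := by gcongr
    _ = |α - ν * β| * √(γ - ε ^ 2) * (1 + s * ν) := by ring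
    _ ≤ ε * (β + ν * α) * (1 + s * ν) := by gcongr
    _ = ε * (1 + s * ν) * (β + ν * α) := by ring

end Slope

namespace IsPencilSpectrum

variable {N : ℕ} {A B A' B' : Matrix (Fin N × Fin 2) (Fin N × Fin 2) ℝ}
  {lam lam' a b : Fin (2 * N) → ℝ}

lemma exists_quadForm_le_and_ge (hA : A.IsHermitian) (hB : B.PosSemidef) (hA' : A'.IsHermitian)
    (hB' : B'.PosSemidef) (h : IsPencilSpectrum A B lam) (h' : IsPencilSpectrum A' B' lam')
    (l : Fin (2 * N)) :
    ∃ x : EuclideanSpace ℝ (Fin N × Fin 2), ‖x‖ = 1 ∧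
      x.ofLp ⬝ᵥ A *ᵥ x.ofLp ≤ lam l * (x.ofLp ⬝ᵥ B *ᵥ x.ofLp) ∧
      lam' l * (x.ofLp ⬝ᵥ B' *ᵥ x.ofLp) ≤ x.ofLp ⬝ᵥ A' *ᵥ x.ofLp := by
  obtain ⟨hanti, w, hw, hwe⟩ := h
  obtain ⟨hanti', w', hw', hwe'⟩ := h'
  obtain ⟨x, hx0, hx, hx'⟩ := exists_ne_zero_mem_span_inter_span
    (hw.comp (Subtype.val : Finset.Ici l → _) Subtype.val_injective)
    (hw'.comp (Subtype.val : Finset.Iic l → _) Subtype.val_injective) (by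
      simp only [Module.finrank_fintype_fun_eq_card, Fintype.card_prod, Fintype.card_fin,
        Fintype.card_coe, Fin.card_Ici, Fin.card_Iic]
      omega)
  have hne : (WithLp.toLp 2 x : EuclideanSpace ℝ (Fin N × Fin 2)) ≠ 0 := by simpa using hx0
  refine ⟨‖(WithLp.toLp 2 x : EuclideanSpace ℝ (Fin N × Fin 2))‖⁻¹ • WithLp.toLp 2 x,
    norm_smul_inv_norm hne, ?_, ?_⟩
  · exact quadForm_le_of_mem_span_pencil_eigenvectors hA hB (fun m : Finset.Ici l => hwe m)
      (fun m => hanti (Finset.mem_Ici.1 m.2)) (Submodule.smul_mem _ _ hx)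
  · exact le_quadForm_of_mem_span_pencil_eigenvectors hA' hB' (fun m : Finset.Iic l => hwe' m)
      (fun m => hanti' (Finset.mem_Iic.1 m.2)) (Submodule.smul_mem _ _ hx')

lemma pos (hA : A.PosDef) (hB : B.PosSemidef) (h : IsPencilSpectrum A B lam) (l : Fin (2 * N)) :
    0 < lam l := by
  obtain ⟨x, hx, hle, -⟩ := h.exists_quadForm_le_and_ge hA.1 hB hA.1 hB h l
  exact pos_of_mul_pos_left ((quadForm_pos_of_norm_eq_one hA hx).trans_le hle)
    (by simpa only [star_trivial] using hB.dotProduct_mulVec_nonneg x.ofLp)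

theorem abs_sub_mul_sqrt_le (hA : A.PosDef) (hB : B.PosDef) (hA' : A'.IsHermitian)
    (hB' : B'.PosDef) (h : IsPencilSpectrum A B lam) (h' : IsPencilSpectrum A' B' lam')
    (hgap : pencilDist A B A' B' ^ 2 < crawford A B) (l : Fin (2 * N)) :
    |lam l - lam' l| * √(crawford A B - pencilDist A B A' B' ^ 2)
      ≤ pencilDist A B A' B' * |1 + lam l * lam' l| := by
  have of_crossing {x : EuclideanSpace ℝ (Fin N × Fin 2)} (hx : ‖x‖ = 1) :=
    abs_slope_sub_mul_sqrt_le (ν := lam' l) (quadForm_pos_of_norm_eq_one hB hx)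
      (quadForm_pos_of_norm_eq_one hA hx) (quadForm_pos_of_norm_eq_one hB' hx)
      (h.pos hA hB.posSemidef l) (pencilDist_nonneg A B A' B') hgap
      (quadForm_sub_sq_add_sq_le_pencilDist_sq A B A' B' hx) (crawford_le A B hx)
  rcases lt_trichotomy (lam l) (lam' l) with hlt | heq | hlt
  · obtain ⟨x, hx, hle, hge⟩ := h.exists_quadForm_le_and_ge hA.1 hB.posSemidef hA'
      hB'.posSemidef h' l
    exact of_crossing hx (Or.inl ⟨hlt, hle, hge⟩)
  · rw [heq, sub_self, abs_zero, zero_mul]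
    exact mul_nonneg (pencilDist_nonneg A B A' B') (abs_nonneg _)
  · obtain ⟨x, hx, hle, hge⟩ := h'.exists_quadForm_le_and_ge hA' hB'.posSemidef hA.1
      hB.posSemidef h l
    exact of_crossing hx (Or.inr ⟨hlt, hge, hle⟩)

lemma le_quadForm (hA : A.IsHermitian) (ha : IsPencilSpectrum A 1 a) {c : ℝ} (hc : ∀ l, c ≤ a l)
    {x : EuclideanSpace ℝ (Fin N × Fin 2)} (hx : ‖x‖ = 1) : c ≤ x.ofLp ⬝ᵥ A *ᵥ x.ofLp := by
  obtain ⟨-, w, hw, hwe⟩ := ha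
  have htop : Submodule.span ℝ (Set.range w) = ⊤ :=
    hw.span_eq_top_of_card_eq_finrank' (by simp [mul_comm])
  have hle := le_quadForm_of_mem_span_pencil_eigenvectors hA Matrix.PosSemidef.one hwe hc
    (x := x.ofLp) (htop ▸ Submodule.mem_top)
  rwa [quadForm_one_of_norm_eq_one hx, mul_one] at hle

lemma lt_crawford (hA : A.PosDef) (hB : B.PosDef) (ha : IsPencilSpectrum A 1 a)
    (hb : IsPencilSpectrum B 1 b) {m : Fin (2 * N)} (hm : IsTop m) {s : ℝ}
    (hs : s < a m ^ 2 + b m ^ 2) : s < crawford A B := by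
  have : Nonempty (Fin N × Fin 2) := ⟨(⟨0, by have := m.pos; omega⟩, 0)⟩
  refine hs.trans_le (le_csInf ((NormedSpace.sphere_nonempty.2 zero_le_one).image _) ?_)
  rintro _ ⟨x, hx, rfl⟩
  have hx' : ‖x‖ = 1 := mem_sphere_zero_iff_norm.1 hx
  have ham := ha.le_quadForm hA.1 (fun l => ha.1 (hm l)) hx'
  have hbm := hb.le_quadForm hB.1 (fun l => hb.1 (hm l)) hx'
  have ha0 := (ha.pos hA Matrix.PosSemidef.one m).le
  have hb0 := (hb.pos hB Matrix.PosSemidef.one m).le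
  dsimp only
  gcongr

theorem abs_sub_le (hA : A.PosDef) (hB : B.PosDef) (hA' : A'.IsHermitian) (hB' : B'.PosDef)
    (ha : IsPencilSpectrum A 1 a) (hb : IsPencilSpectrum B 1 b)
    (h : IsPencilSpectrum A B lam) (h' : IsPencilSpectrum A' B' lam') {κ η : ℝ} (hκ : 1 ≤ κ)
    (hcrawford : crawford A B ≤ κ ^ 2 - 1) (hη : κ * pencilDist A B A' B' ≤ η)
    (hgap : ∀ l, η ^ 2 < a l ^ 2 + b l ^ 2) (l : Fin (2 * N)) :
    |lam l - lam' l| ≤ η / crawford A B * |1 + lam l * lam' l| := by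
  have hε0 := pencilDist_nonneg A B A' B'
  have hηγ : η ^ 2 < crawford A B :=
    lt_crawford hA hB ha hb (m := ⟨2 * N - 1, by have := l.pos; omega⟩)
      (fun j => Fin.le_def.2 (by simp only; omega)) (hgap _)
  have hbound := h.abs_sub_mul_sqrt_le hA hB hA' hB' h'
  set ε := pencilDist A B A' B'
  set γ := crawford A B
  have hκε : κ ^ 2 * ε ^ 2 < γ := by
    rw [← mul_pow]
    exact (pow_le_pow_left₀ (by positivity) hη 2).trans_lt hηγ
  have hεγ : ε ^ 2 < γ := lt_of_le_of_lt (by nlinarith [sq_nonneg ε]) hκε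
  have hγ : 0 < γ := (sq_nonneg _).trans_lt hεγ
  -- `crawford A B ≤ κ ^ 2 - 1` turns the tangent `ε / √(γ - ε ^ 2)` into `κ * ε / γ`.
  have hγκ : γ ≤ κ * √(γ - ε ^ 2) := by
    refine le_of_sq_le_sq ?_ (by positivity)
    rw [mul_pow, Real.sq_sqrt (sub_pos.2 hεγ).le]
    nlinarith
  rw [div_mul_eq_mul_div, le_div_iff₀ hγ]
  calc |lam l - lam' l| * γ ≤ |lam l - lam' l| * (κ * √(γ - ε ^ 2)) := by gcongr
    _ = κ * (|lam l - lam' l| * √(γ - ε ^ 2)) := by ring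
    _ ≤ κ * (ε * |1 + lam l * lam' l|) :=
      mul_le_mul_of_nonneg_left (hbound hεγ l) (by positivity)
    _ = κ * ε * |1 + lam l * lam' l| := by ring
    _ ≤ η * |1 + lam l * lam' l| := by gcongr

end IsPencilSpectrum

/-! ### Relative closeness at a length scale -/

section CloseCalculus

open Asymptotics Filter

variable {ι : Type*} {l : Filter ι} {h : ι → ℝ}

/-- `f` and `f₀` have order `h ^ a` and differ by one order less, that is by `O(h ^ (a + 1))`. With
`a` an integer, this relative `O(h)`-closeness of a quantity on a curved patch to the same quantity
on a flat one is preserved by products, quotients and square roots. -/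
structure Close (l : Filter ι) (h : ι → ℝ) (a : ℤ) (f f₀ : ι → ℝ) : Prop where
  isBigO : f =O[l] fun x => h x ^ a
  isBigO₀ : f₀ =O[l] fun x => h x ^ a
  isBigO_sub : (fun x => f x - f₀ x) =O[l] fun x => h x ^ (a + 1)

/-- The length scale `h` takes values in `(0, 1]`, so that higher powers of it are smaller. -/
def IsScale (l : Filter ι) (h : ι → ℝ) : Prop := ∀ᶠ x in l, 0 < h x ∧ h x ≤ 1

namespace IsScale

lemma zpow_isBigO (hh : IsScale l h) {a b : ℤ} (hab : b ≤ a) :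
    (fun x => h x ^ a) =O[l] fun x => h x ^ b := by
  refine IsBigO.of_bound 1 (hh.mono fun x hx => ?_)
  rw [one_mul, Real.norm_of_nonneg (zpow_nonneg hx.1.le _),
    Real.norm_of_nonneg (zpow_nonneg hx.1.le _)]
  exact zpow_le_zpow_right_of_le_one₀ hx.1 hx.2 hab

lemma isBigO_mul (hh : IsScale l h) {a b : ℤ} {f g : ι → ℝ}
    (hf : f =O[l] fun x => h x ^ a) (hg : g =O[l] fun x => h x ^ b) :
    (fun x => f x * g x) =O[l] fun x => h x ^ (a + b) :=
  (hf.mul hg).trans_eventuallyEq (hh.mono fun _ hx => (zpow_add₀ hx.1.ne' a b).symm)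

lemma isBigO_inv (hh : IsScale l h) {a : ℤ} {g : ι → ℝ} (hg : (fun x => h x ^ a) =O[l] g) :
    (fun x => (g x)⁻¹) =O[l] fun x => h x ^ (-a) := by
  simpa only [zpow_neg] using
    hg.inv_rev (hh.mono fun x hx h0 => absurd h0 (zpow_pos hx.1 a).ne')

lemma eventually_ne_zero (hh : IsScale l h) {a : ℤ} {g : ι → ℝ}
    (hg : (fun x => h x ^ a) =O[l] g) : ∀ᶠ x in l, g x ≠ 0 := by
  filter_upwards [hg.eq_zero_imp, hh] with x himp hx h0
  exact (zpow_pos hx.1 a).ne' (himp h0)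

lemma sqrt_zpow (hh : IsScale l h) (a : ℤ) :
    (fun x => √(h x ^ (a + a))) =ᶠ[l] fun x => h x ^ a :=
  hh.mono fun x hx => by
    simp only [zpow_add₀ hx.1.ne', Real.sqrt_mul_self (zpow_pos hx.1 a).le]

end IsScale

lemma abs_sqrt_sub_sqrt_le (x : ℝ) {y : ℝ} (hy : 0 < y) : |√x - √y| ≤ |x - y| * (√y)⁻¹ := by
  have hpos := Real.sqrt_pos.2 hy
  rw [← div_eq_mul_inv, le_div_iff₀ hpos]
  rcases le_total 0 x with hx | hx
  · have hfactor : x - y = (√x - √y) * (√x + √y) := by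
      linear_combination Real.sq_sqrt hy.le - Real.sq_sqrt hx
    rw [hfactor, abs_mul, abs_of_pos (add_pos_of_nonneg_of_pos (Real.sqrt_nonneg x) hpos)]
    gcongr
    exact le_add_of_nonneg_left (Real.sqrt_nonneg x)
  · rw [Real.sqrt_eq_zero_of_nonpos hx, zero_sub, abs_neg, abs_of_pos hpos,
      Real.mul_self_sqrt hy.le, abs_sub_comm]
    exact (le_sub_self_iff y).2 hx |>.trans (le_abs_self _)

namespace Close

variable {a b : ℤ} {f f₀ g g₀ : ι → ℝ}

lemma refl (hf : f =O[l] fun x => h x ^ a) : Close l h a f f :=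
  ⟨hf, hf, by simpa only [sub_self] using isBigO_zero _ _⟩

lemma zero : Close l h a (fun _ => (0 : ℝ)) fun _ => 0 := refl (isBigO_zero _ _)

lemma of_isBigO_sub (hh : IsScale l h) (h₀ : f₀ =O[l] fun x => h x ^ a)
    (hsub : (fun x => f x - f₀ x) =O[l] fun x => h x ^ (a + 1)) : Close l h a f f₀ :=
  ⟨by simpa only [sub_add_cancel] using (hsub.trans (hh.zpow_isBigO (by lia))).add h₀, h₀, hsub⟩

lemma zero_right (hh : IsScale l h) (hf : f =O[l] fun x => h x ^ (a + 1)) :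
    Close l h a f fun _ => 0 :=
  of_isBigO_sub hh (isBigO_zero _ _) (by simpa only [sub_zero] using hf)

lemma cast (hf : Close l h a f f₀) (hab : a = b) : Close l h b f f₀ := hab ▸ hf

lemma mono (hf : Close l h a f f₀) (hh : IsScale l h) (hab : b ≤ a) : Close l h b f f₀ :=
  ⟨hf.isBigO.trans (hh.zpow_isBigO hab), hf.isBigO₀.trans (hh.zpow_isBigO hab),
    hf.isBigO_sub.trans (hh.zpow_isBigO (by lia))⟩

lemma congr' (hf : Close l h a f f₀) (hfg : f =ᶠ[l] g) (hfg₀ : f₀ =ᶠ[l] g₀) :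
    Close l h a g g₀ :=
  ⟨hf.isBigO.congr' hfg .rfl, hf.isBigO₀.congr' hfg₀ .rfl,
    hf.isBigO_sub.congr' (hfg.sub hfg₀) .rfl⟩

lemma add (hf : Close l h a f f₀) (hg : Close l h a g g₀) :
    Close l h a (fun x => f x + g x) fun x => f₀ x + g₀ x :=
  ⟨hf.isBigO.add hg.isBigO, hf.isBigO₀.add hg.isBigO₀,
    (hf.isBigO_sub.add hg.isBigO_sub).congr_left fun x => by ring⟩

lemma neg (hf : Close l h a f f₀) : Close l h a (fun x => -f x) fun x => -f₀ x :=
  ⟨hf.isBigO.neg_left, hf.isBigO₀.neg_left,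
    hf.isBigO_sub.neg_left.congr_left fun x => by ring⟩

lemma sub (hf : Close l h a f f₀) (hg : Close l h a g g₀) :
    Close l h a (fun x => f x - g x) fun x => f₀ x - g₀ x := by
  simpa only [sub_eq_add_neg] using hf.add hg.neg

lemma mul (hh : IsScale l h) (hf : Close l h a f f₀) (hg : Close l h b g g₀) :
    Close l h (a + b) (fun x => f x * g x) fun x => f₀ x * g₀ x := by
  refine ⟨hh.isBigO_mul hf.isBigO hg.isBigO, hh.isBigO_mul hf.isBigO₀ hg.isBigO₀, ?_⟩
  have hleft := hh.isBigO_mul hf.isBigO_sub hg.isBigO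
  have hright := hh.isBigO_mul hf.isBigO₀ hg.isBigO_sub
  rw [add_right_comm] at hleft
  rw [← add_assoc] at hright
  exact (hleft.add hright).congr_left fun x => by ring

lemma const_mul (c : ℝ) (hf : Close l h a f f₀) :
    Close l h a (fun x => c * f x) fun x => c * f₀ x :=
  ⟨hf.isBigO.const_mul_left c, hf.isBigO₀.const_mul_left c,
    (hf.isBigO_sub.const_mul_left c).congr_left fun x => by ring⟩

lemma sum {κ : Type*} (s : Finset κ) {F F₀ : κ → ι → ℝ} (hF : ∀ k, Close l h a (F k) (F₀ k)) :
    Close l h a (fun x => ∑ k ∈ s, F k x) fun x => ∑ k ∈ s, F₀ k x := by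
  classical
  induction s using Finset.induction_on with
  | empty => simpa only [Finset.sum_empty] using zero
  | insert k s hk ih => simpa only [Finset.sum_insert hk] using (hF k).add ih

lemma inv (hh : IsScale l h) (hf : Close l h a f f₀) (hlower : (fun x => h x ^ a) =O[l] f)
    (hlower₀ : (fun x => h x ^ a) =O[l] f₀) :
    Close l h (-a) (fun x => (f x)⁻¹) fun x => (f₀ x)⁻¹ := by
  refine ⟨hh.isBigO_inv hlower, hh.isBigO_inv hlower₀, ?_⟩
  have hprod := hh.isBigO_mul (hh.isBigO_mul hf.isBigO_sub.neg_left (hh.isBigO_inv hlower))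
    (hh.isBigO_inv hlower₀)
  rw [show a + 1 + -a + -a = -a + 1 by ring] at hprod
  refine hprod.congr' ?_ .rfl
  filter_upwards [hh.eventually_ne_zero hlower, hh.eventually_ne_zero hlower₀] with x hx hx₀
  field_simp
  ring

lemma sqrt (hh : IsScale l h) (hf : Close l h (a + a) f f₀) (hnonneg₀ : ∀ᶠ x in l, 0 ≤ f₀ x)
    (hlower₀ : (fun x => h x ^ (a + a)) =O[l] f₀) :
    Close l h a (fun x => √(f x)) fun x => √(f₀ x) := by
  have hpow : ∀ᶠ x in l, 0 ≤ h x ^ (a + a) := hh.mono fun x hx => (zpow_pos hx.1 _).le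
  have hsqrt₀ : (fun x => h x ^ a) =O[l] fun x => √(f₀ x) :=
    (hlower₀.sqrt hnonneg₀).congr' (hh.sqrt_zpow a) .rfl
  refine of_isBigO_sub hh ((hf.isBigO₀.sqrt hpow).congr' .rfl (hh.sqrt_zpow a)) ?_
  have hquot := hh.isBigO_mul hf.isBigO_sub (hh.isBigO_inv hsqrt₀)
  rw [show a + a + 1 + -a = a + 1 by ring] at hquot
  refine IsBigO.trans (IsBigO.of_bound 1 ?_) hquot
  filter_upwards [hnonneg₀, hh.eventually_ne_zero hlower₀] with x hx hx₀
  rw [one_mul, norm_mul, norm_inv, Real.norm_of_nonneg (Real.sqrt_nonneg _)]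
  exact abs_sqrt_sub_sqrt_le _ (hx.lt_of_ne' hx₀)

end Close

/-- Closeness of two families of planar metrics: their entries are of order `h ^ 2` and close, and
their determinants are of the exact order `h ^ 4`, which makes the inverses close as well. -/
structure MetricClose (l : Filter ι) (h : ι → ℝ) (G G₀ : ι → Matrix (Fin 2) (Fin 2) ℝ) : Prop where
  entry : ∀ k m, Close l h 2 (fun x => G x k m) fun x => G₀ x k m
  det_lower : (fun x => h x ^ (4 : ℤ)) =O[l] fun x => (G x).det
  det_nonneg₀ : ∀ᶠ x in l, 0 ≤ (G₀ x).det
  det_lower₀ : (fun x => h x ^ (4 : ℤ)) =O[l] fun x => (G₀ x).det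

namespace MetricClose

variable {G G₀ : ι → Matrix (Fin 2) (Fin 2) ℝ}

lemma det (hh : IsScale l h) (hG : MetricClose l h G G₀) :
    Close l h 4 (fun x => (G x).det) fun x => (G₀ x).det := by
  simp only [Matrix.det_fin_two]
  exact ((hG.entry 0 0).mul hh (hG.entry 1 1)).sub ((hG.entry 0 1).mul hh (hG.entry 1 0))

lemma adjugate (hG : MetricClose l h G G₀) (k m : Fin 2) :
    Close l h 2 (fun x => (G x).adjugate k m) fun x => (G₀ x).adjugate k m := by
  simp only [Matrix.adjugate_fin_two]
  fin_cases k <;> fin_cases m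
  · exact hG.entry 1 1
  · exact (hG.entry 0 1).neg
  · exact (hG.entry 1 0).neg
  · exact hG.entry 0 0

lemma inv (hh : IsScale l h) (hG : MetricClose l h G G₀) (k m : Fin 2) :
    Close l h (-2) (fun x => (G x)⁻¹ k m) fun x => (G₀ x)⁻¹ k m := by
  simp only [Matrix.inv_def, Ring.inverse_eq_inv', Matrix.smul_apply, smul_eq_mul]
  exact ((hG.det hh).inv hh hG.det_lower hG.det_lower₀).mul hh (hG.adjugate k m)

lemma sqrt_det (hh : IsScale l h) (hG : MetricClose l h G G₀) :
    Close l h 2 (fun x => √(G x).det) fun x => √(G₀ x).det :=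
  Close.sqrt hh (hG.det hh) hG.det_nonneg₀ hG.det_lower₀

end MetricClose

variable {Φ Φ₀ : ι → E2 → E3} {u : ι → E2} {V V₀ W W₀ : ι → Fin 2 → E2 → ℝ} {a b : ℤ}

/-- Closeness of two families of parameterizations at the parameters `u`, as far as the metric and
its first derivatives are concerned. -/
structure PatchClose (l : Filter ι) (h : ι → ℝ) (Φ Φ₀ : ι → E2 → E3) (u : ι → E2) : Prop where
  metric : MetricClose l h (fun x => Param.metric (Φ x) (u x)) fun x => Param.metric (Φ₀ x) (u x)
  pd_metric : ∀ m k n, Close l h 2 (fun x => Param.pd m (fun w => Param.metric (Φ x) w k n) (u x))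
    fun x => Param.pd m (fun w => Param.metric (Φ₀ x) w k n) (u x)

/-- Closeness, at the parameters `u`, of the components of two families of vector fields and of
their first derivatives, all of order `h ^ a`. -/
structure FieldClose (l : Filter ι) (h : ι → ℝ) (a : ℤ) (V V₀ : ι → Fin 2 → E2 → ℝ)
    (u : ι → E2) : Prop where
  value : ∀ q, Close l h a (fun x => V x q (u x)) fun x => V₀ x q (u x)
  pd : ∀ k q, Close l h a (fun x => Param.pd k (V x q) (u x)) fun x => Param.pd k (V₀ x q) (u x)

namespace PatchClose

lemma christoffel (hh : IsScale l h) (hΦ : PatchClose l h Φ Φ₀ u) (i p k : Fin 2) :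
    Close l h 0 (fun x => Param.christoffel (Φ x) i p k (u x))
      fun x => Param.christoffel (Φ₀ x) i p k (u x) := by
  unfold Param.christoffel
  exact (Close.sum _ fun m => (hΦ.metric.inv hh i m).mul hh
    (((hΦ.pd_metric k m p).add (hΦ.pd_metric p m k)).sub (hΦ.pd_metric m p k))).const_mul _

lemma gradVec (hh : IsScale l h) (hΦ : PatchClose l h Φ Φ₀ u) (hV : FieldClose l h a V V₀ u)
    (i j : Fin 2) :
    Close l h (a - 2) (fun x => Param.gradVec (Φ x) (V x) (u x) i j)
      fun x => Param.gradVec (Φ₀ x) (V₀ x) (u x) i j := by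
  simp only [Param.gradVec, Matrix.of_apply]
  refine Close.cast (Close.sum _ fun k => (hΦ.metric.inv hh k j).mul hh ((hV.pd k i).add
    (Close.sum _ fun p => ?_))) (neg_add_eq_sub 2 a)
  exact ((hV.value p).mul hh (hΦ.christoffel hh i p k)).cast (add_zero a)

lemma stiffness (hh : IsScale l h) (hΦ : PatchClose l h Φ Φ₀ u) (hV : FieldClose l h a V V₀ u)
    (hW : FieldClose l h b W W₀ u) :
    Close l h (a + b + 2)
      (fun x => Param.tensorInner (Φ x) (u x) (Param.gradVec (Φ x) (V x) (u x))
        (Param.gradVec (Φ x) (W x) (u x)) * Param.density (Φ x) (u x))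
      (fun x => Param.tensorInner (Φ₀ x) (u x) (Param.gradVec (Φ₀ x) (V₀ x) (u x))
        (Param.gradVec (Φ₀ x) (W₀ x) (u x)) * Param.density (Φ₀ x) (u x)) := by
  simp only [Param.tensorInner, Param.density, Matrix.trace, Matrix.diag_apply, Matrix.mul_apply,
    Matrix.transpose_apply]
  exact ((Close.sum _ fun i => Close.sum _ fun j => (Close.sum _ fun k => (Close.sum _ fun m =>
    (hΦ.gradVec hh hV i m).mul hh (hΦ.metric.entry m k)).mul hh (hΦ.gradVec hh hW j k)).mul hh
      (hΦ.metric.entry j i)).mul hh (hΦ.metric.sqrt_det hh)).cast (by ring)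

end PatchClose

namespace MetricClose

lemma mass (hh : IsScale l h)
    (hG : MetricClose l h (fun x => Param.metric (Φ x) (u x)) fun x => Param.metric (Φ₀ x) (u x))
    (hV : ∀ q, Close l h a (fun x => V x q (u x)) fun x => V₀ x q (u x))
    (hW : ∀ q, Close l h b (fun x => W x q (u x)) fun x => W₀ x q (u x)) :
    Close l h (a + b + 4)
      (fun x => Param.vecInner (Φ x) (V x) (W x) (u x) * Param.density (Φ x) (u x))
      (fun x => Param.vecInner (Φ₀ x) (V₀ x) (W₀ x) (u x) * Param.density (Φ₀ x) (u x)) := by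
  simp only [Param.vecInner, Param.density]
  exact ((Close.sum _ fun i => Close.sum _ fun j =>
    ((hV i).mul hh (hG.entry i j)).mul hh (hW j)).mul hh (hG.sqrt_det hh)).cast (by ring)

lemma lsCoeff (hh : IsScale l h) {τ : ι → E3}
    (hG : MetricClose l h (fun x => Param.metric (Φ x) (u x)) fun x => Param.metric (Φ₀ x) (u x))
    (hτ : ∀ q, Close l h a (fun x => inner ℝ (Param.pd q (Φ x) (u x)) (τ x))
      fun x => inner ℝ (Param.pd q (Φ₀ x) (u x)) (τ x)) (q : Fin 2) :
    Close l h (a - 2) (fun x => Param.lsCoeff (Φ x) (u x) (τ x) q)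
      fun x => Param.lsCoeff (Φ₀ x) (u x) (τ x) q := by
  simp only [Param.lsCoeff, Matrix.mulVec, dotProduct]
  exact (Close.sum _ fun p => (hG.inv hh q p).mul hh (hτ p)).cast (neg_add_eq_sub 2 a)

end MetricClose

end CloseCalculus

/-! ### Elements over a flat triangle -/

section Element

open Asymptotics Filter Param

/-- The linear map taking the reference triangle to the triangle with vertices `0, J 0, J 1`. -/
noncomputable def edgeMap (J : Fin 2 → E2) : E2 →L[ℝ] E2 :=
  (EuclideanSpace.proj 0 : E2 →L[ℝ] ℝ).smulRight (J 0)
    + (EuclideanSpace.proj 1 : E2 →L[ℝ] ℝ).smulRight (J 1)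

lemma edgeMap_apply (J : Fin 2 → E2) (u : E2) : edgeMap J u = u 0 • J 0 + u 1 • J 1 := rfl

lemma edgeMap_single (J : Fin 2 → E2) (k : Fin 2) :
    edgeMap J (EuclideanSpace.single k 1) = J k := by
  fin_cases k <;> simp [edgeMap_apply]

/-- The patch of a graph over the triangle with vertices `0, J 0, J 1`, parameterized by the
reference triangle. -/
noncomputable def elementMap (t : OrthonormalBasis (Fin 3) ℝ E3) (x : E3) (f : E2 → ℝ)
    (J : Fin 2 → E2) (u : E2) : E3 := graphMap t x f (edgeMap J u)

section ElementMap

variable (t : OrthonormalBasis (Fin 3) ℝ E3) (x : E3) {f : E2 → ℝ}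

lemma hasFDerivAt_graphMap {f' : E2 →L[ℝ] ℝ} {v : E2} (hf : HasFDerivAt f f' v) :
    HasFDerivAt (graphMap t x f) ((EuclideanSpace.proj 0 : E2 →L[ℝ] ℝ).smulRight (t 0)
      + (EuclideanSpace.proj 1 : E2 →L[ℝ] ℝ).smulRight (t 1) + f'.smulRight (t 2)) v := by
  have hproj (i : Fin 2) : HasFDerivAt (fun v : E2 => v i) (EuclideanSpace.proj i : E2 →L[ℝ] ℝ) v :=
    (EuclideanSpace.proj i : E2 →L[ℝ] ℝ).hasFDerivAt
  exact ((((hproj 0).smul_const (t 0)).const_add x).add ((hproj 1).smul_const (t 1))).add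
    (hf.smul_const (t 2))

variable {J : Fin 2 → E2} {u : E2}

lemma pd_elementMap (hf : DifferentiableAt ℝ f (edgeMap J u)) (k : Fin 2) :
    pd k (elementMap t x f J) u
      = J k 0 • t 0 + J k 1 • t 1 + fderiv ℝ f (edgeMap J u) (J k) • t 2 := by
  have h := (hasFDerivAt_graphMap t x hf.hasFDerivAt).comp u (edgeMap J).hasFDerivAt
  unfold pd
  rw [show elementMap t x f J = graphMap t x f ∘ edgeMap J from rfl, h.fderiv]
  simp only [ContinuousLinearMap.comp_apply, edgeMap_single]
  rfl

lemma metric_elementMap (hf : DifferentiableAt ℝ f (edgeMap J u)) (k n : Fin 2) :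
    metric (elementMap t x f J) u k n = J k 0 * J n 0 + J k 1 * J n 1
      + fderiv ℝ f (edgeMap J u) (J k) * fderiv ℝ f (edgeMap J u) (J n) := by
  rw [metric, Matrix.of_apply, pd_elementMap t x hf, pd_elementMap t x hf]
  simpa [Fin.sum_univ_three] using t.orthonormal.inner_sum
    ![J k 0, J k 1, fderiv ℝ f (edgeMap J u) (J k)] ![J n 0, J n 1, fderiv ℝ f (edgeMap J u) (J n)]
    Finset.univ

lemma pd_metric_elementMap (hf : ContDiffAt ℝ 2 f (edgeMap J u)) (m k n : Fin 2) :
    pd m (fun w => metric (elementMap t x f J) w k n) u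
      = fderiv ℝ (fderiv ℝ f) (edgeMap J u) (J m) (J k) * fderiv ℝ f (edgeMap J u) (J n)
        + fderiv ℝ f (edgeMap J u) (J k) * fderiv ℝ (fderiv ℝ f) (edgeMap J u) (J m) (J n) := by
  have hmetric : (fun w => metric (elementMap t x f J) w k n) =ᶠ[nhds u] fun w =>
      J k 0 * J n 0 + J k 1 * J n 1
        + fderiv ℝ f (edgeMap J w) (J k) * fderiv ℝ f (edgeMap J w) (J n) := by
    filter_upwards [(edgeMap J).continuous.continuousAt.eventually (hf.eventually (by simp))]
      with w hw
    exact metric_elementMap t x (hw.differentiableAt (by simp)) k n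
  have hfderiv : HasFDerivAt (fun w => fderiv ℝ f (edgeMap J w))
      ((fderiv ℝ (fderiv ℝ f) (edgeMap J u)).comp (edgeMap J)) u :=
    ((hf.fderiv_right (m := 1) (by norm_num)).differentiableAt (by simp)).hasFDerivAt.comp u
      (edgeMap J).hasFDerivAt
  have happly (v : E2) : HasFDerivAt (fun w => fderiv ℝ f (edgeMap J w) v)
      ((ContinuousLinearMap.apply ℝ ℝ v).comp
        ((fderiv ℝ (fderiv ℝ f) (edgeMap J u)).comp (edgeMap J))) u :=
    (ContinuousLinearMap.apply ℝ ℝ v).hasFDerivAt.comp u hfderiv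
  unfold pd
  rw [hmetric.fderiv_eq, (((happly (J k)).fun_mul (happly (J n))).const_add _).fderiv]
  simp [edgeMap_single]
  ring

end ElementMap

/-- A triangle with vertices `0, J 0, J 1`, a height function `f` over it, the frame `t` at the base
point `x` in which the graph is drawn, and a length scale `h`. -/
structure ElementData where
  t : OrthonormalBasis (Fin 3) ℝ E3
  x : E3
  f : E2 → ℝ
  J : Fin 2 → E2
  h : ℝ

namespace ElementData

/-- The patch of the graph of the height function. -/
noncomputable def curved (d : ElementData) : E2 → E3 := elementMap d.t d.x d.f d.J

/-- The triangle itself, as a patch in the tangent plane: the common reference to which the patches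
of different height functions are compared. -/
noncomputable def flat (d : ElementData) : E2 → E3 := elementMap d.t d.x (fun _ => 0) d.J

/-- Shape regularity of the triangle at scale `h` and flatness of the graph. The gradient enters the
metric quadratically, which is why the bound `O(√h)` is enough. -/
structure Admissible (K c : ℝ) (d : ElementData) : Prop where
  h_pos : 0 < d.h
  h_le : d.h ≤ 1
  edge_le : ∀ k, ‖d.J k‖ ≤ K * d.h
  le_det : c * d.h ^ 4 ≤ (d.J 0 0 * d.J 1 1 - d.J 0 1 * d.J 1 0) ^ 2
  contDiffAt : ∀ u ∈ refTriangle, ContDiffAt ℝ 2 d.f (edgeMap d.J u)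
  grad_le : ∀ u ∈ refTriangle, ‖fderiv ℝ d.f (edgeMap d.J u)‖ ≤ K * √d.h
  hess_le : ∀ u ∈ refTriangle, ‖fderiv ℝ (fderiv ℝ d.f) (edgeMap d.J u)‖ ≤ K

lemma pd_flat (d : ElementData) (u : E2) (k : Fin 2) :
    pd k d.flat u = d.J k 0 • d.t 0 + d.J k 1 • d.t 1 := by
  rw [flat, pd_elementMap _ _ (by fun_prop), fderiv_fun_const]
  simp

lemma metric_flat (d : ElementData) (u : E2) (k n : Fin 2) :
    metric d.flat u k n = d.J k 0 * d.J n 0 + d.J k 1 * d.J n 1 := by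
  rw [flat, metric_elementMap _ _ (by fun_prop), fderiv_fun_const]
  simp

lemma pd_metric_flat (d : ElementData) (u : E2) (m k n : Fin 2) :
    pd m (fun w => metric d.flat w k n) u = 0 := by
  simp only [metric_flat, pd, fderiv_fun_const]
  simp

namespace Admissible

variable {d : ElementData} {K c : ℝ} {u : E2}

lemma bound_nonneg (hd : d.Admissible K c) : 0 ≤ K :=
  nonneg_of_mul_nonneg_left ((norm_nonneg _).trans (hd.edge_le 0)) hd.h_pos

lemma abs_edge_le (hd : d.Admissible K c) (k i : Fin 2) : |d.J k i| ≤ K * d.h :=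
  (PiLp.norm_apply_le (d.J k) i).trans (hd.edge_le k)

lemma grad_edge_le (hd : d.Admissible K c) (hu : u ∈ refTriangle) (k : Fin 2) :
    |fderiv ℝ d.f (edgeMap d.J u) (d.J k)| ≤ K ^ 2 * (√d.h * d.h) := by
  calc |fderiv ℝ d.f (edgeMap d.J u) (d.J k)| ≤ (K * √d.h) * (K * d.h) :=
        ContinuousLinearMap.le_of_opNorm_le_of_le _ (hd.grad_le u hu) (hd.edge_le k)
    _ = K ^ 2 * (√d.h * d.h) := by ring

lemma hess_edge_le (hd : d.Admissible K c) (hu : u ∈ refTriangle) (m k : Fin 2) :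
    |fderiv ℝ (fderiv ℝ d.f) (edgeMap d.J u) (d.J m) (d.J k)| ≤ K ^ 3 * d.h ^ 2 := by
  calc |fderiv ℝ (fderiv ℝ d.f) (edgeMap d.J u) (d.J m) (d.J k)|
      ≤ K * (K * d.h) * (K * d.h) :=
        ContinuousLinearMap.le_of_opNorm₂_le_of_le _ (hd.hess_le u hu) (hd.edge_le m) (hd.edge_le k)
    _ = K ^ 3 * d.h ^ 2 := by ring

lemma metric_curved (hd : d.Admissible K c) (hu : u ∈ refTriangle) (k n : Fin 2) :
    metric d.curved u k n = d.J k 0 * d.J n 0 + d.J k 1 * d.J n 1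
      + fderiv ℝ d.f (edgeMap d.J u) (d.J k) * fderiv ℝ d.f (edgeMap d.J u) (d.J n) :=
  metric_elementMap _ _ ((hd.contDiffAt u hu).differentiableAt (by simp)) _ _

lemma le_det_metric_flat (hd : d.Admissible K c) (u : E2) :
    c * d.h ^ 4 ≤ (metric d.flat u).det := by
  rw [Matrix.det_fin_two]
  simp only [metric_flat]
  linear_combination hd.le_det

lemma le_det_metric_curved (hd : d.Admissible K c) (hu : u ∈ refTriangle) :
    c * d.h ^ 4 ≤ (metric d.curved u).det := by
  rw [Matrix.det_fin_two]
  simp only [hd.metric_curved hu]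
  set p := fderiv ℝ d.f (edgeMap d.J u) (d.J 0)
  set q := fderiv ℝ d.f (edgeMap d.J u) (d.J 1)
  linear_combination hd.le_det + sq_nonneg (d.J 0 0 * q - p * d.J 1 0)
    + sq_nonneg (d.J 0 1 * q - p * d.J 1 1)

lemma abs_metric_flat_le (hd : d.Admissible K c) (u : E2) (k n : Fin 2) :
    |metric d.flat u k n| ≤ 2 * K ^ 2 * d.h ^ 2 := by
  have hmul (i : Fin 2) : |d.J k i * d.J n i| ≤ (K * d.h) * (K * d.h) := by
    rw [abs_mul]
    exact mul_le_mul (hd.abs_edge_le k i) (hd.abs_edge_le n i) (abs_nonneg _)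
      (mul_nonneg hd.bound_nonneg hd.h_pos.le)
  rw [metric_flat]
  exact (abs_add_le _ _).trans ((add_le_add (hmul 0) (hmul 1)).trans_eq (by ring))

lemma abs_metric_sub_le (hd : d.Admissible K c) (hu : u ∈ refTriangle) (k n : Fin 2) :
    |metric d.curved u k n - metric d.flat u k n| ≤ K ^ 4 * d.h ^ 3 := by
  rw [hd.metric_curved hu, metric_flat, add_sub_cancel_left, abs_mul]
  calc |fderiv ℝ d.f (edgeMap d.J u) (d.J k)| * |fderiv ℝ d.f (edgeMap d.J u) (d.J n)|
      ≤ (K ^ 2 * (√d.h * d.h)) * (K ^ 2 * (√d.h * d.h)) :=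
        mul_le_mul (hd.grad_edge_le hu k) (hd.grad_edge_le hu n) (abs_nonneg _)
          ((abs_nonneg _).trans (hd.grad_edge_le hu k))
    _ = K ^ 4 * (√d.h * √d.h) * d.h ^ 2 := by ring
    _ = K ^ 4 * d.h ^ 3 := by rw [Real.mul_self_sqrt hd.h_pos.le]; ring

lemma abs_pd_metric_curved_le (hd : d.Admissible K c) (hu : u ∈ refTriangle) (m k n : Fin 2) :
    |pd m (fun w => metric d.curved w k n) u| ≤ 2 * K ^ 5 * d.h ^ 3 := by
  have hmul (i j : Fin 2) : |fderiv ℝ (fderiv ℝ d.f) (edgeMap d.J u) (d.J m) (d.J i)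
      * fderiv ℝ d.f (edgeMap d.J u) (d.J j)| ≤ K ^ 5 * d.h ^ 3 := by
    have h0 := hd.h_pos.le
    have hK := hd.bound_nonneg
    rw [abs_mul]
    calc _ ≤ (K ^ 3 * d.h ^ 2) * (K ^ 2 * (√d.h * d.h)) :=
          mul_le_mul (hd.hess_edge_le hu m i) (hd.grad_edge_le hu j) (abs_nonneg _) (by positivity)
      _ ≤ (K ^ 3 * d.h ^ 2) * (K ^ 2 * (1 * d.h)) := by
          gcongr
          exact Real.sqrt_le_one.2 hd.h_le
      _ = K ^ 5 * d.h ^ 3 := by ring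
  rw [curved, pd_metric_elementMap _ _ (hd.contDiffAt u hu)]
  refine (abs_add_le _ _).trans ?_
  rw [mul_comm (fderiv ℝ d.f _ _)]
  linarith [hmul k n, hmul n k]

end Admissible

end ElementData

/-- A hat function `e`, an ambient vector `τ` and the parameter `w` of the vertex to which it is
attached: the data of a nodal vector field on a patch. -/
structure NodalData where
  e : E2 → ℝ
  w : E2
  τ : E3

namespace NodalData

/-- Components of the nodal vector field on the patch `Φ`: the hat function times the least-squares
coefficients of `τ` at the vertex. -/
noncomputable def field (n : NodalData) (Φ : E2 → E3) : Fin 2 → E2 → ℝ :=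
  fun q u => n.e u * lsCoeff Φ n.w n.τ q

/-- Bounds for the hat function, and near-tangency of the ambient vector to the element `d`. -/
structure Admissible (K : ℝ) (d : ElementData) (n : NodalData) : Prop where
  mem : n.w ∈ refTriangle
  norm_le : ‖n.τ‖ ≤ 1
  normal_le : |inner ℝ (d.t 2) n.τ| ≤ K * √d.h
  measurable : Measurable n.e
  differentiableAt : ∀ u ∈ refTriangle, DifferentiableAt ℝ n.e u
  abs_le : ∀ u ∈ refTriangle, |n.e u| ≤ 1
  pd_le : ∀ u ∈ refTriangle, ∀ k, |pd k n.e u| ≤ 1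

lemma pd_field {n : NodalData} {u : E2} (hn : DifferentiableAt ℝ n.e u) (Φ : E2 → E3)
    (k q : Fin 2) : pd k (n.field Φ q) u = pd k n.e u * lsCoeff Φ n.w n.τ q := by
  unfold pd field
  rw [(hn.hasFDerivAt.mul_const _).fderiv, smul_apply, smul_eq_mul, mul_comm]

lemma measurable_field {n : NodalData} (hn : Measurable n.e) (Φ : E2 → E3) (q : Fin 2) :
    Measurable (n.field Φ q) := hn.mul_const _

namespace Admissible

variable {n : NodalData} {d : ElementData} {K c : ℝ}

lemma abs_inner_pd_flat_le (hn : n.Admissible K d) (hd : d.Admissible K c) (q : Fin 2) :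
    |inner ℝ (pd q d.flat n.w) n.τ| ≤ 2 * K * d.h := by
  have hframe (i : Fin 3) : |inner ℝ (d.t i) n.τ| ≤ 1 := by
    simpa only [d.t.orthonormal.1 i, one_mul] using
      (abs_real_inner_le_norm (d.t i) n.τ).trans
        (mul_le_mul_of_nonneg_left hn.norm_le (norm_nonneg _))
  have hmul (i : Fin 2) (j : Fin 3) : |d.J q i * inner ℝ (d.t j) n.τ| ≤ K * d.h := by
    rw [abs_mul]
    exact (mul_le_of_le_one_right (abs_nonneg _) (hframe j)).trans (hd.abs_edge_le q i)
  rw [d.pd_flat, inner_add_left, real_inner_smul_left, real_inner_smul_left]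
  exact (abs_add_le _ _).trans ((add_le_add (hmul 0 0) (hmul 1 1)).trans_eq (by ring))

lemma abs_inner_pd_sub_le (hn : n.Admissible K d) (hd : d.Admissible K c) (q : Fin 2) :
    |inner ℝ (pd q d.curved n.w) n.τ - inner ℝ (pd q d.flat n.w) n.τ| ≤ K ^ 3 * d.h ^ 2 := by
  rw [d.pd_flat, ElementData.curved, pd_elementMap _ _
    ((hd.contDiffAt _ hn.mem).differentiableAt (by simp)), inner_add_left, add_sub_cancel_left,
    real_inner_smul_left, abs_mul]
  calc |fderiv ℝ d.f (edgeMap d.J n.w) (d.J q)| * |inner ℝ (d.t 2) n.τ|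
      ≤ (K ^ 2 * (√d.h * d.h)) * (K * √d.h) :=
        mul_le_mul (hd.grad_edge_le hn.mem q) hn.normal_le (abs_nonneg _)
          ((abs_nonneg _).trans (hd.grad_edge_le hn.mem q))
    _ = K ^ 3 * (√d.h * √d.h) * d.h := by ring
    _ = K ^ 3 * d.h ^ 2 := by rw [Real.mul_self_sqrt hd.h_pos.le]; ring

end Admissible

end NodalData

section Families

variable {ι : Type*} {S : Set ι}

lemma isBigO_principal_zpow {h f : ι → ℝ} (n : ℕ) (C : ℝ) (hf : ∀ y ∈ S, |f y| ≤ C * h y ^ n) :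
    f =O[𝓟 S] fun y => h y ^ (n : ℤ) :=
  isBigO_principal.2 ⟨|C|, fun y hy => (hf y hy).trans (by
    rw [zpow_natCast, Real.norm_eq_abs, ← abs_mul]
    exact le_abs_self _)⟩

lemma zpow_isBigO_principal {h f : ι → ℝ} (hh : ∀ y ∈ S, 0 ≤ h y) {c : ℝ} (hc : 0 < c) (n : ℕ)
    (hf : ∀ y ∈ S, c * h y ^ n ≤ f y) : (fun y => h y ^ (n : ℤ)) =O[𝓟 S] f :=
  isBigO_principal.2 ⟨c⁻¹, fun y hy => by
    rw [zpow_natCast, Real.norm_of_nonneg (pow_nonneg (hh y hy) n), inv_mul_eq_div,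
      le_div_iff₀' hc]
    exact (hf y hy).trans (le_abs_self _)⟩

variable {d : ι → ElementData} {K c : ℝ}

lemma isScale_of_admissible (hd : ∀ y ∈ S, (d y).Admissible K c) :
    IsScale (𝓟 S) fun y => (d y).h :=
  eventually_principal.2 fun y hy => ⟨(hd y hy).h_pos, (hd y hy).h_le⟩

lemma metricClose_of_admissible (hd : ∀ y ∈ S, (d y).Admissible K c) (hc : 0 < c)
    {u : ι → E2} (hu : ∀ y ∈ S, u y ∈ refTriangle) :
    MetricClose (𝓟 S) (fun y => (d y).h) (fun y => metric (d y).curved (u y))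
      fun y => metric (d y).flat (u y) where
  entry k m := Close.of_isBigO_sub (isScale_of_admissible hd)
    (isBigO_principal_zpow 2 _ fun y hy => (hd y hy).abs_metric_flat_le (u y) k m)
    (isBigO_principal_zpow 3 _ fun y hy => (hd y hy).abs_metric_sub_le (hu y hy) k m)
  det_lower := zpow_isBigO_principal (fun y hy => (hd y hy).h_pos.le) hc 4
    fun y hy => (hd y hy).le_det_metric_curved (hu y hy)
  det_nonneg₀ := eventually_principal.2 fun y hy =>
    (mul_nonneg hc.le (pow_nonneg (hd y hy).h_pos.le 4)).trans ((hd y hy).le_det_metric_flat _)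
  det_lower₀ := zpow_isBigO_principal (fun y hy => (hd y hy).h_pos.le) hc 4
    fun y hy => (hd y hy).le_det_metric_flat _

lemma patchClose_of_admissible (hd : ∀ y ∈ S, (d y).Admissible K c) (hc : 0 < c)
    {u : ι → E2} (hu : ∀ y ∈ S, u y ∈ refTriangle) :
    PatchClose (𝓟 S) (fun y => (d y).h) (fun y => (d y).curved) (fun y => (d y).flat) u where
  metric := metricClose_of_admissible hd hc hu
  pd_metric m k n := by
    simp only [ElementData.pd_metric_flat]
    exact Close.zero_right (isScale_of_admissible hd) (isBigO_principal_zpow 3 _ fun y hy =>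
      (hd y hy).abs_pd_metric_curved_le (hu y hy) m k n)

lemma lsCoeff_close_of_admissible (hd : ∀ y ∈ S, (d y).Admissible K c) (hc : 0 < c)
    {n : ι → NodalData} (hn : ∀ y ∈ S, (n y).Admissible K (d y)) (q : Fin 2) :
    Close (𝓟 S) (fun y => (d y).h) (-1) (fun y => lsCoeff (d y).curved (n y).w (n y).τ q)
      fun y => lsCoeff (d y).flat (n y).w (n y).τ q := by
  have hh := isScale_of_admissible hd
  refine (metricClose_of_admissible hd hc fun y hy => (hn y hy).mem).lsCoeff hh (a := 1)
    (fun q => Close.of_isBigO_sub hh ?_ ?_) q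
  · exact isBigO_principal_zpow 1 _ fun y hy => by
      simpa only [pow_one] using (hn y hy).abs_inner_pd_flat_le (hd y hy) q
  · exact isBigO_principal_zpow 2 _ fun y hy => (hn y hy).abs_inner_pd_sub_le (hd y hy) q

lemma fieldClose_of_admissible (hd : ∀ y ∈ S, (d y).Admissible K c) (hc : 0 < c)
    {n : ι → NodalData} (hn : ∀ y ∈ S, (n y).Admissible K (d y)) {u : ι → E2}
    (hu : ∀ y ∈ S, u y ∈ refTriangle) :
    FieldClose (𝓟 S) (fun y => (d y).h) (-1) (fun y => (n y).field (d y).curved)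
      (fun y => (n y).field (d y).flat) u := by
  have hbounded {F : ι → ℝ} (hF : ∀ y ∈ S, |F y| ≤ 1) : Close (𝓟 S) (fun y => (d y).h) 0 F F :=
    Close.refl (isBigO_principal_zpow 0 1 fun y hy => by simpa using hF y hy)
  have hmul {F : ι → ℝ} (hF : ∀ y ∈ S, |F y| ≤ 1) (q : Fin 2) :=
    (hbounded hF).mul (isScale_of_admissible hd) (lsCoeff_close_of_admissible hd hc hn q)
  have hpd (Φ : ι → E2 → E3) (k q : Fin 2) :
      (fun y => pd k (n y).e (u y) * lsCoeff (Φ y) (n y).w (n y).τ q)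
        =ᶠ[𝓟 S] fun y => pd k ((n y).field (Φ y) q) (u y) :=
    eventually_principal.2 fun y hy =>
      (NodalData.pd_field ((hn y hy).differentiableAt _ (hu y hy)) _ k q).symm
  exact ⟨fun q => hmul (fun y hy => (hn y hy).abs_le _ (hu y hy)) q,
    fun k q => (hmul (fun y hy => (hn y hy).pd_le _ (hu y hy) k) q).congr' (hpd _ k q) (hpd _ k q)⟩

end Families

end Element

section ElementIntegrals

open Asymptotics Filter Param MeasureTheory

section Measurability

variable (Φ : E2 → E3)

lemma measurable_pd {F : Type*} [NormedAddCommGroup F] [NormedSpace ℝ F] [CompleteSpace F]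
    [MeasurableSpace F] [BorelSpace F] (k : Fin 2) (f : E2 → F) : Measurable (pd k f) :=
  measurable_fderiv_apply_const ℝ f _

lemma measurable_metric (k n : Fin 2) : Measurable fun u => metric Φ u k n := by
  simp only [metric, Matrix.of_apply]
  exact (measurable_pd k Φ).inner (measurable_pd n Φ)

lemma measurable_det_metric : Measurable fun u => (metric Φ u).det := by
  simp only [Matrix.det_fin_two]
  exact ((measurable_metric Φ 0 0).mul (measurable_metric Φ 1 1)).sub
    ((measurable_metric Φ 0 1).mul (measurable_metric Φ 1 0))

lemma measurable_inv_metric (k n : Fin 2) : Measurable fun u => (metric Φ u)⁻¹ k n := by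
  simp only [Matrix.inv_def, Ring.inverse_eq_inv', Matrix.smul_apply, smul_eq_mul,
    Matrix.adjugate_fin_two]
  refine (measurable_det_metric Φ).inv.mul ?_
  fin_cases k <;> fin_cases n
  · exact measurable_metric Φ 1 1
  · exact (measurable_metric Φ 0 1).neg
  · exact (measurable_metric Φ 1 0).neg
  · exact measurable_metric Φ 0 0

lemma measurable_christoffel (i p k : Fin 2) : Measurable (christoffel Φ i p k) :=
  (Finset.measurable_sum _ fun m _ => (measurable_inv_metric Φ i m).mul
    (((measurable_pd k _).add (measurable_pd p _)).sub (measurable_pd m _))).const_mul _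

lemma measurable_density : Measurable (density Φ) :=
  (measurable_det_metric Φ).sqrt

variable {V W : Fin 2 → E2 → ℝ}

lemma measurable_gradVec (hV : ∀ q, Measurable (V q)) (i j : Fin 2) :
    Measurable fun u => gradVec Φ V u i j := by
  simp only [gradVec, Matrix.of_apply]
  exact Finset.measurable_sum _ fun k _ => (measurable_inv_metric Φ k j).mul
    ((measurable_pd k (V i)).add
      (Finset.measurable_sum _ fun p _ => (hV p).mul (measurable_christoffel Φ i p k)))

lemma measurable_tensorInner_gradVec (hV : ∀ q, Measurable (V q)) (hW : ∀ q, Measurable (W q)) :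
    Measurable fun u => tensorInner Φ u (gradVec Φ V u) (gradVec Φ W u) := by
  simp only [tensorInner, Matrix.trace, Matrix.diag_apply, Matrix.mul_apply, Matrix.transpose_apply]
  exact Finset.measurable_sum _ fun i _ => Finset.measurable_sum _ fun j _ =>
    (Finset.measurable_sum _ fun k _ => (Finset.measurable_sum _ fun m _ =>
      (measurable_gradVec Φ hV i m).mul (measurable_metric Φ m k)).mul
        (measurable_gradVec Φ hW j k)).mul (measurable_metric Φ j i)

lemma measurable_vecInner (hV : ∀ q, Measurable (V q)) (hW : ∀ q, Measurable (W q)) :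
    Measurable (vecInner Φ V W) :=
  Finset.measurable_sum _ fun i _ => Finset.measurable_sum _ fun j _ =>
    ((hV i).mul (measurable_metric Φ i j)).mul (hW j)

end Measurability

section SetIntegral

variable {ι X : Type*} [MeasurableSpace X] {μ : Measure X} {S : Set ι} {s : Set X}

lemma isBigO_principal_setIntegral (hs : μ s < ⊤) {F : ι → X → ℝ} {g : ι → ℝ}
    (hF : (fun y : ι × X => F y.1 y.2) =O[𝓟 (S ×ˢ s)] fun y => g y.1) :
    (fun i => ∫ x in s, F i x ∂μ) =O[𝓟 S] g := by
  obtain ⟨C, hC⟩ := isBigO_principal.1 hF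
  refine isBigO_principal.2 ⟨C * μ.real s, fun i hi => ?_⟩
  have hFi : ∀ x ∈ s, ‖F i x‖ ≤ C * ‖g i‖ := fun x hx => hC (i, x) ⟨hi, hx⟩
  exact (norm_setIntegral_le_of_norm_le_const hs hFi).trans_eq (mul_right_comm _ _ _)

lemma integrableOn_of_isBigO_principal (hs : MeasurableSet s) (hμ : μ s < ⊤) {F : ι → X → ℝ}
    {g : ι → ℝ} (hF : (fun y : ι × X => F y.1 y.2) =O[𝓟 (S ×ˢ s)] fun y => g y.1) {i : ι}
    (hi : i ∈ S) (hm : Measurable (F i)) : IntegrableOn (F i) s μ := by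
  obtain ⟨C, hC⟩ := isBigO_principal.1 hF
  have hFi : ∀ x ∈ s, ‖F i x‖ ≤ C * ‖g i‖ := fun x hx => hC (i, x) ⟨hi, hx⟩
  exact Measure.integrableOn_of_bounded hμ.ne hm.aestronglyMeasurable
    (ae_restrict_of_forall_mem hs hFi)

lemma Close.setIntegral (hs : MeasurableSet s) (hμ : μ s < ⊤) {h : ι → ℝ} {a : ℤ}
    {F F₀ : ι → X → ℝ}
    (hF : Close (𝓟 (S ×ˢ s)) (fun y => h y.1) a (fun y => F y.1 y.2) fun y => F₀ y.1 y.2)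
    (hm : ∀ i ∈ S, Measurable (F i)) (hm₀ : ∀ i ∈ S, Measurable (F₀ i)) :
    Close (𝓟 S) h a (fun i => ∫ x in s, F i x ∂μ) fun i => ∫ x in s, F₀ i x ∂μ where
  isBigO := isBigO_principal_setIntegral hμ hF.isBigO
  isBigO₀ := isBigO_principal_setIntegral hμ hF.isBigO₀
  isBigO_sub := by
    refine (isBigO_principal_setIntegral hμ hF.isBigO_sub).congr'
      (eventually_principal.2 fun i hi => integral_sub ?_ ?_) .rfl
    · exact integrableOn_of_isBigO_principal hs hμ (g := (h · ^ a)) hF.isBigO hi (hm i hi)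
    · exact integrableOn_of_isBigO_principal hs hμ (g := (h · ^ a)) hF.isBigO₀ hi (hm₀ i hi)

end SetIntegral

lemma isClosed_refTriangle : IsClosed refTriangle := by
  have hcoord (i : Fin 2) : Continuous fun u : E2 => u i := by fun_prop
  exact (isClosed_le continuous_const (hcoord 0)).inter
    ((isClosed_le continuous_const (hcoord 1)).inter
      (isClosed_le ((hcoord 0).add (hcoord 1)) continuous_const))

lemma norm_le_of_mem_refTriangle {u : E2} (hu : u ∈ refTriangle) : ‖u‖ ≤ 1 := by
  obtain ⟨hu₀, hu₁, hsum⟩ := hu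
  refine abs_le_of_sq_le_sq' ?_ zero_le_one |>.2
  rw [EuclideanSpace.norm_sq_eq, Fin.sum_univ_two]
  simp only [Real.norm_eq_abs, sq_abs]
  nlinarith [mul_nonneg hu₀ hu₁]

lemma volume_refTriangle_lt_top : volume refTriangle < ⊤ :=
  (measure_mono fun _ hu => mem_closedBall_zero_iff.2 (norm_le_of_mem_refTriangle hu)).trans_lt
    measure_closedBall_lt_top

/-- Contribution of one patch `Φ` to the stiffness matrix entry of two nodal fields. -/
noncomputable def stiffnessIntegral (Φ : E2 → E3) (n n' : NodalData) : ℝ :=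
  ∫ u in refTriangle, tensorInner Φ u (gradVec Φ (n.field Φ) u) (gradVec Φ (n'.field Φ) u)
    * density Φ u

/-- Contribution of one patch `Φ` to the mass matrix entry of two nodal fields. -/
noncomputable def massIntegral (Φ : E2 → E3) (n n' : NodalData) : ℝ :=
  ∫ u in refTriangle, vecInner Φ (n.field Φ) (n'.field Φ) u * density Φ u

section Families

variable {ι : Type*} {S : Set ι} {d : ι → ElementData} {n n' : ι → NodalData} {K c : ℝ}

lemma stiffnessIntegral_close (hd : ∀ y ∈ S, (d y).Admissible K c) (hc : 0 < c)
    (hn : ∀ y ∈ S, (n y).Admissible K (d y)) (hn' : ∀ y ∈ S, (n' y).Admissible K (d y)) :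
    Close (𝓟 S) (fun y => (d y).h) 0 (fun y => stiffnessIntegral (d y).curved (n y) (n' y))
      fun y => stiffnessIntegral (d y).flat (n y) (n' y) := by
  have hd' : ∀ y ∈ S ×ˢ refTriangle, (d y.1).Admissible K c := fun y hy => hd _ hy.1
  have hu : ∀ y ∈ S ×ˢ refTriangle, y.2 ∈ refTriangle := fun y hy => hy.2
  have hmeas (Φ : ι → E2 → E3) : ∀ y ∈ S, Measurable fun u => tensorInner (Φ y) u
      (gradVec (Φ y) ((n y).field (Φ y)) u) (gradVec (Φ y) ((n' y).field (Φ y)) u)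
        * density (Φ y) u := fun y hy =>
    (measurable_tensorInner_gradVec _ (NodalData.measurable_field (hn y hy).measurable _)
      (NodalData.measurable_field (hn' y hy).measurable _)).mul (measurable_density _)
  exact Close.setIntegral isClosed_refTriangle.measurableSet volume_refTriangle_lt_top
    ((patchClose_of_admissible hd' hc hu).stiffness (isScale_of_admissible hd')
      (fieldClose_of_admissible hd' hc (fun y hy => hn _ hy.1) hu)
      (fieldClose_of_admissible hd' hc (fun y hy => hn' _ hy.1) hu)) (hmeas _) (hmeas _)

lemma massIntegral_close (hd : ∀ y ∈ S, (d y).Admissible K c) (hc : 0 < c)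
    (hn : ∀ y ∈ S, (n y).Admissible K (d y)) (hn' : ∀ y ∈ S, (n' y).Admissible K (d y)) :
    Close (𝓟 S) (fun y => (d y).h) 2 (fun y => massIntegral (d y).curved (n y) (n' y))
      fun y => massIntegral (d y).flat (n y) (n' y) := by
  have hd' : ∀ y ∈ S ×ˢ refTriangle, (d y.1).Admissible K c := fun y hy => hd _ hy.1
  have hu : ∀ y ∈ S ×ˢ refTriangle, y.2 ∈ refTriangle := fun y hy => hy.2
  have hmeas (Φ : ι → E2 → E3) : ∀ y ∈ S, Measurable fun u =>
      vecInner (Φ y) ((n y).field (Φ y)) ((n' y).field (Φ y)) u * density (Φ y) u := fun y hy =>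
    (measurable_vecInner _ (NodalData.measurable_field (hn y hy).measurable _)
      (NodalData.measurable_field (hn' y hy).measurable _)).mul (measurable_density _)
  exact Close.setIntegral isClosed_refTriangle.measurableSet volume_refTriangle_lt_top
    ((metricClose_of_admissible hd' hc hu).mass (isScale_of_admissible hd')
      (fieldClose_of_admissible hd' hc (fun y hy => hn _ hy.1) hu).value
      (fieldClose_of_admissible hd' hc (fun y hy => hn' _ hy.1) hu).value) (hmeas _) (hmeas _)

end Families

/-- The admissible elements, together with two admissible nodal fields on them. -/
def admissibleSet (K c : ℝ) : Set (ElementData × NodalData × NodalData) :=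
  {y | y.1.Admissible K c ∧ y.2.1.Admissible K y.1 ∧ y.2.2.Admissible K y.1}

/-- Functionals `I` of a patch and two nodal fields whose values on the admissible elements are
bounded, and those on the curved and on the flat patch `O(h)`-close. -/
structure IsConsistent (K c C : ℝ) (I : (E2 → E3) → NodalData → NodalData → ℝ) : Prop where
  nonneg : 0 ≤ C
  eq_zero : ∀ Φ n n', n'.e = 0 → I Φ n n' = 0
  abs_sub_le : ∀ y ∈ admissibleSet K c,
    |I y.1.curved y.2.1 y.2.2 - I y.1.flat y.2.1 y.2.2| ≤ C * y.1.h
  abs_le : ∀ y ∈ admissibleSet K c, |I y.1.curved y.2.1 y.2.2| ≤ C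

lemma exists_isConsistent {I : (E2 → E3) → NodalData → NodalData → ℝ} {K c : ℝ}
    (hzero : ∀ Φ n n', n'.e = 0 → I Φ n n' = 0)
    (hI : Close (𝓟 (admissibleSet K c)) (fun y => y.1.h) 0 (fun y => I y.1.curved y.2.1 y.2.2)
      fun y => I y.1.flat y.2.1 y.2.2) : ∃ C, IsConsistent K c C I := by
  obtain ⟨C₁, hC₁⟩ := isBigO_principal.1 hI.isBigO_sub
  obtain ⟨C₂, hC₂⟩ := isBigO_principal.1 hI.isBigO
  simp only [zpow_zero, norm_one, mul_one, zero_add, zpow_one] at hC₁ hC₂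
  have hh : ∀ y ∈ admissibleSet K c, 0 ≤ y.1.h := fun y hy => hy.1.h_pos.le
  refine ⟨max |C₁| |C₂|, by positivity, hzero, fun y hy => (hC₁ y hy).trans ?_, fun y hy =>
    (hC₂ y hy).trans ((le_abs_self _).trans (le_max_right _ _))⟩
  rw [Real.norm_of_nonneg (hh y hy)]
  exact mul_le_mul_of_nonneg_right ((le_abs_self _).trans (le_max_left _ _)) (hh y hy)

lemma IsConsistent.mono {I : (E2 → E3) → NodalData → NodalData → ℝ} {K c C C' : ℝ}
    (hI : IsConsistent K c C I) (hC : C ≤ C') : IsConsistent K c C' I where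
  nonneg := hI.nonneg.trans hC
  eq_zero := hI.eq_zero
  abs_sub_le y hy := (hI.abs_sub_le y hy).trans (mul_le_mul_of_nonneg_right hC hy.1.h_pos.le)
  abs_le y hy := (hI.abs_le y hy).trans hC

lemma exists_isConsistent_stiffnessIntegral (K : ℝ) {c : ℝ} (hc : 0 < c) :
    ∃ C, IsConsistent K c C stiffnessIntegral := by
  refine exists_isConsistent (fun Φ n n' hn' => ?_) (stiffnessIntegral_close
    (fun _ hy => hy.1) hc (fun _ hy => hy.2.1) fun _ hy => hy.2.2)
  have hfield (q : Fin 2) : n'.field Φ q = fun _ => 0 := by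
    funext u
    simp [NodalData.field, hn']
  have hgrad (u : E2) : gradVec Φ (n'.field Φ) u = 0 := by
    ext i j
    simp [gradVec, pd, hfield]
  simp [stiffnessIntegral, tensorInner, hgrad]

lemma exists_isConsistent_massIntegral (K : ℝ) {c : ℝ} (hc : 0 < c) :
    ∃ C, IsConsistent K c C massIntegral :=
  exists_isConsistent (fun Φ n n' hn' => by simp [massIntegral, vecInner, NodalData.field, hn'])
    ((massIntegral_close (fun _ hy => hy.1) hc (fun _ hy => hy.2.1) fun _ hy => hy.2.2).mono
      (isScale_of_admissible fun _ hy => hy.1) (by norm_num))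

end ElementIntegrals

/-! ### Local geometry of the surface -/

section Surface

open Set Filter Topology Metric

/-- `F` is a defining function of `M` on the ball of radius `δ` about its point `x`, normalized at
`x`, whose derivative is `L`-Lipschitz. -/
structure IsLocalDefining (M : Set E3) (δ L : ℝ) (x : E3) (F : E3 → ℝ) : Prop where
  radius_pos : 0 < δ
  mem : x ∈ M
  differentiableAt : ∀ y ∈ ball x δ, DifferentiableAt ℝ F y
  mem_iff : ∀ y ∈ ball x δ, y ∈ M ↔ F y = 0
  norm_fderiv : ‖fderiv ℝ F x‖ = 1
  lipschitz : ∀ y ∈ ball x δ, ∀ y' ∈ ball x δ, ‖fderiv ℝ F y - fderiv ℝ F y'‖ ≤ L * ‖y - y'‖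

lemma IsLocalDefining.mono {M : Set E3} {δ δ' L L' : ℝ} {x : E3} {F : E3 → ℝ}
    (hF : IsLocalDefining M δ L x F) (hδ' : 0 < δ') (hδ : δ' ≤ δ) (hL : L ≤ L') :
    IsLocalDefining M δ' L' x F where
  radius_pos := hδ'
  mem := hF.mem
  differentiableAt y hy := hF.differentiableAt y (ball_subset_ball hδ hy)
  mem_iff y hy := hF.mem_iff y (ball_subset_ball hδ hy)
  norm_fderiv := hF.norm_fderiv
  lipschitz y hy y' hy' := (hF.lipschitz y (ball_subset_ball hδ hy) y'
    (ball_subset_ball hδ hy')).trans (by gcongr)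

section Existence

variable {M : Set E3}

lemma isLocalDefining_inv_norm_smul {δ K c : ℝ} {x : E3} {F : E3 → ℝ} (hδ : 0 < δ) (hx : x ∈ M)
    (hF : ∀ y ∈ ball x δ, DifferentiableAt ℝ F y) (hMF : ∀ y ∈ ball x δ, y ∈ M ↔ F y = 0)
    (hc : 0 < c) (hcF : c ≤ ‖fderiv ℝ F x‖)
    (hK : ∀ y ∈ ball x δ, ∀ y' ∈ ball x δ, ‖fderiv ℝ F y - fderiv ℝ F y'‖ ≤ K * ‖y - y'‖) :
    IsLocalDefining M δ (c⁻¹ * K) x (‖fderiv ℝ F x‖⁻¹ • F) := by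
  have hpos : 0 < ‖fderiv ℝ F x‖ := hc.trans_le hcF
  have hfderiv : ∀ y ∈ ball x δ,
      fderiv ℝ (‖fderiv ℝ F x‖⁻¹ • F) y = ‖fderiv ℝ F x‖⁻¹ • fderiv ℝ F y :=
    fun y hy => fderiv_const_smul (hF y hy) _
  refine ⟨hδ, hx, fun y hy => (hF y hy).const_smul _, fun y hy => ?_, ?_, fun y hy y' hy' => ?_⟩
  · rw [hMF y hy, Pi.smul_apply, smul_eq_mul, mul_eq_zero_iff_left (inv_ne_zero hpos.ne')]
  · rw [hfderiv x (mem_ball_self hδ), norm_smul, norm_inv, norm_norm, inv_mul_cancel₀ hpos.ne']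
  · rw [hfderiv y hy, hfderiv y' hy', ← smul_sub, norm_smul, norm_inv, norm_norm, mul_assoc]
    gcongr
    exact hK y hy y' hy'

lemma IsC3Surface.exists_isLocalDefining_nhds (hM : IsC3Surface M) {x₀ : E3} (hx₀ : x₀ ∈ M) :
    ∃ r > 0, ∃ L, ∀ x ∈ ball x₀ r, x ∈ M → ∃ F, IsLocalDefining M r L x F := by
  obtain ⟨U, F, hU, hx₀U, hF, hF', hMU⟩ := hM x₀ hx₀
  have hFat : ∀ y ∈ U, ContDiffAt ℝ 3 F y := fun y hy => hF.contDiffAt (hU.mem_nhds hy)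
  have hdF : ContDiffAt ℝ 1 (fderiv ℝ F) x₀ :=
    (hFat x₀ hx₀U).fderiv_right (m := 1) (by norm_num)
  obtain ⟨K, T, hT, hK⟩ := hdF.exists_lipschitzOnWith
  have hpos : 0 < ‖fderiv ℝ F x₀‖ := norm_pos_iff.2 (hF' x₀ hx₀U)
  have hlower : ∀ᶠ y in 𝓝 x₀, ‖fderiv ℝ F x₀‖ / 2 < ‖fderiv ℝ F y‖ :=
    hdF.continuousAt.norm.eventually (lt_mem_nhds (half_lt_self hpos))
  obtain ⟨r, hr, hball⟩ :=
    Metric.mem_nhds_iff.1 (inter_mem (inter_mem (hU.mem_nhds hx₀U) hT) hlower)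
  refine ⟨r / 2, half_pos hr, (‖fderiv ℝ F x₀‖ / 2)⁻¹ * K, fun x hx hxM => ?_⟩
  have hsub : ball x (r / 2) ⊆ ball x₀ r :=
    ball_subset_ball' (by linarith [mem_ball.1 hx])
  exact ⟨_, isLocalDefining_inv_norm_smul (half_pos hr) hxM
    (fun y hy => (hFat y (hball (hsub hy)).1.1).differentiableAt (by simp))
    (fun y hy => by simpa [(hball (hsub hy)).1.1] using Set.ext_iff.1 hMU y) (half_pos hpos)
    (hball (hsub (mem_ball_self (half_pos hr)))).2.le
    fun y hy y' hy' => hK.norm_sub_le (hball (hsub hy)).1.2 (hball (hsub hy')).1.2⟩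

lemma IsC3Surface.exists_isLocalDefining (hM : IsC3Surface M) (hMc : IsCompact M) :
    ∃ δ > 0, ∃ L, ∀ x ∈ M, ∃ F, IsLocalDefining M δ L x F := by
  suffices ∃ δ > 0, ∃ L, ∀ x ∈ M, x ∈ M → ∃ F, IsLocalDefining M δ L x F by
    obtain ⟨δ, hδ, L, h⟩ := this
    exact ⟨δ, hδ, L, fun x hx => h x hx hx⟩
  refine hMc.induction_on (p := fun S => ∃ δ > 0, ∃ L, ∀ x ∈ S, x ∈ M →
    ∃ F, IsLocalDefining M δ L x F) ⟨1, one_pos, 1, by simp⟩ ?mono ?union ?nhds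
  case mono =>
    rintro S S' hS ⟨δ, hδ, L, h⟩
    exact ⟨δ, hδ, L, fun x hx => h x (hS hx)⟩
  case union =>
    rintro S S' ⟨δ, hδ, L, h⟩ ⟨δ', hδ', L', h'⟩
    have hmin : 0 < min δ δ' := lt_min hδ hδ'
    refine ⟨min δ δ', hmin, max L L', ?_⟩
    rintro x (hx | hx) hxM
    · obtain ⟨F, hF⟩ := h x hx hxM
      exact ⟨F, hF.mono hmin (min_le_left _ _) (le_max_left _ _)⟩
    · obtain ⟨F, hF⟩ := h' x hx hxM
      exact ⟨F, hF.mono hmin (min_le_right _ _) (le_max_right _ _)⟩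
  case nhds =>
    intro x hx
    obtain ⟨r, hr, L, h⟩ := hM.exists_isLocalDefining_nhds hx
    exact ⟨ball x r, mem_nhdsWithin_of_mem_nhds (ball_mem_nhds x hr), r, hr, L, h⟩

lemma IsC3Surface.exists_isLocalDefining_mul_le (hM : IsC3Surface M) (hMc : IsCompact M) :
    ∃ δ > 0, ∃ L ≥ 1, L * δ ≤ 1 / 4 ∧ ∀ x ∈ M, ∃ F, IsLocalDefining M δ L x F := by
  obtain ⟨δ, hδ, L, h⟩ := hM.exists_isLocalDefining hMc
  have hmin : 0 < min δ (1 / (4 * max 1 L)) := by positivity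
  refine ⟨_, hmin, max 1 L, le_max_left _ _, ?_, fun x hx => ?_⟩
  · calc max 1 L * min δ (1 / (4 * max 1 L)) ≤ max 1 L * (1 / (4 * max 1 L)) := by
          gcongr
          exact min_le_right _ _
      _ = 1 / 4 := by field_simp
  · obtain ⟨F, hF⟩ := h x hx
    exact ⟨F, hF.mono hmin (min_le_left _ _) (le_max_right _ _)⟩

end Existence

section Frame

lemma norm_sq_E2 (v : E2) : ‖v‖ ^ 2 = v 0 ^ 2 + v 1 ^ 2 := by
  rw [EuclideanSpace.real_norm_sq_eq, Fin.sum_univ_two]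

variable (t : OrthonormalBasis (Fin 3) ℝ E3)

lemma norm_sq_frame (v : E3) :
    ‖v‖ ^ 2 = inner ℝ (t 0) v ^ 2 + inner ℝ (t 1) v ^ 2 + inner ℝ (t 2) v ^ 2 := by
  rw [← t.sum_sq_inner_right v, Fin.sum_univ_three]

lemma norm_tangent_smul_add_smul (w : E2) : ‖w 0 • t 0 + w 1 • t 1‖ = ‖w‖ := by
  rw [← sq_eq_sq₀ (norm_nonneg _) (norm_nonneg _), norm_sq_frame t, norm_sq_E2]
  simp [inner_add_right, real_inner_smul_right, orthonormal_iff_ite.1 t.orthonormal]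

lemma norm_sq_tangentCoord_sub (x y y' : E3) :
    ‖tangentCoord t x y - tangentCoord t x y'‖ ^ 2 + inner ℝ (t 2) (y - y') ^ 2
      = ‖y - y'‖ ^ 2 := by
  rw [norm_sq_frame t, norm_sq_E2]
  simp [tangentCoord, inner_sub_right]

lemma tangentCoord_self (x : E3) : tangentCoord t x x = 0 := by
  ext i; fin_cases i <;> simp [tangentCoord]

lemma norm_tangentCoord_sub_le (x y y' : E3) :
    ‖tangentCoord t x y - tangentCoord t x y'‖ ≤ ‖y - y'‖ := by
  refine le_of_sq_le_sq ?_ (norm_nonneg _)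
  linarith [norm_sq_tangentCoord_sub t x y y', sq_nonneg (inner ℝ (t 2) (y - y'))]

lemma norm_tangentCoord_le (x y : E3) : ‖tangentCoord t x y‖ ≤ ‖y - x‖ := by
  simpa [tangentCoord_self] using norm_tangentCoord_sub_le t x y x

lemma tangentCoord_graphMap (x : E3) (f : E2 → ℝ) (v : E2) :
    tangentCoord t x (graphMap t x f v) = v := by
  ext i
  fin_cases i <;> simp [tangentCoord, graphMap, add_assoc, inner_add_right, real_inner_smul_right,
    orthonormal_iff_ite.1 t.orthonormal]

end Frame

/-- The first two vectors of the frame `t` are tangent to `M` at `x`. -/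
def IsAdapted (M : Set E3) (x : E3) (t : OrthonormalBasis (Fin 3) ℝ E3) : Prop :=
  t 0 ∈ tangentConeAt ℝ M x ∧ t 1 ∈ tangentConeAt ℝ M x

namespace IsLocalDefining

variable {M : Set E3} {δ L : ℝ} {x : E3} {F : E3 → ℝ} {t : OrthonormalBasis (Fin 3) ℝ E3}

lemma lipschitz_nonneg (hF : IsLocalDefining M δ L x F) : 0 ≤ L := by
  obtain ⟨y, hy, hyx⟩ := (NormedSpace.sphere_nonempty (x := x)).2 (half_pos hF.radius_pos).le
    |>.imp fun y hy => (⟨hy, mem_sphere_iff_norm.1 hy⟩ : y ∈ sphere x (δ / 2) ∧ ‖y - x‖ = δ / 2)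
  have hyδ : y ∈ ball x δ := sphere_subset_ball (half_lt_self hF.radius_pos) hy
  refine nonneg_of_mul_nonneg_left ((norm_nonneg _).trans
    (hF.lipschitz y hyδ x (mem_ball_self hF.radius_pos))) ?_
  rw [hyx]
  exact half_pos hF.radius_pos

lemma apply_eq_zero (hF : IsLocalDefining M δ L x F) {y : E3} (hy : y ∈ ball x δ) (hyM : y ∈ M) :
    F y = 0 := (hF.mem_iff y hy).1 hyM

lemma fderiv_tangent_eq_zero (hF : IsLocalDefining M δ L x F) {y : E3} (hy : y ∈ ball x δ)
    (hyM : y ∈ M) {τ : E3} (hτ : τ ∈ tangentConeAt ℝ M y) : fderiv ℝ F y τ = 0 := by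
  have hderiv : HasFDerivWithinAt F (fderiv ℝ F y) M y :=
    (hF.differentiableAt y hy).hasFDerivAt.hasFDerivWithinAt
  have hderiv_zero : HasFDerivWithinAt F (0 : E3 →L[ℝ] ℝ) M y := by
    refine (hasFDerivWithinAt_const (0 : ℝ) y M).congr_of_eventuallyEq ?_ (hF.apply_eq_zero hy hyM)
    filter_upwards [self_mem_nhdsWithin, mem_nhdsWithin_of_mem_nhds (isOpen_ball.mem_nhds hy)]
      with w hwM hw
    exact hF.apply_eq_zero hw hwM
  exact hderiv.unique_on hderiv_zero hτ

lemma fderiv_eq (hF : IsLocalDefining M δ L x F) (ht : IsAdapted M x t) (v : E3) :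
    fderiv ℝ F x v = inner ℝ (t 2) v * fderiv ℝ F x (t 2) := by
  have hx := mem_ball_self (x := x) hF.radius_pos
  conv_lhs => rw [← t.sum_repr' v]
  rw [Fin.sum_univ_three, map_add, map_add, map_smul, map_smul, map_smul,
    hF.fderiv_tangent_eq_zero hx hF.mem ht.1, hF.fderiv_tangent_eq_zero hx hF.mem ht.2]
  simp

lemma abs_fderiv_normal (hF : IsLocalDefining M δ L x F) (ht : IsAdapted M x t) :
    |fderiv ℝ F x (t 2)| = 1 := by
  have hnorm : ‖t 2‖ = 1 := t.orthonormal.1 2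
  refine le_antisymm ?_ ?_
  · simpa only [hF.norm_fderiv, hnorm, one_mul, Real.norm_eq_abs] using
      (fderiv ℝ F x).le_opNorm (t 2)
  · rw [← hF.norm_fderiv]
    refine ContinuousLinearMap.opNorm_le_bound _ (abs_nonneg _) fun v => ?_
    rw [hF.fderiv_eq ht, norm_mul, mul_comm, Real.norm_eq_abs]
    gcongr
    exact (abs_real_inner_le_norm _ _).trans_eq (by rw [hnorm, one_mul])

lemma abs_fderiv_eq (hF : IsLocalDefining M δ L x F) (ht : IsAdapted M x t) (v : E3) :
    |fderiv ℝ F x v| = |inner ℝ (t 2) v| := by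
  rw [hF.fderiv_eq ht, abs_mul, hF.abs_fderiv_normal ht, mul_one]

lemma abs_sub_sub_fderiv_le (hF : IsLocalDefining M δ L x F) {r : ℝ} {s : Set E3}
    (hs : Convex ℝ s) (hsδ : s ⊆ ball x δ) (hsr : s ⊆ closedBall x r) {y y' : E3}
    (hy : y ∈ s) (hy' : y' ∈ s) :
    |F y - F y' - fderiv ℝ F x (y - y')| ≤ L * r * ‖y - y'‖ :=
  hs.norm_image_sub_le_of_norm_hasFDerivWithin_le' (f' := fderiv ℝ F)
    (fun w hw => (hF.differentiableAt w (hsδ hw)).hasFDerivAt.hasFDerivWithinAt)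
    (fun w hw => (hF.lipschitz w (hsδ hw) x (mem_ball_self hF.radius_pos)).trans
      (mul_le_mul_of_nonneg_left (mem_closedBall_iff_norm.1 (hsr hw)) hF.lipschitz_nonneg)) hy' hy

lemma abs_sub_fderiv_le (hF : IsLocalDefining M δ L x F) {y : E3} (hy : y ∈ ball x δ) :
    |F y - fderiv ℝ F x (y - x)| ≤ L * ‖y - x‖ ^ 2 := by
  have hbound := hF.abs_sub_sub_fderiv_le (convex_closedBall x ‖y - x‖)
    (closedBall_subset_ball (mem_ball_iff_norm.1 hy)) Subset.rfl
    (mem_closedBall_iff_norm.2 le_rfl) (mem_closedBall_self (norm_nonneg _))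
  rwa [hF.apply_eq_zero (mem_ball_self hF.radius_pos) hF.mem, sub_zero, mul_assoc, ← sq] at hbound

lemma abs_normal_sub_le (hF : IsLocalDefining M δ L x F) (ht : IsAdapted M x t) {y y' : E3}
    (hy : y ∈ ball x δ) (hyM : y ∈ M) (hy' : y' ∈ ball x δ) (hyM' : y' ∈ M) :
    |inner ℝ (t 2) (y - y')| ≤ L * δ * ‖y - y'‖ := by
  have hbound := hF.abs_sub_sub_fderiv_le (convex_ball x δ) Subset.rfl ball_subset_closedBall hy hy'
  rwa [hF.apply_eq_zero hy hyM, hF.apply_eq_zero hy' hyM', sub_zero, zero_sub, abs_neg,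
    hF.abs_fderiv_eq ht] at hbound

lemma abs_normal_le (hF : IsLocalDefining M δ L x F) (ht : IsAdapted M x t) {y : E3}
    (hy : y ∈ ball x δ) (hyM : y ∈ M) : |inner ℝ (t 2) (y - x)| ≤ L * ‖y - x‖ ^ 2 := by
  simpa only [hF.apply_eq_zero hy hyM, zero_sub, abs_neg, hF.abs_fderiv_eq ht] using
    hF.abs_sub_fderiv_le hy

lemma norm_sub_le (hF : IsLocalDefining M δ L x F) (hLδ : L * δ ≤ 1 / 4) (ht : IsAdapted M x t)
    {y y' : E3} (hy : y ∈ ball x δ) (hyM : y ∈ M) (hy' : y' ∈ ball x δ) (hyM' : y' ∈ M) :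
    ‖y - y'‖ ≤ 2 * ‖tangentCoord t x y - tangentCoord t x y'‖ := by
  have hnormal : |inner ℝ (t 2) (y - y')| ≤ 1 / 4 * ‖y - y'‖ :=
    (hF.abs_normal_sub_le ht hy hyM hy' hyM').trans (by gcongr)
  have hnormal_sq := pow_le_pow_left₀ (abs_nonneg _) hnormal 2
  rw [sq_abs] at hnormal_sq
  refine le_of_sq_le_sq ?_ (by positivity)
  nlinarith [sq_nonneg ‖y - y'‖, norm_sq_tangentCoord_sub t x y y']

lemma abs_normal_tangent_le (hF : IsLocalDefining M δ L x F) (ht : IsAdapted M x t) {y : E3}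
    (hy : y ∈ ball x δ) (hyM : y ∈ M) {τ : E3} (hτ : τ ∈ tangentConeAt ℝ M y) (hτ1 : ‖τ‖ ≤ 1) :
    |inner ℝ (t 2) τ| ≤ L * ‖y - x‖ := by
  have hsub : fderiv ℝ F x τ = (fderiv ℝ F x - fderiv ℝ F y) τ := by
    rw [_root_.sub_apply, hF.fderiv_tangent_eq_zero hy hyM hτ, sub_zero]
  rw [← hF.abs_fderiv_eq ht, hsub, norm_sub_rev, ← mul_one (L * _)]
  exact ContinuousLinearMap.le_of_opNorm_le_of_le _
    (hF.lipschitz x (mem_ball_self hF.radius_pos) y hy) hτ1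

/-- The defining function changes sign along the normal, hence on every small sphere. -/
lemma exists_mem_dist_eq (hF : IsLocalDefining M δ L x F) (hLδ : L * δ ≤ 1 / 4)
    (ht : IsAdapted M x t) {s : ℝ} (hs : 0 < s) (hsδ : s < δ) : ∃ y ∈ M, dist y x = s := by
  have hsub : sphere x s ⊆ ball x δ := sphere_subset_ball hsδ
  have hν := hF.abs_fderiv_normal ht
  have hνν : fderiv ℝ F x (t 2) * fderiv ℝ F x (t 2) = 1 := by
    rw [← abs_mul_abs_self, hν, one_mul]
  set ν := fderiv ℝ F x (t 2)
  have hmem {σ : ℝ} (hσ : |σ| = 1) : x + (s * σ) • t 2 ∈ sphere x s := by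
    rw [mem_sphere_iff_norm, add_sub_cancel_left, norm_smul, t.orthonormal.1 2, mul_one, norm_mul,
      Real.norm_of_nonneg hs.le, Real.norm_eq_abs, hσ, mul_one]
  have hval {σ : ℝ} (hσ : |σ| = 1) : |F (x + (s * σ) • t 2) - s * σ * ν| ≤ s / 4 := by
    have hLs : L * s ≤ 1 / 4 := (mul_le_mul_of_nonneg_left hsδ.le hF.lipschitz_nonneg).trans hLδ
    have hbound := hF.abs_sub_fderiv_le (hsub (hmem hσ))
    rw [mem_sphere_iff_norm.1 (hmem hσ), add_sub_cancel_left, map_smul, smul_eq_mul] at hbound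
    exact hbound.trans (by nlinarith)
  have hpos : 0 ≤ F (x + (s * ν) • t 2) := by nlinarith [(abs_le.1 (hval hν)).1]
  have hν' : |-ν| = 1 := by rwa [abs_neg]
  have hneg : F (x + (s * -ν) • t 2) ≤ 0 := by nlinarith [(abs_le.1 (hval hν')).2]
  have hcont : ContinuousOn F (sphere x s) := fun y hy =>
    (hF.differentiableAt y (hsub hy)).continuousAt.continuousWithinAt
  have hrank : 1 < Module.rank ℝ E3 := by
    rw [← Module.finrank_eq_rank, finrank_euclideanSpace_fin]
    norm_num
  obtain ⟨y, hy, hFy⟩ := (isPreconnected_sphere hrank x s).intermediate_value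
    (hmem hν') (hmem hν) hcont ⟨hneg, hpos⟩
  exact ⟨y, (hF.mem_iff y (hsub hy)).2 hFy, hy⟩

lemma le_abs_fderiv_normal (hF : IsLocalDefining M δ L x F) (hLδ : L * δ ≤ 1 / 4)
    (ht : IsAdapted M x t) {y : E3} (hy : y ∈ ball x δ) : 3 / 4 ≤ |fderiv ℝ F y (t 2)| := by
  have hdist : L * ‖x - y‖ ≤ 1 / 4 := by
    refine le_trans (mul_le_mul_of_nonneg_left ?_ hF.lipschitz_nonneg) hLδ
    exact (mem_ball_iff_norm'.1 hy).le
  have hsub : |fderiv ℝ F x (t 2) - fderiv ℝ F y (t 2)| ≤ L * ‖x - y‖ * 1 :=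
    ContinuousLinearMap.le_of_opNorm_le_of_le (fderiv ℝ F x - fderiv ℝ F y)
      (hF.lipschitz x (mem_ball_self hF.radius_pos) y hy) (t.orthonormal.1 2).le
  have hrev := abs_sub_abs_le_abs_sub (fderiv ℝ F x (t 2)) (fderiv ℝ F y (t 2))
  rw [hF.abs_fderiv_normal ht] at hrev
  linarith

end IsLocalDefining

/-- On the disc of radius `ρ`, the graph of `z` over the plane spanned by `t 0` and `t 1` lies in
`M` and passes through `x`. -/
structure IsLocalGraph (M : Set E3) (x : E3) (t : OrthonormalBasis (Fin 3) ℝ E3) (ρ : ℝ)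
    (z : E2 → ℝ) : Prop where
  zero : z 0 = 0
  differentiableAt : ∀ v ∈ ball (0 : E2) ρ, DifferentiableAt ℝ z v
  mem : ∀ v ∈ ball (0 : E2) ρ, graphMap t x z v ∈ M

namespace IsLocalGraph

variable {M : Set E3} {δ L ρ : ℝ} {x : E3} {F : E3 → ℝ} {t : OrthonormalBasis (Fin 3) ℝ E3}
  {z : E2 → ℝ} {v v' : E2}

/-- A continuity argument: along a ray the graph cannot jump over the gap between the radii `2‖v‖`
and `δ` to another sheet of `M`. -/
lemma norm_graphMap_sub_le (hz : IsLocalGraph M x t ρ z) (hF : IsLocalDefining M δ L x F)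
    (hLδ : L * δ ≤ 1 / 4) (ht : IsAdapted M x t) (hv : v ∈ ball (0 : E2) ρ) (hvδ : ‖v‖ < δ / 4) :
    ‖graphMap t x z v - x‖ ≤ 2 * ‖v‖ := by
  have hδ := hF.radius_pos
  have hseg : ∀ s ∈ Icc (0 : ℝ) 1, s • v ∈ ball (0 : E2) ρ := fun s hs => by
    rw [mem_ball_zero_iff] at hv ⊢
    rw [norm_smul, Real.norm_of_nonneg hs.1]
    exact (mul_le_of_le_one_left (norm_nonneg v) hs.2).trans_lt hv
  have hgap : ∀ s ∈ Icc (0 : ℝ) 1, ‖graphMap t x z (s • v) - x‖ < δ →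
      ‖graphMap t x z (s • v) - x‖ ≤ 2 * ‖v‖ := fun s hs hlt => by
    have hbilip := hF.norm_sub_le hLδ ht (mem_ball_iff_norm.2 hlt) (hz.mem _ (hseg s hs))
      (mem_ball_self hδ) hF.mem
    rw [tangentCoord_graphMap, tangentCoord_self, sub_zero, norm_smul, Real.norm_of_nonneg hs.1]
      at hbilip
    exact hbilip.trans
      (mul_le_mul_of_nonneg_left (mul_le_of_le_one_left (norm_nonneg v) hs.2) zero_le_two)
  have hcont : ContinuousOn (fun s : ℝ => ‖graphMap t x z (s • v) - x‖) (Icc 0 1) := fun s hs =>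
    ((ContinuousAt.comp (f := fun s : ℝ => s • v)
      (hasFDerivAt_graphMap t x (hz.differentiableAt _ (hseg s hs)).hasFDerivAt).continuousAt
      (by fun_prop)).sub continuousAt_const).norm.continuousWithinAt
  have hstart : ‖graphMap t x z ((0 : ℝ) • v) - x‖ = 0 := by
    simp [graphMap, hz.zero]
  have hlt : ‖graphMap t x z ((1 : ℝ) • v) - x‖ < δ := by
    by_contra! hge
    obtain ⟨s, hs, hs'⟩ := intermediate_value_Icc zero_le_one hcont
      (show 3 * δ / 4 ∈ Icc _ _ from
        ⟨hstart.le.trans (by positivity), by linarith⟩)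
    dsimp only at hs'
    linarith [hgap s hs (by rw [hs']; linarith)]
  simpa only [one_smul] using hgap 1 (right_mem_Icc.2 zero_le_one) hlt

lemma graphMap_mem_ball (hz : IsLocalGraph M x t ρ z) (hF : IsLocalDefining M δ L x F)
    (hLδ : L * δ ≤ 1 / 4) (ht : IsAdapted M x t) (hv : v ∈ ball (0 : E2) ρ) (hvδ : ‖v‖ < δ / 4) :
    graphMap t x z v ∈ ball x δ :=
  mem_ball_iff_norm.2 ((hz.norm_graphMap_sub_le hF hLδ ht hv hvδ).trans_lt (by linarith
    [hF.radius_pos]))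

lemma norm_graphMap_sub_graphMap_le (hz : IsLocalGraph M x t ρ z) (hF : IsLocalDefining M δ L x F)
    (hLδ : L * δ ≤ 1 / 4) (ht : IsAdapted M x t) (hv : v ∈ ball (0 : E2) ρ) (hvδ : ‖v‖ < δ / 4)
    (hv' : v' ∈ ball (0 : E2) ρ) (hvδ' : ‖v'‖ < δ / 4) :
    ‖graphMap t x z v - graphMap t x z v'‖ ≤ 2 * ‖v - v'‖ := by
  simpa only [tangentCoord_graphMap] using
    hF.norm_sub_le hLδ ht (hz.graphMap_mem_ball hF hLδ ht hv hvδ) (hz.mem v hv)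
      (hz.graphMap_mem_ball hF hLδ ht hv' hvδ') (hz.mem v' hv')

lemma fderiv_height (hz : IsLocalGraph M x t ρ z) (hF : IsLocalDefining M δ L x F)
    (hv : v ∈ ball (0 : E2) ρ) (hgv : graphMap t x z v ∈ ball x δ) (w : E2) :
    fderiv ℝ z v w * fderiv ℝ F (graphMap t x z v) (t 2)
      = -fderiv ℝ F (graphMap t x z v) (w 0 • t 0 + w 1 • t 1) := by
  have hgraph := hasFDerivAt_graphMap t x (hz.differentiableAt v hv).hasFDerivAt
  have hzero : (F ∘ graphMap t x z) =ᶠ[𝓝 v] fun _ => (0 : ℝ) := by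
    filter_upwards [isOpen_ball.mem_nhds hv, hgraph.continuousAt (isOpen_ball.mem_nhds hgv)]
      with w hw hgw
    exact hF.apply_eq_zero hgw (hz.mem w hw)
  have hchain := congrArg (fun T : E2 →L[ℝ] ℝ => T w)
    (((hF.differentiableAt _ hgv).hasFDerivAt.comp v hgraph).fderiv.symm.trans hzero.fderiv_eq)
  simp only [ContinuousLinearMap.comp_apply, _root_.add_apply,
    ContinuousLinearMap.smulRight_apply, fderiv_fun_const, Pi.zero_apply, _root_.zero_apply]
    at hchain
  rw [map_add, map_smul _ (fderiv ℝ z v w), smul_eq_mul] at hchain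
  exact eq_neg_of_add_eq_zero_right hchain

lemma norm_fderiv_height_le (hz : IsLocalGraph M x t ρ z) (hF : IsLocalDefining M δ L x F)
    (hLδ : L * δ ≤ 1 / 4) (ht : IsAdapted M x t) (hv : v ∈ ball (0 : E2) ρ) (hvδ : ‖v‖ < δ / 4) :
    ‖fderiv ℝ z v‖ ≤ 4 * L * ‖v‖ := by
  have hL := hF.lipschitz_nonneg
  have hx := mem_ball_self (x := x) hF.radius_pos
  have hgv := hz.graphMap_mem_ball hF hLδ ht hv hvδ
  refine ContinuousLinearMap.opNorm_le_bound _ (by positivity) fun w => ?_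
  have htangent : fderiv ℝ F x (w 0 • t 0 + w 1 • t 1) = 0 := by
    rw [map_add, map_smul, map_smul, hF.fderiv_tangent_eq_zero hx hF.mem ht.1,
      hF.fderiv_tangent_eq_zero hx hF.mem ht.2]
    simp
  have hupper : |fderiv ℝ F (graphMap t x z v) (w 0 • t 0 + w 1 • t 1)|
      ≤ (L * (2 * ‖v‖)) * ‖w‖ := by
    rw [← sub_zero (fderiv ℝ F _ _), ← htangent, ← _root_.sub_apply]
    refine ContinuousLinearMap.le_of_opNorm_le_of_le _ ((hF.lipschitz _ hgv x hx).trans ?_)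
      (norm_tangent_smul_add_smul t w).le
    gcongr
    exact hz.norm_graphMap_sub_le hF hLδ ht hv hvδ
  have hlower := hF.le_abs_fderiv_normal hLδ ht hgv
  rw [← abs_neg, ← hz.fderiv_height hF hv hgv w, abs_mul] at hupper
  rw [Real.norm_eq_abs]
  nlinarith [abs_nonneg (fderiv ℝ z v w)]

lemma norm_fderiv_height_sub_le (hz : IsLocalGraph M x t ρ z) (hF : IsLocalDefining M δ L x F)
    (hLδ : L * δ ≤ 1 / 4) (ht : IsAdapted M x t) (hv : v ∈ ball (0 : E2) ρ) (hvδ : ‖v‖ < δ / 4)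
    (hv' : v' ∈ ball (0 : E2) ρ) (hvδ' : ‖v'‖ < δ / 4) :
    ‖fderiv ℝ z v' - fderiv ℝ z v‖ ≤ 4 * L * ‖v' - v‖ := by
  have hL := hF.lipschitz_nonneg
  have hgv := hz.graphMap_mem_ball hF hLδ ht hv hvδ
  have hgv' := hz.graphMap_mem_ball hF hLδ ht hv' hvδ'
  refine ContinuousLinearMap.opNorm_le_bound _ (by positivity) fun w => ?_
  have himplicit := hz.fderiv_height hF hv hgv w
  have himplicit' := hz.fderiv_height hF hv' hgv' w
  have hlower := hF.le_abs_fderiv_normal hLδ ht hgv'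
  have hdist := hz.norm_graphMap_sub_graphMap_le hF hLδ ht hv' hvδ' hv hvδ
  set y := graphMap t x z v
  set y' := graphMap t x z v'
  set D := fderiv ℝ F y' - fderiv ℝ F y with hD_def
  have hD : ‖D‖ ≤ L * (2 * ‖v' - v‖) :=
    (hF.lipschitz _ hgv' _ hgv).trans (mul_le_mul_of_nonneg_left hdist hL)
  have htangent : |D (w 0 • t 0 + w 1 • t 1)| ≤ L * (2 * ‖v' - v‖) * ‖w‖ :=
    ContinuousLinearMap.le_of_opNorm_le_of_le _ hD (norm_tangent_smul_add_smul t w).le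
  have hnormal : |D (t 2)| ≤ L * (2 * ‖v' - v‖) * 1 :=
    ContinuousLinearMap.le_of_opNorm_le_of_le _ hD (t.orthonormal.1 2).le
  have hgrad : |fderiv ℝ z v w| ≤ 1 / 4 * ‖w‖ :=
    ContinuousLinearMap.le_of_opNorm_le _
      ((hz.norm_fderiv_height_le hF hLδ ht hv hvδ).trans (by nlinarith)) w
  have hsplit : (fderiv ℝ z v' - fderiv ℝ z v) w * fderiv ℝ F y' (t 2)
      = -(D (w 0 • t 0 + w 1 • t 1) + fderiv ℝ z v w * D (t 2)) := by
    simp only [hD_def, _root_.sub_apply]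
    linear_combination himplicit' - himplicit
  have hupper : |(fderiv ℝ z v' - fderiv ℝ z v) w| * |fderiv ℝ F y' (t 2)|
      ≤ L * (2 * ‖v' - v‖) * ‖w‖ + 1 / 4 * ‖w‖ * (L * (2 * ‖v' - v‖) * 1) := by
    rw [← abs_mul, hsplit, abs_neg]
    refine (abs_add_le _ _).trans (add_le_add htangent ?_)
    rw [abs_mul]
    gcongr
  rw [Real.norm_eq_abs]
  have hnonneg : 0 ≤ L * ‖v' - v‖ * ‖w‖ := by positivity
  nlinarith [abs_nonneg ((fderiv ℝ z v' - fderiv ℝ z v) w)]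

lemma norm_fderiv_fderiv_height_le (hz : IsLocalGraph M x t ρ z) (hF : IsLocalDefining M δ L x F)
    (hLδ : L * δ ≤ 1 / 4) (ht : IsAdapted M x t) (hv : v ∈ ball (0 : E2) ρ) (hvδ : ‖v‖ < δ / 4) :
    ‖fderiv ℝ (fderiv ℝ z) v‖ ≤ 4 * L := by
  have hL := hF.lipschitz_nonneg
  refine norm_fderiv_le_of_lip' ℝ (by positivity) ?_
  filter_upwards [isOpen_ball.mem_nhds hv, isOpen_ball.mem_nhds (mem_ball_zero_iff.2 hvδ)]
    with v' hv' hvδ'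
  exact hz.norm_fderiv_height_sub_le hF hLδ ht hv hvδ hv' (mem_ball_zero_iff.1 hvδ')

end IsLocalGraph

end Surface

/-! ### Point clouds and quadratic polynomials -/

section Counting

open MeasureTheory Metric Module

variable {E : Type*} [NormedAddCommGroup E] [NormedSpace ℝ E] [FiniteDimensional ℝ E]
  [Nontrivial E] {ι : Type*}

lemma measureReal_addHaar_ball [MeasurableSpace E] [BorelSpace E] (μ : Measure E)
    [μ.IsAddHaarMeasure] (x : E) {r : ℝ} (hr : 0 ≤ r) :
    μ.real (ball x r) = r ^ finrank ℝ E * μ.real (ball 0 1) := by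
  rw [← Measure.addHaar_real_closedBall_eq_addHaar_real_ball,
    Measure.addHaar_real_closedBall μ x hr]

lemma card_mul_pow_le_of_separated (s : Finset ι) (p : ι → E) (c : E) {R q : ℝ} (hq : 0 < q)
    (hR : 0 ≤ R) (hp : ∀ i ∈ s, ‖p i - c‖ ≤ R)
    (hsep : ∀ i ∈ s, ∀ j ∈ s, i ≠ j → 2 * q ≤ ‖p i - p j‖) :
    (s.card : ℝ) * q ^ finrank ℝ E ≤ (R + q) ^ finrank ℝ E := by
  borelize E
  let μ : Measure E := Measure.addHaar
  have hdisj : (s : Set ι).PairwiseDisjoint fun i => ball (p i) q := fun i hi j hj hij =>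
    ball_disjoint_ball (by linarith [hsep i hi j hj hij, dist_eq_norm (p i) (p j)])
  have hsub : (⋃ i ∈ s, ball (p i) q) ⊆ ball c (R + q) :=
    Set.iUnion₂_subset fun i hi =>
      ball_subset_ball' (by linarith [hp i hi, dist_eq_norm (p i) c])
  have hvolume := measureReal_mono (μ := μ) hsub measure_ball_lt_top.ne
  rw [measureReal_biUnion_finset hdisj (fun _ _ => measurableSet_ball)
    (fun _ _ => measure_ball_lt_top.ne), measureReal_addHaar_ball μ c (by positivity)] at hvolume
  simp only [measureReal_addHaar_ball μ _ hq.le, Finset.sum_const, nsmul_eq_mul, ← mul_assoc]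
    at hvolume
  exact le_of_mul_le_mul_right hvolume
    (ENNReal.toReal_pos (measure_ball_pos μ 0 one_pos).ne' measure_ball_lt_top.ne)

lemma pow_le_card_filter_mul_of_cover (s : Finset ι) (p : ι → E) (c : E) {r h : ℝ} (hr : 0 ≤ r)
    (hh : 0 ≤ h) (hcov : ∀ w, ‖w - c‖ < r → ∃ i ∈ s, ‖p i - w‖ ≤ h) :
    r ^ finrank ℝ E ≤ ((s.filter fun i => ‖p i - c‖ ≤ r + h).card : ℝ) * h ^ finrank ℝ E := by
  borelize E
  let μ : Measure E := Measure.addHaar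
  set s' := s.filter fun i => ‖p i - c‖ ≤ r + h
  have hsub : ball c r ⊆ ⋃ i ∈ s', closedBall (p i) h := fun w hw => by
    rw [mem_ball_iff_norm] at hw
    obtain ⟨i, hi, hiw⟩ := hcov w hw
    have hic : ‖p i - c‖ ≤ r + h := by
      linarith [norm_sub_le_norm_sub_add_norm_sub (p i) w c]
    exact Set.mem_iUnion₂.2
      ⟨i, Finset.mem_filter.2 ⟨hi, hic⟩, by rwa [mem_closedBall_iff_norm, norm_sub_rev]⟩
  have hfinite : μ (⋃ i ∈ s', closedBall (p i) h) ≠ ⊤ :=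
    (measure_biUnion_lt_top s'.finite_toSet fun _ _ => measure_closedBall_lt_top).ne
  have hvolume :=
    (measureReal_mono (μ := μ) hsub hfinite).trans (measureReal_biUnion_finset_le s' _)
  rw [measureReal_addHaar_ball μ c hr] at hvolume
  simp only [Measure.addHaar_real_closedBall μ _ hh, Finset.sum_const, nsmul_eq_mul, ← mul_assoc]
    at hvolume
  exact le_of_mul_le_mul_right hvolume
    (ENNReal.toReal_pos (measure_ball_pos μ 0 one_pos).ne' measure_ball_lt_top.ne)

end Counting

section Quadratic

open Metric

lemma abs_mul_apply_le (y : ℝ) (v : E2) (i : Fin 2) : |y * v i| ≤ |y| * ‖v‖ := by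
  rw [abs_mul]
  gcongr
  exact PiLp.norm_apply_le v i

lemma norm_smul_proj_add_smul_proj_le (a b : ℝ) :
    ‖a • (EuclideanSpace.proj 0 : E2 →L[ℝ] ℝ) + b • (EuclideanSpace.proj 1 : E2 →L[ℝ] ℝ)‖
      ≤ |a| + |b| := by
  refine ContinuousLinearMap.opNorm_le_bound _ (by positivity) fun w => ?_
  rw [add_mul]
  exact (abs_add_le _ _).trans (add_le_add (abs_mul_apply_le a w 0) (abs_mul_apply_le b w 1))

lemma contDiff_quadPoly (c : Fin 6 → ℝ) {n : WithTop ℕ∞} : ContDiff ℝ n (quadPoly c) := by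
  unfold quadPoly
  fun_prop

/-- The differential of `quadPoly c` at `v`. -/
noncomputable def quadDeriv (c : Fin 6 → ℝ) (v : E2) : E2 →L[ℝ] ℝ :=
  (2 * c 0 * v 0 + c 2 * v 1 + c 3) • (EuclideanSpace.proj 0 : E2 →L[ℝ] ℝ)
    + (2 * c 1 * v 1 + c 2 * v 0 + c 4) • (EuclideanSpace.proj 1 : E2 →L[ℝ] ℝ)

lemma fderiv_quadPoly (c : Fin 6 → ℝ) : fderiv ℝ (quadPoly c) = quadDeriv c := by
  funext v
  refine HasFDerivAt.fderiv ?_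
  have hcoord : ∀ i, HasFDerivAt (fun v : E2 => v i) (EuclideanSpace.proj i : E2 →L[ℝ] ℝ) v :=
    fun i => (EuclideanSpace.proj i : E2 →L[ℝ] ℝ).hasFDerivAt
  unfold quadPoly
  refine ((((((hcoord 0).pow 2).const_mul (c 0)).add (((hcoord 1).pow 2).const_mul (c 1))).add
    (((hcoord 0).fun_mul (hcoord 1)).const_mul (c 2))).add ((hcoord 0).const_mul (c 3))).add
    ((hcoord 1).const_mul (c 4)) |>.add_const (c 5) |>.congr_fderiv ?_
  ext w
  simp [quadDeriv]
  ring

lemma norm_fderiv_quadPoly_le (c : Fin 6 → ℝ) (v : E2) : ‖fderiv ℝ (quadPoly c) v‖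
    ≤ |c 3| + |c 4| + 2 * (|c 0| + |c 1| + |c 2|) * ‖v‖ := by
  rw [fderiv_quadPoly]
  refine (norm_smul_proj_add_smul_proj_le _ _).trans ?_
  have htriangle₀ := abs_add_three (2 * c 0 * v 0) (c 2 * v 1) (c 3)
  have htriangle₁ := abs_add_three (2 * c 1 * v 1) (c 2 * v 0) (c 4)
  have hsq₀ := abs_mul_apply_le (2 * c 0) v 0
  have hsq₁ := abs_mul_apply_le (2 * c 1) v 1
  rw [abs_mul 2, abs_two] at hsq₀ hsq₁
  linarith [abs_mul_apply_le (c 2) v 0, abs_mul_apply_le (c 2) v 1]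

lemma norm_fderiv_fderiv_quadPoly_le (c : Fin 6 → ℝ) (v : E2) :
    ‖fderiv ℝ (fderiv ℝ (quadPoly c)) v‖ ≤ 2 * (|c 0| + |c 1| + |c 2|) := by
  rw [fderiv_quadPoly]
  refine norm_fderiv_le_of_lip' ℝ (by positivity) (Filter.Eventually.of_forall fun w => ?_)
  -- The differential is affine, so its increments are differentials without the linear terms.
  have hincrement : quadDeriv c w - quadDeriv c v
      = fderiv ℝ (quadPoly ![c 0, c 1, c 2, 0, 0, 0]) (w - v) := by
    rw [fderiv_quadPoly]
    ext y
    simp [quadDeriv]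
    ring
  rw [hincrement]
  simpa using norm_fderiv_quadPoly_le ![c 0, c 1, c 2, 0, 0, 0] (w - v)

/-- Size at length scale `a` of the quadratic polynomial with coefficients `c`: the sum of the
absolute values of its monomials at the point `(a, a)`. -/
noncomputable def quadSize (a : ℝ) (c : Fin 6 → ℝ) : ℝ :=
  |c 5| + a * (|c 3| + |c 4|) + a ^ 2 * (|c 0| + |c 1| + |c 2|)

lemma quadSize_nonneg {a : ℝ} (ha : 0 ≤ a) (c : Fin 6 → ℝ) : 0 ≤ quadSize a c := by
  unfold quadSize
  positivity

lemma mul_norm_fderiv_quadPoly_le {a r : ℝ} (ha : 0 ≤ a) (hr : 1 ≤ r) (c : Fin 6 → ℝ) {v : E2}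
    (hv : ‖v‖ ≤ r * a) : a * ‖fderiv ℝ (quadPoly c) v‖ ≤ 2 * r * quadSize a c :=
  calc a * ‖fderiv ℝ (quadPoly c) v‖
      ≤ a * (|c 3| + |c 4| + 2 * (|c 0| + |c 1| + |c 2|) * (r * a)) := by
        grw [norm_fderiv_quadPoly_le, hv]
    _ = 1 * (a * (|c 3| + |c 4|)) + 2 * r * (a ^ 2 * (|c 0| + |c 1| + |c 2|)) := by ring
    _ ≤ 2 * r * |c 5| + 2 * r * (a * (|c 3| + |c 4|))
        + 2 * r * (a ^ 2 * (|c 0| + |c 1| + |c 2|)) := by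
      rw [← zero_add (1 * _)]
      gcongr
      · positivity
      · linarith
    _ = 2 * r * quadSize a c := by unfold quadSize; ring

lemma sq_mul_norm_fderiv_fderiv_quadPoly_le {a : ℝ} (ha : 0 ≤ a) (c : Fin 6 → ℝ) (v : E2) :
    a ^ 2 * ‖fderiv ℝ (fderiv ℝ (quadPoly c)) v‖ ≤ 2 * quadSize a c := by
  have hlower : 0 ≤ |c 5| + a * (|c 3| + |c 4|) := by positivity
  grw [norm_fderiv_fderiv_quadPoly_le]
  unfold quadSize
  linarith

lemma mul_abs_quadPoly_sub_le {a r : ℝ} (ha : 0 ≤ a) (hr : 1 ≤ r) (c : Fin 6 → ℝ) {v w : E2}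
    (hv : ‖v‖ ≤ r * a) (hw : ‖w‖ ≤ r * a) :
    a * |quadPoly c v - quadPoly c w| ≤ 2 * r * quadSize a c * ‖v - w‖ := by
  rcases ha.eq_or_lt with rfl | hpos
  · rw [zero_mul]
    have := quadSize_nonneg le_rfl c
    positivity
  rw [mul_comm a, ← le_div_iff₀ hpos, ← div_mul_eq_mul_div]
  refine (convex_closedBall (0 : E2) (r * a)).norm_image_sub_le_of_norm_fderiv_le (𝕜 := ℝ)
    (fun y _ => (contDiff_quadPoly c (n := 1)).contDiffAt.differentiableAt one_ne_zero)
    (fun y hy => ?_) (mem_closedBall_zero_iff.2 hw) (mem_closedBall_zero_iff.2 hv)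
  rw [le_div_iff₀ hpos, mul_comm]
  exact mul_norm_fderiv_quadPoly_le ha hr c (mem_closedBall_zero_iff.1 hy)

/-- Finite differences: the values at `0`, `(±a, 0)`, `(0, ±a)` and `(a, a)` determine the
coefficients. -/
lemma quadSize_lt_of_abs_quadPoly_lt {a m : ℝ} (ha : 0 ≤ a) (c : Fin 6 → ℝ)
    (hm : ∀ w : E2, |w 0| ≤ a → |w 1| ≤ a → |quadPoly c w| < m) : quadSize a c < 11 * m := by
  have hvalue : ∀ s r : ℝ, |s| ≤ a → |r| ≤ a →
      -m < c 0 * s ^ 2 + c 1 * r ^ 2 + c 2 * (s * r) + c 3 * s + c 4 * r + c 5 ∧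
        c 0 * s ^ 2 + c 1 * r ^ 2 + c 2 * (s * r) + c 3 * s + c 4 * r + c 5 < m :=
    fun s r hs hr => abs_lt.1 <| by
      simpa [quadPoly] using hm !₂[s, r] (by simpa using hs) (by simpa using hr)
  have hzero : |(0 : ℝ)| ≤ a := by rwa [abs_zero]
  have hpos : |a| ≤ a := (abs_of_nonneg ha).le
  have hneg : |-a| ≤ a := by rwa [abs_neg]
  have horigin := hvalue 0 0 hzero hzero
  have heast := hvalue a 0 hpos hzero
  have hwest := hvalue (-a) 0 hneg hzero
  have hnorth := hvalue 0 a hzero hpos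
  have hsouth := hvalue 0 (-a) hzero hneg
  have hcorner := hvalue a a hpos hpos
  ring_nf at horigin heast hwest hnorth hsouth hcorner
  have hconst : |c 5| < m := abs_lt.2 ⟨by linarith, by linarith⟩
  have hlinear₀ : |a * c 3| < m := abs_lt.2 ⟨by linarith, by linarith⟩
  have hlinear₁ : |a * c 4| < m := abs_lt.2 ⟨by linarith, by linarith⟩
  have hquadratic₀ : |a ^ 2 * c 0| < 2 * m := abs_lt.2 ⟨by linarith, by linarith⟩
  have hquadratic₁ : |a ^ 2 * c 1| < 2 * m := abs_lt.2 ⟨by linarith, by linarith⟩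
  have hmixed : |a ^ 2 * c 2| < 4 * m := abs_lt.2 ⟨by linarith, by linarith⟩
  rw [abs_mul, abs_of_nonneg ha] at hlinear₀ hlinear₁
  rw [abs_mul, abs_of_nonneg (sq_nonneg a)] at hquadratic₀ hquadratic₁ hmixed
  unfold quadSize
  linarith

lemma exists_quadSize_le {a : ℝ} (ha : 0 ≤ a) (c : Fin 6 → ℝ) :
    ∃ w : E2, |w 0| ≤ a ∧ |w 1| ≤ a ∧ quadSize a c ≤ 11 * |quadPoly c w| := by
  by_contra! hsmall
  refine (quadSize_lt_of_abs_quadPoly_lt (m := quadSize a c / 11) ha c fun w hw₀ hw₁ => ?_).ne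
    (by ring)
  linarith [hsmall w hw₀ hw₁]

lemma exists_disc_quadSize_le {a : ℝ} (ha : 0 < a) (c : Fin 6 → ℝ) :
    ∃ w : E2, ‖w‖ ≤ 2 * a ∧
      ∀ v : E2, ‖v - w‖ ≤ a / 200 → quadSize a c ≤ 22 * |quadPoly c v| := by
  obtain ⟨w, hw₀, hw₁, hw⟩ := exists_quadSize_le ha.le c
  have hw_norm : ‖w‖ ≤ 2 * a := by
    refine le_of_sq_le_sq ?_ (by positivity)
    rw [norm_sq_E2]
    linarith [sq_le_sq' (abs_le.1 hw₀).1 (abs_le.1 hw₀).2,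
      sq_le_sq' (abs_le.1 hw₁).1 (abs_le.1 hw₁).2, sq_nonneg a]
  refine ⟨w, hw_norm, fun v hv => ?_⟩
  have hv_norm : ‖v‖ ≤ 3 * a := by linarith [norm_le_norm_add_norm_sub' v w]
  have hosc : |quadPoly c w - quadPoly c v| ≤ quadSize a c / 22 := by
    refine le_of_mul_le_mul_left ((mul_abs_quadPoly_sub_le ha.le (r := 3) (by norm_num) c
      (hw_norm.trans (by linarith)) hv_norm).trans ?_) ha
    rw [norm_sub_rev]
    nlinarith [quadSize_nonneg ha.le c]
  linarith [abs_sub_abs_le_abs_sub (quadPoly c w) (quadPoly c v)]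

lemma card_filter_mul_quadSize_sq_le {ι : Type*} (K : Finset ι) (v : ι → E2) (c : Fin 6 → ℝ)
    {a b r : ℝ} {w : E2} (ha : 0 ≤ a)
    (hw : ∀ y : E2, ‖y - w‖ ≤ r → quadSize a c ≤ 22 * |quadPoly c y|)
    (hsum : ∑ j ∈ K, quadPoly c (v j) ^ 2 ≤ K.card * b ^ 2) :
    ((K.filter fun j => ‖v j - w‖ ≤ r).card : ℝ) * quadSize a c ^ 2
      ≤ 22 ^ 2 * (K.card * b ^ 2) := by
  calc ((K.filter fun j => ‖v j - w‖ ≤ r).card : ℝ) * quadSize a c ^ 2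
      = ∑ j ∈ K with ‖v j - w‖ ≤ r, quadSize a c ^ 2 := by rw [Finset.sum_const, nsmul_eq_mul]
    _ ≤ ∑ j ∈ K with ‖v j - w‖ ≤ r, 22 ^ 2 * quadPoly c (v j) ^ 2 := by
      refine Finset.sum_le_sum fun j hj => ?_
      rw [← sq_abs (quadPoly c _), ← mul_pow]
      gcongr
      exacts [quadSize_nonneg ha c, hw (v j) (Finset.mem_filter.1 hj).2]
    _ ≤ ∑ j ∈ K, 22 ^ 2 * quadPoly c (v j) ^ 2 :=
      Finset.sum_le_sum_of_subset_of_nonneg (Finset.filter_subset _ _) fun _ _ _ => by positivity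
    _ ≤ 22 ^ 2 * (K.card * b ^ 2) := by
      rw [← Finset.mul_sum]
      gcongr

/-- The sample points have density between `1 / h ^ 2` and `1 / q ^ 2`, and a fixed fraction of the
disc of radius `D` is taken up by a small disc on which the polynomial is as large as its
coefficients. The factor `4000` makes the sample resolve that small disc. -/
lemma quadSize_le_of_sum_sq_le {ι : Type*} (K : Finset ι) (v : ι → E2) (c : Fin 6 → ℝ)
    {D h q b : ℝ} (hh : 0 < h) (hq : 0 < q) (hqD : q ≤ D) (hD : 4000 * h ≤ D) (hb : 0 ≤ b)
    (hv : ∀ j ∈ K, ‖v j‖ ≤ D) (hsep : ∀ i ∈ K, ∀ j ∈ K, i ≠ j → 2 * q ≤ ‖v i - v j‖)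
    (hcov : ∀ w : E2, ‖w‖ ≤ D / 4 → ∃ j ∈ K, ‖v j - w‖ ≤ h)
    (hsum : ∑ j ∈ K, quadPoly c (v j) ^ 2 ≤ K.card * b ^ 2) :
    quadSize (D / 10) c ≤ 176000 * (h / q) * b := by
  have hD₀ : 0 < D := hq.trans_le hqD
  obtain ⟨w, hw, hwP⟩ := exists_disc_quadSize_le (a := D / 10) (by positivity) c
  have hmass := card_filter_mul_quadSize_sq_le K v c (w := w) (r := D / 4000 + h) (by positivity)
    (fun y hy => hwP y (by linarith)) hsum
  have hmany := pow_le_card_filter_mul_of_cover K v w (r := D / 4000) (by positivity) hh.le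
    fun y hy => hcov y (by linarith [norm_le_norm_add_norm_sub' y w])
  have hfew := card_mul_pow_le_of_separated K v 0 hq hD₀.le (fun j hj => by simpa using hv j hj)
    hsep
  rw [finrank_euclideanSpace_fin] at hmany hfew
  set S := quadSize (D / 10) c
  set n : ℝ := ((K.filter fun j => ‖v j - w‖ ≤ D / 4000 + h).card : ℝ)
  have _ : 0 ≤ S := quadSize_nonneg (by positivity) c
  have hsq : (D / 4000) ^ 2 * (S * q) ^ 2 ≤ (D / 4000) ^ 2 * (176000 * h * b) ^ 2 :=
    calc (D / 4000) ^ 2 * (S * q) ^ 2 ≤ n * h ^ 2 * (S * q) ^ 2 := by gcongr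
      _ = h ^ 2 * q ^ 2 * (n * S ^ 2) := by ring
      _ ≤ h ^ 2 * q ^ 2 * (22 ^ 2 * (K.card * b ^ 2)) := by gcongr
      _ = 22 ^ 2 * h ^ 2 * (K.card * q ^ 2) * b ^ 2 := by ring
      _ ≤ 22 ^ 2 * h ^ 2 * (D + D) ^ 2 * b ^ 2 := by
        gcongr
        exact hfew.trans (by gcongr)
      _ = (D / 4000) ^ 2 * (176000 * h * b) ^ 2 := by ring
  have hbound : S * q ≤ 176000 * h * b :=
    le_of_sq_le_sq (le_of_mul_le_mul_left hsq (by positivity)) (by positivity)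
  rw [← le_div_iff₀ hq] at hbound
  exact hbound.trans_eq (by ring)

end Quadratic

/-- The squared form of `‖a‖ ‖b‖ ‖a - b‖ = 4 R T` for the triangle `0, a, b` with circumradius
`R` and area `T`. -/
lemma norm_sq_mul_norm_sq_mul_norm_sub_sq_of_dist_eq {a b c : E2} (ha : dist a c = ‖c‖)
    (hb : dist b c = ‖c‖) :
    ‖a‖ ^ 2 * ‖b‖ ^ 2 * ‖a - b‖ ^ 2 = 4 * ‖c‖ ^ 2 * (a 0 * b 1 - a 1 * b 0) ^ 2 := by
  have ha_sq : ‖a - c‖ ^ 2 = ‖c‖ ^ 2 := by rw [← dist_eq_norm, ha]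
  have hb_sq : ‖b - c‖ ^ 2 = ‖c‖ ^ 2 := by rw [← dist_eq_norm, hb]
  simp only [norm_sq_E2, PiLp.sub_apply] at ha_sq hb_sq ⊢
  have ha_inner : a 0 ^ 2 + a 1 ^ 2 = 2 * (a 0 * c 0 + a 1 * c 1) := by linarith
  have hb_inner : b 0 ^ 2 + b 1 ^ 2 = 2 * (b 0 * c 0 + b 1 * c 1) := by linarith
  have hcramer₀ : 2 * (a 0 * b 1 - a 1 * b 0) * c 0
      = (a 0 ^ 2 + a 1 ^ 2) * b 1 - (b 0 ^ 2 + b 1 ^ 2) * a 1 := by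
    rw [ha_inner, hb_inner]
    ring
  have hcramer₁ : 2 * (a 0 * b 1 - a 1 * b 0) * c 1
      = (b 0 ^ 2 + b 1 ^ 2) * a 0 - (a 0 ^ 2 + a 1 ^ 2) * b 0 := by
    rw [ha_inner, hb_inner]
    ring
  calc _ = ((a 0 ^ 2 + a 1 ^ 2) * b 1 - (b 0 ^ 2 + b 1 ^ 2) * a 1) ^ 2
        + ((b 0 ^ 2 + b 1 ^ 2) * a 0 - (a 0 ^ 2 + a 1 ^ 2) * b 0) ^ 2 := by ring
    _ = _ := by
      rw [← hcramer₀, ← hcramer₁]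
      ring

/-! ### The first ring of a fine mesh -/

section Weight

variable {E : Type*} [NormedAddCommGroup E] [InnerProductSpace ℝ E]

lemma one_div_le_lsWeight (k : ℕ) (s : ℝ) : 1 / (k : ℝ) ≤ lsWeight k s := by
  unfold lsWeight
  split_ifs
  · rw [one_div]
    exact Nat.cast_inv_le_one k
  · exact le_rfl

/-- The exceptional weight sits at the base point, where the fitted value vanishes. -/
lemma lsWeight_mul_inner_sq (k : ℕ) (n x y : E) :
    lsWeight k ‖x - y‖ * inner ℝ n (y - x) ^ 2 = 1 / (k : ℝ) * inner ℝ n (y - x) ^ 2 := by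
  unfold lsWeight
  split_ifs with hxy
  · rw [← neg_sub, neg_eq_zero.2 (norm_eq_zero.1 hxy)]
    simp
  · rfl

end Weight

namespace CurvedMesh

open Metric

variable {M : Set E3} {N k : ℕ}

/-- The radius of the ambient neighbourhood of `x_i`. -/
noncomputable def reach (X : CurvedMesh M N k) (i : Fin N) : ℝ :=
  (X.K i).sup' ⟨i, X.self_mem i⟩ fun j => ‖X.x j - X.x i‖

/-- The normal coordinate of `x_j` at `x_i`: the value to be fitted at `v_j`. -/
noncomputable def normalCoord (X : CurvedMesh M N k) (i j : Fin N) : ℝ :=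
  inner ℝ (X.t i 2) (X.x j - X.x i)

/-- The vertices of the triangle `p` of the first ring at `x_i`. -/
def corners (i : Fin N) (p : Fin N × Fin N) : Finset (Fin N) := {i, p.1, p.2}

/-- Quasi-uniform meshes in the asymptotic regime: `δ` and `L` are the radius and the curvature
bound of local defining functions of `M`, `γ` bounds the ratio of fill and separation distance,
and `σ` the radii of the neighbourhoods relative to the square root of the fill distance. -/
structure IsFine (δ L γ σ : ℝ) (X : CurvedMesh M N k) : Prop where
  one_le_L : 1 ≤ L
  L_mul_δ : L * δ ≤ 1 / 4
  localDefining : ∀ i, ∃ F, IsLocalDefining M δ L (X.x i) F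
  one_le_γ : 1 ≤ γ
  one_le_σ : 1 ≤ σ
  fill_pos : 0 < X.fill
  fill_le_one : X.fill ≤ 1
  fill_lt : 32 * X.fill < δ
  rad_lt : ∀ i, X.rad i < 3 * δ / 16
  rad_le : ∀ i, X.rad i ≤ σ * √X.fill
  cover : ∀ y ∈ M, ∃ j, ‖X.x j - y‖ ≤ X.fill
  sep_le : ∀ i j, i ≠ j → 2 * (X.fill / γ) ≤ ‖X.x i - X.x j‖
  lt_k : (4000 * γ + 1) ^ 3 < k

/-- Height functions with gradient `O(√fill)` and bounded Hessian near the first rings, whose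
vertices lie in the discs of radius `4 * fill`. -/
structure IsFlat (K : ℝ) (X : CurvedMesh M N k) (f : Fin N → E2 → ℝ) : Prop where
  contDiffAt : ∀ i v, ‖v‖ ≤ 4 * X.fill → ContDiffAt ℝ 2 (f i) v
  grad_le : ∀ i v, ‖v‖ ≤ 4 * X.fill → ‖fderiv ℝ (f i) v‖ ≤ K * √X.fill
  hess_le : ∀ i v, ‖v‖ ≤ 4 * X.fill → ‖fderiv ℝ (fderiv ℝ (f i)) v‖ ≤ K

variable {X : CurvedMesh M N k} {δ L γ σ : ℝ} {i j m : Fin N} {p : Fin N × Fin N}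

lemma norm_sub_le_reach (hj : j ∈ X.K i) : ‖X.x j - X.x i‖ ≤ X.reach i :=
  Finset.le_sup' (fun j => ‖X.x j - X.x i‖) hj

lemma exists_reach_eq (X : CurvedMesh M N k) (i : Fin N) :
    ∃ j ∈ X.K i, X.reach i = ‖X.x j - X.x i‖ :=
  Finset.exists_mem_eq_sup' _ _

lemma norm_v_le_rad (hj : j ∈ X.K i) : ‖X.v i j‖ ≤ X.rad i :=
  Finset.le_sup' (fun j => ‖X.v i j‖) hj

lemma v_self (X : CurvedMesh M N k) (i : Fin N) : X.v i i = 0 := tangentCoord_self _ _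

lemma mem_K_of_lt (hj : j ∈ X.K i) (hm : ‖X.x m - X.x i‖ < ‖X.x j - X.x i‖) : m ∈ X.K i := by
  by_contra hmK
  have hle := X.K_nearest i j hj m hmK
  rw [dist_comm, dist_comm (X.x i), dist_eq_norm, dist_eq_norm] at hle
  exact hm.not_ge hle

lemma k_pos (X : CurvedMesh M N k) (i : Fin N) : 0 < k :=
  X.K_card i ▸ Finset.card_pos.2 ⟨i, X.self_mem i⟩

lemma sum_residual_sq_le (X : CurvedMesh M N k) (i : Fin N) :
    ∑ j ∈ X.K i, (X.fit i (X.v i j) - X.normalCoord i j) ^ 2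
      ≤ ∑ j ∈ X.K i, X.normalCoord i j ^ 2 := by
  have hk : 0 < 1 / (k : ℝ) := one_div_pos.2 (Nat.cast_pos.2 (X.k_pos i))
  refine le_of_mul_le_mul_left ?_ hk
  rw [Finset.mul_sum, Finset.mul_sum]
  calc ∑ j ∈ X.K i, 1 / (k : ℝ) * (X.fit i (X.v i j) - X.normalCoord i j) ^ 2
      ≤ ∑ j ∈ X.K i, lsWeight k ‖X.x i - X.x j‖
          * (X.fit i (X.v i j) - X.normalCoord i j) ^ 2 := by
        gcongr
        exact one_div_le_lsWeight k _
    _ ≤ ∑ j ∈ X.K i, lsWeight k ‖X.x i - X.x j‖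
          * (quadPoly 0 (X.v i j) - X.normalCoord i j) ^ 2 := X.coef_min i 0
    _ = ∑ j ∈ X.K i, 1 / (k : ℝ) * X.normalCoord i j ^ 2 :=
      Finset.sum_congr rfl fun j _ => by
        have hzero : quadPoly 0 (X.v i j) = 0 := by simp [quadPoly]
        rw [hzero, zero_sub, neg_sq]
        exact lsWeight_mul_inner_sq k _ _ _

lemma mem_ring_iff : p ∈ X.ring i ↔ p.1 < p.2 ∧ corners i p ∈ X.tri i := by
  simp [ring, corners]

lemma ring_distinct (hp : p ∈ X.ring i) : p.1 ≠ i ∧ p.2 ≠ i ∧ p.1 ≠ p.2 := by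
  obtain ⟨hlt, htri⟩ := mem_ring_iff.1 hp
  have hcard := (X.tri_delaunay i).card _ htri
  refine ⟨fun heq => ?_, fun heq => ?_, hlt.ne⟩
  · rw [corners, heq, Finset.insert_idem] at hcard
    exact absurd hcard (Finset.card_le_two.trans_lt (by norm_num)).ne
  · rw [corners, heq, Finset.insert_eq_of_mem (by simp)] at hcard
    exact absurd hcard (Finset.card_le_two.trans_lt (by norm_num)).ne

lemma corners_subset_K (hp : p ∈ X.ring i) : corners i p ⊆ X.K i :=
  (X.tri_delaunay i).subset _ (mem_ring_iff.1 hp).2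

lemma self_mem_corners (i : Fin N) (p : Fin N × Fin N) : i ∈ corners i p := by simp [corners]

lemma fst_mem_corners (i : Fin N) (p : Fin N × Fin N) : p.1 ∈ corners i p := by simp [corners]

lemma snd_mem_corners (i : Fin N) (p : Fin N × Fin N) : p.2 ∈ corners i p := by simp [corners]

namespace IsFine

lemma γ_pos (hX : X.IsFine δ L γ σ) : 0 < γ := zero_lt_one.trans_le hX.one_le_γ

lemma L_pos (hX : X.IsFine δ L γ σ) : 0 < L := zero_lt_one.trans_le hX.one_le_L

lemma fill_le_sqrt (hX : X.IsFine δ L γ σ) : X.fill ≤ √X.fill :=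
  Real.le_sqrt_of_sq_le (pow_le_of_le_one hX.fill_pos.le hX.fill_le_one two_ne_zero)

lemma exists_far_sample (hX : X.IsFine δ L γ σ) (i : Fin N) :
    ∃ m, 3 * δ / 8 ≤ ‖X.x m - X.x i‖ ∧ ‖X.x m - X.x i‖ < δ := by
  obtain ⟨F, hF⟩ := hX.localDefining i
  have hδ := hF.radius_pos
  obtain ⟨y, hyM, hy⟩ := hF.exists_mem_dist_eq hX.L_mul_δ (X.t_tangent i) (s := δ / 2)
    (by positivity) (by linarith)
  obtain ⟨m, hm⟩ := hX.cover y hyM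
  rw [dist_eq_norm] at hy
  have hupper := norm_sub_le_norm_sub_add_norm_sub (X.x m) y (X.x i)
  have hlower := norm_sub_le_norm_sub_add_norm_sub y (X.x m) (X.x i)
  rw [norm_sub_rev y (X.x m)] at hlower
  exact ⟨m, by linarith [hX.fill_lt], by linarith [hX.fill_lt]⟩

lemma mem_ball (hX : X.IsFine δ L γ σ) (hj : j ∈ X.K i) : X.x j ∈ ball (X.x i) δ := by
  rw [mem_ball_iff_norm]
  by_contra! hge
  obtain ⟨F, hF⟩ := hX.localDefining i
  obtain ⟨m, hm, hmδ⟩ := hX.exists_far_sample i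
  have hmK : m ∈ X.K i := mem_K_of_lt hj (hmδ.trans_le hge)
  have hdist := hF.norm_sub_le hX.L_mul_δ (X.t_tangent i) (mem_ball_iff_norm.2 hmδ) (X.x_mem m)
    (mem_ball_self hF.radius_pos) hF.mem
  rw [tangentCoord_self, sub_zero] at hdist
  have hrad : ‖tangentCoord (X.t i) (X.x i) (X.x m)‖ ≤ X.rad i := norm_v_le_rad hmK
  linarith [hX.rad_lt i]

lemma norm_sub_le (hX : X.IsFine δ L γ σ) (hj : j ∈ X.K i) (hm : m ∈ X.K i) :
    ‖X.x j - X.x m‖ ≤ 2 * ‖X.v i j - X.v i m‖ := by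
  obtain ⟨F, hF⟩ := hX.localDefining i
  exact hF.norm_sub_le hX.L_mul_δ (X.t_tangent i) (hX.mem_ball hj) (X.x_mem j) (hX.mem_ball hm)
    (X.x_mem m)

lemma norm_sub_self_le (hX : X.IsFine δ L γ σ) (hj : j ∈ X.K i) :
    ‖X.x j - X.x i‖ ≤ 2 * ‖X.v i j‖ := by
  simpa [v_self] using hX.norm_sub_le hj (X.self_mem i)

lemma fill_div_le_norm_v_sub (hX : X.IsFine δ L γ σ) (hj : j ∈ X.K i) (hm : m ∈ X.K i)
    (hjm : j ≠ m) : X.fill / γ ≤ ‖X.v i j - X.v i m‖ := by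
  linarith [hX.norm_sub_le hj hm, hX.sep_le j m hjm]

lemma fill_div_le_norm_v (hX : X.IsFine δ L γ σ) (hj : j ∈ X.K i) (hji : j ≠ i) :
    X.fill / γ ≤ ‖X.v i j‖ := by
  simpa [v_self] using hX.fill_div_le_norm_v_sub hj (X.self_mem i) hji

lemma reach_le (hX : X.IsFine δ L γ σ) (i : Fin N) : X.reach i ≤ 2 * σ * √X.fill := by
  obtain ⟨j, hj, hreach⟩ := X.exists_reach_eq i
  linarith [hX.norm_sub_self_le hj, norm_v_le_rad hj, hX.rad_le i]

lemma reach_lt (hX : X.IsFine δ L γ σ) (i : Fin N) : X.reach i < δ := by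
  obtain ⟨j, hj, hreach⟩ := X.exists_reach_eq i
  exact hreach.trans_lt (mem_ball_iff_norm.1 (hX.mem_ball hj))

lemma card_le_of_norm_sub_le (hX : X.IsFine δ L γ σ) (s : Finset (Fin N)) (i : Fin N) {R : ℝ}
    (hR : 0 ≤ R) (hs : ∀ j ∈ s, ‖X.x j - X.x i‖ ≤ R * X.fill) :
    (s.card : ℝ) ≤ (R * γ + 1) ^ 3 := by
  have hfill := hX.fill_pos
  have hγ := hX.γ_pos
  have hcard := card_mul_pow_le_of_separated s X.x (X.x i) (R := R * X.fill) (q := X.fill / γ)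
    (by positivity) (by positivity) hs fun a _ b _ hab => hX.sep_le a b hab
  have hsum : R * X.fill + X.fill / γ = (R * γ + 1) * (X.fill / γ) := by field_simp
  rw [finrank_euclideanSpace_fin, hsum, mul_pow] at hcard
  exact le_of_mul_le_mul_right hcard (by positivity)

lemma mul_fill_le_reach (hX : X.IsFine δ L γ σ) (i : Fin N) : 4000 * X.fill ≤ X.reach i := by
  by_contra! hlt
  have hcard := hX.card_le_of_norm_sub_le (X.K i) i (R := 4000) (by norm_num)
    fun j hj => (norm_sub_le_reach hj).trans hlt.le
  rw [X.K_card] at hcard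
  exact hX.lt_k.not_ge hcard

lemma exists_isLocalGraph (hX : X.IsFine δ L γ σ) (i : Fin N) : ∃ ρ, X.reach i / 4 < ρ ∧
    ContDiffOn ℝ 3 (X.z i) (ball 0 ρ) ∧ IsLocalGraph M (X.x i) (X.t i) ρ (X.z i) := by
  obtain ⟨ρ, hρ, hz, hzM⟩ := X.z_chart i
  obtain ⟨j, hj, hreach⟩ := X.exists_reach_eq i
  have hjρ : ‖X.v i j‖ < ρ := hρ j hj
  refine ⟨ρ, by linarith [hX.norm_sub_self_le hj, norm_nonneg (X.v i j)], hz, X.z_zero i,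
    fun v hv => ?_, hzM⟩
  exact (hz.contDiffAt (isOpen_ball.mem_nhds hv)).differentiableAt (by norm_num)

lemma exists_norm_v_sub_le (hX : X.IsFine δ L γ σ) (i : Fin N) {w : E2}
    (hw : ‖w‖ ≤ X.reach i / 4) : ∃ j ∈ X.K i, ‖X.v i j - w‖ ≤ X.fill := by
  obtain ⟨ρ, hρ, -, hz⟩ := hX.exists_isLocalGraph i
  obtain ⟨F, hF⟩ := hX.localDefining i
  have hwρ : w ∈ ball (0 : E2) ρ := mem_ball_zero_iff.2 (hw.trans_lt hρ)
  set y := graphMap (X.t i) (X.x i) (X.z i) w with hy_def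
  have hy : ‖y - X.x i‖ ≤ 2 * ‖w‖ := hz.norm_graphMap_sub_le hF hX.L_mul_δ (X.t_tangent i) hwρ
    (by linarith [hX.reach_lt i])
  obtain ⟨m, hm⟩ := hX.cover y (hz.mem w hwρ)
  obtain ⟨j, hj, hreach⟩ := X.exists_reach_eq i
  have hmi := norm_sub_le_norm_sub_add_norm_sub (X.x m) y (X.x i)
  have hmK : m ∈ X.K i := mem_K_of_lt hj (by linarith [hX.mul_fill_le_reach i, hX.fill_pos])
  have hproj := norm_tangentCoord_sub_le (X.t i) (X.x i) (X.x m) y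
  rw [hy_def, tangentCoord_graphMap] at hproj
  exact ⟨m, hmK, hproj.trans hm⟩

lemma sum_fit_sq_le (hX : X.IsFine δ L γ σ) (i : Fin N) :
    ∑ j ∈ X.K i, X.fit i (X.v i j) ^ 2 ≤ (X.K i).card * (2 * L * X.reach i ^ 2) ^ 2 := by
  obtain ⟨F, hF⟩ := hX.localDefining i
  have hL := hX.L_pos
  have hnormal : ∀ j ∈ X.K i, X.normalCoord i j ^ 2 ≤ (L * X.reach i ^ 2) ^ 2 := fun j hj => by
    rw [← sq_abs]
    have hcurv : |X.normalCoord i j| ≤ L * ‖X.x j - X.x i‖ ^ 2 :=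
      hF.abs_normal_le (X.t_tangent i) (hX.mem_ball hj) (X.x_mem j)
    grw [hcurv, norm_sub_le_reach hj]
  calc ∑ j ∈ X.K i, X.fit i (X.v i j) ^ 2
      ≤ ∑ j ∈ X.K i, (2 * (X.fit i (X.v i j) - X.normalCoord i j) ^ 2
          + 2 * X.normalCoord i j ^ 2) := by
        gcongr with j
        linarith [sq_nonneg (X.fit i (X.v i j) - 2 * X.normalCoord i j)]
    _ ≤ 4 * ∑ j ∈ X.K i, X.normalCoord i j ^ 2 := by
      rw [Finset.sum_add_distrib, ← Finset.mul_sum, ← Finset.mul_sum]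
      linarith [X.sum_residual_sq_le i]
    _ ≤ 4 * ((X.K i).card * (L * X.reach i ^ 2) ^ 2) := by
      gcongr
      exact (Finset.sum_le_sum hnormal).trans_eq (by rw [Finset.sum_const, nsmul_eq_mul])
    _ = (X.K i).card * (2 * L * X.reach i ^ 2) ^ 2 := by ring

lemma quadSize_coef_le (hX : X.IsFine δ L γ σ) (i : Fin N) :
    quadSize (X.reach i / 10) (X.coef i) ≤ 704000 * (γ * L) * X.reach i ^ 2 := by
  have hL := hX.L_pos
  have hγ := hX.γ_pos
  have hfill := hX.fill_pos
  have hreach := hX.mul_fill_le_reach i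
  have hq : X.fill / γ / 2 ≤ X.fill :=
    (half_le_self (by positivity)).trans (div_le_self hfill.le hX.one_le_γ)
  refine (quadSize_le_of_sum_sq_le (X.K i) (X.v i) (X.coef i) (q := X.fill / γ / 2) hfill
    (by positivity) (by linarith) hreach (by positivity)
    (fun j hj => (norm_tangentCoord_le _ _ _).trans (norm_sub_le_reach hj))
    (fun a ha b hb hab => ?_) (fun w hw => hX.exists_norm_v_sub_le i hw)
    (hX.sum_fit_sq_le i)).trans_eq ?_
  · linarith [hX.fill_div_le_norm_v_sub ha hb hab]
  · field_simp
    ring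

lemma norm_fderiv_fit_le (hX : X.IsFine δ L γ σ) (i : Fin N) {v : E2} (hv : ‖v‖ ≤ 4 * X.fill) :
    ‖fderiv ℝ (X.fit i) v‖ ≤ 2 * 10 ^ 8 * (γ * L * σ) * √X.fill := by
  have hL := hX.L_pos
  have hγ := hX.γ_pos
  have hσ := hX.one_le_σ
  have hfill := hX.fill_pos
  have hreach := hX.mul_fill_le_reach i
  have hreach₀ : 0 < X.reach i := by linarith
  have hgrad := mul_norm_fderiv_quadPoly_le (a := X.reach i / 10) (by positivity) le_rfl
    (X.coef i) (v := v) (by linarith)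
  have hbound : ‖fderiv ℝ (X.fit i) v‖ ≤ 14080000 * (γ * L) * X.reach i := by
    refine le_of_mul_le_mul_left (hgrad.trans ?_) (by positivity : 0 < X.reach i / 10)
    linarith [hX.quadSize_coef_le i]
  calc ‖fderiv ℝ (X.fit i) v‖ ≤ 14080000 * (γ * L) * (2 * σ * √X.fill) := by
        grw [hbound, hX.reach_le i]
    _ = 28160000 * (γ * L * σ) * √X.fill := by ring
    _ ≤ 2 * 10 ^ 8 * (γ * L * σ) * √X.fill := by
      gcongr
      norm_num

lemma norm_fderiv_fderiv_fit_le (hX : X.IsFine δ L γ σ) (i : Fin N) (v : E2) :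
    ‖fderiv ℝ (fderiv ℝ (X.fit i)) v‖ ≤ 2 * 10 ^ 8 * (γ * L) := by
  have hγL : 0 < γ * L := mul_pos hX.γ_pos hX.L_pos
  have hreach₀ : 0 < X.reach i := by linarith [hX.mul_fill_le_reach i, hX.fill_pos]
  have hhess := sq_mul_norm_fderiv_fderiv_quadPoly_le (a := X.reach i / 10) (by positivity)
    (X.coef i) v
  refine le_of_mul_le_mul_left (hhess.trans ?_) (by positivity : 0 < (X.reach i / 10) ^ 2)
  nlinarith [hX.quadSize_coef_le i, mul_pos hγL (pow_pos hreach₀ 2)]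

lemma isFlat_fit (hX : X.IsFine δ L γ σ) : X.IsFlat (2 * 10 ^ 8 * (γ * L * σ)) X.fit where
  contDiffAt i _ _ := (contDiff_quadPoly (X.coef i)).contDiffAt
  grad_le i _ := hX.norm_fderiv_fit_le i
  hess_le i v _ := by
    grw [hX.norm_fderiv_fderiv_fit_le i v,
      le_mul_of_one_le_right (mul_pos hX.γ_pos hX.L_pos).le hX.one_le_σ]

lemma isFlat_z (hX : X.IsFine δ L γ σ) : X.IsFlat (16 * L) X.z := by
  have hL := hX.L_pos
  have hchart : ∀ i v, ‖v‖ ≤ 4 * X.fill → ContDiffAt ℝ 2 (X.z i) v ∧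
      ‖fderiv ℝ (X.z i) v‖ ≤ 4 * L * ‖v‖ ∧ ‖fderiv ℝ (fderiv ℝ (X.z i)) v‖ ≤ 4 * L :=
    fun i v hv => by
      obtain ⟨ρ, hρ, hzC, hz⟩ := hX.exists_isLocalGraph i
      obtain ⟨F, hF⟩ := hX.localDefining i
      have hvρ : v ∈ ball (0 : E2) ρ :=
        mem_ball_zero_iff.2 (by linarith [hX.mul_fill_le_reach i, hX.fill_pos])
      have hvδ : ‖v‖ < δ / 4 := by linarith [hX.fill_lt, hX.fill_pos]
      exact ⟨(hzC.contDiffAt (isOpen_ball.mem_nhds hvρ)).of_le (by norm_num),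
        hz.norm_fderiv_height_le hF hX.L_mul_δ (X.t_tangent i) hvρ hvδ,
        hz.norm_fderiv_fderiv_height_le hF hX.L_mul_δ (X.t_tangent i) hvρ hvδ⟩
  refine ⟨fun i v hv => (hchart i v hv).1, fun i v hv => ?_, fun i v hv => ?_⟩
  · grw [(hchart i v hv).2.1, hv, hX.fill_le_sqrt]
    exact le_of_eq (by ring)
  · linarith [(hchart i v hv).2.2]

/-- Otherwise the sample near the point at distance `2 * fill` from the origin in the direction of
`c` would lie inside the empty circle. -/
lemma norm_lt_of_forall_le_dist (hX : X.IsFine δ L γ σ) {c : E2}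
    (hempty : ∀ j ∈ X.K i, ‖c‖ ≤ dist (X.v i j) c) : ‖c‖ < 2 * X.fill := by
  by_contra! hge
  have hfill := hX.fill_pos
  have hc : 0 < ‖c‖ := by linarith
  set w := (2 * X.fill / ‖c‖) • c with hw_def
  have hw : ‖w‖ = 2 * X.fill := by
    rw [hw_def, norm_smul, Real.norm_of_nonneg (by positivity), div_mul_cancel₀ _ hc.ne']
  obtain ⟨j, hj, hjw⟩ := hX.exists_norm_v_sub_le i (w := w)
    (by linarith [hX.mul_fill_le_reach i])
  have hray : ‖w - c‖ = ‖c‖ - 2 * X.fill := by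
    have hsmul : w - c = (2 * X.fill / ‖c‖ - 1) • c := by rw [sub_smul, one_smul]
    rw [hsmul, norm_smul, Real.norm_of_nonpos (by rwa [sub_nonpos, div_le_one hc])]
    field_simp
    ring
  have hdist := hempty j hj
  rw [dist_eq_norm] at hdist
  linarith [norm_sub_le_norm_sub_add_norm_sub (X.v i j) w c]

lemma exists_circumcenter (hX : X.IsFine δ L γ σ) (hp : p ∈ X.ring i) :
    ∃ c : E2, ‖c‖ < 2 * X.fill ∧ ∀ m ∈ corners i p, dist (X.v i m) c = ‖c‖ := by
  obtain ⟨c, ρ, hon, hempty⟩ := (X.tri_delaunay i).emptyCircle _ (mem_ring_iff.1 hp).2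
  have hρ : ρ = ‖c‖ := by
    have hself : dist (X.v i i) c = ρ := hon i (self_mem_corners i p)
    rw [← hself, v_self, dist_zero_left]
  subst hρ
  exact ⟨c, hX.norm_lt_of_forall_le_dist hempty, hon⟩

lemma norm_v_le (hX : X.IsFine δ L γ σ) (hp : p ∈ X.ring i) (hm : m ∈ corners i p) :
    ‖X.v i m‖ ≤ 4 * X.fill := by
  obtain ⟨c, hc, hon⟩ := hX.exists_circumcenter hp
  have hdist := hon m hm
  rw [dist_eq_norm] at hdist
  linarith [norm_le_norm_sub_add (X.v i m) c]

lemma norm_sub_le_of_mem_corners (hX : X.IsFine δ L γ σ) (hp : p ∈ X.ring i)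
    (hm : m ∈ corners i p) : ‖X.x m - X.x i‖ ≤ 8 * X.fill := by
  linarith [hX.norm_sub_self_le (corners_subset_K hp hm), hX.norm_v_le hp hm]

lemma fill_pow_le_det_sq (hX : X.IsFine δ L γ σ) (hp : p ∈ X.ring i) :
    1 / (16 * γ ^ 6) * X.fill ^ 4
      ≤ (X.v i p.1 0 * X.v i p.2 1 - X.v i p.1 1 * X.v i p.2 0) ^ 2 := by
  obtain ⟨c, hc, hon⟩ := hX.exists_circumcenter hp
  obtain ⟨hne₁, hne₂, hne⟩ := ring_distinct hp
  have hmem₁ := corners_subset_K hp (fst_mem_corners i p)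
  have hmem₂ := corners_subset_K hp (snd_mem_corners i p)
  have hfill := hX.fill_pos
  have hγ := hX.γ_pos
  set T := X.v i p.1 0 * X.v i p.2 1 - X.v i p.1 1 * X.v i p.2 0
  refine le_of_mul_le_mul_left ?_ (by positivity : 0 < 4 * (2 * X.fill) ^ 2)
  calc 4 * (2 * X.fill) ^ 2 * (1 / (16 * γ ^ 6) * X.fill ^ 4)
      = (X.fill / γ) ^ 2 * (X.fill / γ) ^ 2 * (X.fill / γ) ^ 2 := by
        field_simp
        norm_num
    _ ≤ ‖X.v i p.1‖ ^ 2 * ‖X.v i p.2‖ ^ 2 * ‖X.v i p.1 - X.v i p.2‖ ^ 2 := by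
      gcongr
      exacts [hX.fill_div_le_norm_v hmem₁ hne₁, hX.fill_div_le_norm_v hmem₂ hne₂,
        hX.fill_div_le_norm_v_sub hmem₁ hmem₂ hne]
    _ = 4 * ‖c‖ ^ 2 * T ^ 2 := norm_sq_mul_norm_sq_mul_norm_sub_sq_of_dist_eq
      (hon _ (fst_mem_corners i p)) (hon _ (snd_mem_corners i p))
    _ ≤ 4 * (2 * X.fill) ^ 2 * T ^ 2 := by gcongr

lemma card_ring_le (hX : X.IsFine δ L γ σ) (i : Fin N) :
    ((X.ring i).card : ℝ) ≤ ((8 * γ + 1) ^ 3) ^ 2 := by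
  classical
  set s := Finset.univ.filter fun j => ‖X.x j - X.x i‖ ≤ 8 * X.fill
  have hmem (p) (hp : p ∈ X.ring i) (m) (hm : m ∈ corners i p) : m ∈ s :=
    Finset.mem_filter.2 ⟨Finset.mem_univ _, hX.norm_sub_le_of_mem_corners hp hm⟩
  have hsub : X.ring i ⊆ s ×ˢ s := fun p hp => Finset.mem_product.2
    ⟨hmem p hp _ (fst_mem_corners i p), hmem p hp _ (snd_mem_corners i p)⟩
  have hcard : (s.card : ℝ) ≤ (8 * γ + 1) ^ 3 :=
    hX.card_le_of_norm_sub_le s i (by norm_num) fun j hj => (Finset.mem_filter.1 hj).2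
  calc ((X.ring i).card : ℝ) ≤ (s.card : ℝ) ^ 2 := by
        rw [sq]
        exact_mod_cast (Finset.card_le_card hsub).trans_eq (Finset.card_product _ _)
    _ ≤ ((8 * γ + 1) ^ 3) ^ 2 := by gcongr

end IsFine

end CurvedMesh

/-! ### Assembly of the matrices -/

section SymmetricPart

variable {n : Type*}

/-- The symmetric part of a matrix, by which `A`, `B` arise from the stiffness and mass matrices. -/
noncomputable def symmPart (S : Matrix n n ℝ) : Matrix n n ℝ := (1 / 2 : ℝ) • (S + S.transpose)

lemma symmPart_apply (S : Matrix n n ℝ) (a b : n) : symmPart S a b = (S a b + S b a) / 2 := by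
  simp only [symmPart, Matrix.smul_apply, Matrix.add_apply, Matrix.transpose_apply, smul_eq_mul]
  ring

lemma symmPart_sub (S S' : Matrix n n ℝ) : symmPart (S - S') = symmPart S - symmPart S' := by
  ext a b
  simp only [symmPart_apply, Matrix.sub_apply]
  ring

lemma isHermitian_symmPart (S : Matrix n n ℝ) : (symmPart S).IsHermitian := by
  ext a b
  simp [symmPart_apply, add_comm]

lemma specNorm_symmPart_le_of_sparse [Fintype n] [DecidableEq n] {S : Matrix n n ℝ}
    {near : n → n → Prop} [DecidableRel near] {δ r : ℝ} (hsymm : ∀ a b, near a b ↔ near b a)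
    (hδ : 0 ≤ δ) (hr : 0 ≤ r) (hcard : ∀ a, ((Finset.univ.filter (near a)).card : ℝ) ≤ r)
    (hS : ∀ a b, |S a b| ≤ δ) (hS0 : ∀ a b, ¬ near a b → S a b = 0) :
    specNorm (symmPart S) ≤ r * δ := by
  refine specNorm_le_of_sparse hsymm hδ hr hcard (fun a b => ?_) fun a b hab => ?_
  · rw [symmPart_apply, abs_div, abs_two]
    linarith [abs_add_le (S a b) (S b a), hS a b, hS b a]
  · rw [symmPart_apply, hS0 a b hab, hS0 b a (mt (hsymm a b).2 hab), add_zero, zero_div]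

end SymmetricPart

namespace CurvedMesh

open Param Metric

variable {M : Set E3} {N k : ℕ} {X : CurvedMesh M N k} {δ L γ σ K C : ℝ} {f f' : Fin N → E2 → ℝ}
  {i m : Fin N} {p : Fin N × Fin N}

/-- The triangle `p` of the first ring at `x_i` with the height function `f i`, at the scale of the
fill distance. -/
noncomputable def elementData (X : CurvedMesh M N k) (f : Fin N → E2 → ℝ) (i : Fin N)
    (p : Fin N × Fin N) : ElementData :=
  ⟨X.t i, X.x i, f i, ![X.v i p.1, X.v i p.2], X.fill⟩

/-- The nodal field `e_m t_κ^{(m)}` on the triangle `p` of the first ring at `x_i`. -/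
noncomputable def nodalData (X : CurvedMesh M N k) (i : Fin N) (p : Fin N × Fin N) (m : Fin N)
    (κ : Fin 2) : NodalData :=
  ⟨hat i p m, vertexParam i p m, X.t m (Fin.castSucc κ)⟩

/-- The matrix assembled from an integral functional `I` of a patch and two nodal fields, summed
over the first ring of the row node. Both the mass and the stiffness matrix are of this form. -/
noncomputable def assemble (X : CurvedMesh M N k) (I : (E2 → E3) → NodalData → NodalData → ℝ)
    (f : Fin N → E2 → ℝ) : Matrix (Fin N × Fin 2) (Fin N × Fin 2) ℝ :=
  Matrix.of fun a b => ∑ p ∈ X.ring a.1, I (X.elementData f a.1 p).curved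
    (X.nodalData a.1 p a.1 a.2) (X.nodalData a.1 p b.1 b.2)

lemma A_eq_symmPart (X : CurvedMesh M N k) :
    X.A = symmPart (X.assemble stiffnessIntegral X.z) := rfl

lemma B_eq_symmPart (X : CurvedMesh M N k) : X.B = symmPart (X.assemble massIntegral X.z) := rfl

lemma Ahat_eq_symmPart (X : CurvedMesh M N k) :
    X.Ahat = symmPart (X.assemble stiffnessIntegral X.fit) := rfl

lemma Bhat_eq_symmPart (X : CurvedMesh M N k) :
    X.Bhat = symmPart (X.assemble massIntegral X.fit) := rfl

section Hat

lemma nodalData_e_eq_zero (X : CurvedMesh M N k) (hm : m ∉ corners i p) (κ : Fin 2) :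
    (X.nodalData i p m κ).e = 0 := by
  simp only [corners, Finset.mem_insert, Finset.mem_singleton, not_or] at hm
  funext u
  simp [nodalData, hat, hm.1, hm.2.1, hm.2.2]

lemma exists_hat_eq_affine (i : Fin N) (p : Fin N × Fin N) (m : Fin N) : ∃ a b c : ℝ,
    |b| ≤ 1 ∧ |c| ≤ 1 ∧ hat i p m = fun u => a + (b * u 0 + c * u 1) := by
  unfold hat
  split_ifs
  · exact ⟨1, -1, -1, by simp, by simp, by funext u; ring⟩
  · exact ⟨0, 1, 0, by simp, by simp, by funext u; ring⟩
  · exact ⟨0, 0, 1, by simp, by simp, by funext u; ring⟩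
  · exact ⟨0, 0, 0, by simp, by simp, by funext u; ring⟩

lemma differentiable_hat (i : Fin N) (p : Fin N × Fin N) (m : Fin N) :
    Differentiable ℝ (hat i p m) := by
  obtain ⟨a, b, c, -, -, hhat⟩ := exists_hat_eq_affine i p m
  rw [hhat]
  fun_prop

lemma abs_pd_hat_le (i : Fin N) (p : Fin N × Fin N) (m : Fin N) (j : Fin 2) (u : E2) :
    |pd j (hat i p m) u| ≤ 1 := by
  obtain ⟨a, b, c, hb, hc, hhat⟩ := exists_hat_eq_affine i p m
  have hcoord (j : Fin 2) : HasFDerivAt (fun v : E2 => v j)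
      (EuclideanSpace.proj j : E2 →L[ℝ] ℝ) u := (EuclideanSpace.proj j : E2 →L[ℝ] ℝ).hasFDerivAt
  have hderiv := (((hcoord 0).const_mul b).fun_add ((hcoord 1).const_mul c)).const_add a
  rw [hhat, pd, hderiv.fderiv]
  fin_cases j
  · simpa using hb
  · simpa using hc

lemma abs_hat_le (i : Fin N) (p : Fin N × Fin N) (m : Fin N) {u : E2} (hu : u ∈ refTriangle) :
    |hat i p m u| ≤ 1 := by
  obtain ⟨hu₀, hu₁, hsum⟩ := hu
  unfold hat
  split_ifs <;> rw [abs_le] <;> constructor <;> linarith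

lemma vertexParam_mem_refTriangle (i : Fin N) (p : Fin N × Fin N) (m : Fin N) :
    vertexParam i p m ∈ refTriangle := by
  unfold vertexParam refTriangle
  split_ifs <;> simp

end Hat

lemma IsFlat.mono {K' : ℝ} (hf : X.IsFlat K f) (hK : K ≤ K') : X.IsFlat K' f where
  contDiffAt := hf.contDiffAt
  grad_le i v hv := (hf.grad_le i v hv).trans (mul_le_mul_of_nonneg_right hK (Real.sqrt_nonneg _))
  hess_le i v hv := (hf.hess_le i v hv).trans hK

namespace IsFine

lemma norm_edgeMap_le (hX : X.IsFine δ L γ σ) (hp : p ∈ X.ring i) {u : E2}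
    (hu : u ∈ refTriangle) : ‖edgeMap ![X.v i p.1, X.v i p.2] u‖ ≤ 4 * X.fill := by
  obtain ⟨hu₀, hu₁, hsum⟩ := hu
  calc ‖edgeMap ![X.v i p.1, X.v i p.2] u‖ ≤ ‖u 0 • X.v i p.1‖ + ‖u 1 • X.v i p.2‖ :=
        norm_add_le _ _
    _ = u 0 * ‖X.v i p.1‖ + u 1 * ‖X.v i p.2‖ := by
        rw [norm_smul, norm_smul, Real.norm_of_nonneg hu₀, Real.norm_of_nonneg hu₁]
    _ ≤ u 0 * (4 * X.fill) + u 1 * (4 * X.fill) := by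
        gcongr
        exacts [hX.norm_v_le hp (fst_mem_corners i p), hX.norm_v_le hp (snd_mem_corners i p)]
    _ = (u 0 + u 1) * (4 * X.fill) := (add_mul _ _ _).symm
    _ ≤ 4 * X.fill := mul_le_of_le_one_left (by linarith [hX.fill_pos]) hsum

lemma elementData_admissible (hX : X.IsFine δ L γ σ) (hK : 4 ≤ K) (hf : X.IsFlat K f)
    (hp : p ∈ X.ring i) : (X.elementData f i p).Admissible K (1 / (16 * γ ^ 6)) where
  h_pos := hX.fill_pos
  h_le := hX.fill_le_one
  edge_le j := by
    have hedge : ‖(X.elementData f i p).J j‖ ≤ 4 * X.fill := by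
      fin_cases j
      exacts [hX.norm_v_le hp (fst_mem_corners i p), hX.norm_v_le hp (snd_mem_corners i p)]
    exact hedge.trans (mul_le_mul_of_nonneg_right hK hX.fill_pos.le)
  le_det := hX.fill_pow_le_det_sq hp
  contDiffAt _ hu := hf.contDiffAt i _ (hX.norm_edgeMap_le hp hu)
  grad_le _ hu := hf.grad_le i _ (hX.norm_edgeMap_le hp hu)
  hess_le _ hu := hf.hess_le i _ (hX.norm_edgeMap_le hp hu)

lemma abs_normal_frame_le (hX : X.IsFine δ L γ σ) (hp : p ∈ X.ring i) (hm : m ∈ corners i p)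
    (κ : Fin 2) : |inner ℝ (X.t i 2) (X.t m (Fin.castSucc κ))| ≤ 8 * L * √X.fill := by
  obtain ⟨F, hF⟩ := hX.localDefining i
  have htangent : X.t m (Fin.castSucc κ) ∈ tangentConeAt ℝ M (X.x m) := by
    fin_cases κ
    exacts [(X.t_tangent m).1, (X.t_tangent m).2]
  have hL := hX.L_pos
  calc |inner ℝ (X.t i 2) (X.t m (Fin.castSucc κ))| ≤ L * ‖X.x m - X.x i‖ :=
        hF.abs_normal_tangent_le (X.t_tangent i) (hX.mem_ball (corners_subset_K hp hm)) (X.x_mem m)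
          htangent ((X.t m).orthonormal.1 _).le
    _ ≤ L * (8 * √X.fill) := by
        grw [hX.norm_sub_le_of_mem_corners hp hm, hX.fill_le_sqrt]
    _ = 8 * L * √X.fill := by ring

lemma nodalData_admissible (hX : X.IsFine δ L γ σ) (hK : 8 * L ≤ K) (f : Fin N → E2 → ℝ)
    (hp : p ∈ X.ring i) (hm : m ∈ corners i p) (κ : Fin 2) :
    (X.nodalData i p m κ).Admissible K (X.elementData f i p) where
  mem := vertexParam_mem_refTriangle i p m
  norm_le := ((X.t m).orthonormal.1 _).le
  normal_le := (hX.abs_normal_frame_le hp hm κ).trans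
    (mul_le_mul_of_nonneg_right hK (Real.sqrt_nonneg _))
  measurable := (differentiable_hat i p m).continuous.measurable
  differentiableAt u _ := differentiable_hat i p m u
  abs_le _ hu := abs_hat_le i p m hu
  pd_le u _ j := abs_pd_hat_le i p m j u

lemma mem_admissibleSet (hX : X.IsFine δ L γ σ) (hK : 16 * L ≤ K) (hf : X.IsFlat K f)
    (hp : p ∈ X.ring i) (hm : m ∈ corners i p) (κ κ' : Fin 2) :
    (X.elementData f i p, X.nodalData i p i κ, X.nodalData i p m κ')
      ∈ admissibleSet K (1 / (16 * γ ^ 6)) := by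
  have hL := hX.one_le_L
  exact ⟨hX.elementData_admissible (by linarith) hf hp,
    hX.nodalData_admissible (by linarith) f hp (self_mem_corners i p) κ,
    hX.nodalData_admissible (by linarith) f hp hm κ'⟩

variable {I : (E2 → E3) → NodalData → NodalData → ℝ}

lemma abs_sum_ring_le (hX : X.IsFine δ L γ σ) (i : Fin N) {g : Fin N × Fin N → ℝ} {B : ℝ}
    (hB : 0 ≤ B) (hg : ∀ p ∈ X.ring i, |g p| ≤ B) :
    |∑ p ∈ X.ring i, g p| ≤ (8 * γ + 1) ^ 6 * B :=
  calc |∑ p ∈ X.ring i, g p| ≤ ∑ p ∈ X.ring i, |g p| := Finset.abs_sum_le_sum_abs _ _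
    _ ≤ (X.ring i).card * B := by simpa using Finset.sum_le_card_nsmul _ _ _ hg
    _ ≤ (8 * γ + 1) ^ 6 * B := by
        gcongr
        exact (hX.card_ring_le i).trans_eq (by ring)

lemma abs_assemble_le (hX : X.IsFine δ L γ σ) (hI : IsConsistent K (1 / (16 * γ ^ 6)) C I)
    (hK : 16 * L ≤ K) (hf : X.IsFlat K f) (a b : Fin N × Fin 2) :
    |X.assemble I f a b| ≤ (8 * γ + 1) ^ 6 * C := by
  refine hX.abs_sum_ring_le a.1 hI.nonneg fun p hp => ?_
  by_cases hb : b.1 ∈ corners a.1 p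
  · have hbound := hI.abs_le _ (hX.mem_admissibleSet hK hf hp hb a.2 b.2)
    exact hbound
  · rw [hI.eq_zero _ _ _ (X.nodalData_e_eq_zero hb _), abs_zero]
    exact hI.nonneg

lemma abs_assemble_sub_le (hX : X.IsFine δ L γ σ) (hI : IsConsistent K (1 / (16 * γ ^ 6)) C I)
    (hK : 16 * L ≤ K) (hf : X.IsFlat K f) (hf' : X.IsFlat K f') (a b : Fin N × Fin 2) :
    |(X.assemble I f - X.assemble I f') a b| ≤ (8 * γ + 1) ^ 6 * (2 * C * X.fill) := by
  have hC := hI.nonneg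
  have hfill := hX.fill_pos
  rw [Matrix.sub_apply, assemble, assemble, Matrix.of_apply, Matrix.of_apply,
    ← Finset.sum_sub_distrib]
  refine hX.abs_sum_ring_le a.1 (by positivity) fun p hp => ?_
  by_cases hb : b.1 ∈ corners a.1 p
  · have hclose := hI.abs_sub_le _ (hX.mem_admissibleSet hK hf hp hb a.2 b.2)
    have hclose' := hI.abs_sub_le _ (hX.mem_admissibleSet hK hf' hp hb a.2 b.2)
    rw [abs_sub_comm] at hclose'
    refine (abs_sub_le _ _ _).trans ((add_le_add hclose hclose').trans_eq ?_)
    rw [mul_assoc, two_mul]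
    rfl
  · have hzero := X.nodalData_e_eq_zero hb b.2
    rw [hI.eq_zero _ _ _ hzero, hI.eq_zero _ _ _ hzero, sub_zero, abs_zero]
    positivity

lemma assemble_eq_zero (hX : X.IsFine δ L γ σ) (hI : IsConsistent K (1 / (16 * γ ^ 6)) C I)
    (f : Fin N → E2 → ℝ) {a b : Fin N × Fin 2} (hab : 8 * X.fill < ‖X.x a.1 - X.x b.1‖) :
    X.assemble I f a b = 0 := by
  refine Finset.sum_eq_zero fun p hp => hI.eq_zero _ _ _ (X.nodalData_e_eq_zero (fun hb => ?_) _)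
  rw [norm_sub_rev] at hab
  exact hab.not_ge (hX.norm_sub_le_of_mem_corners hp hb)

open Classical in
lemma card_near_le (hX : X.IsFine δ L γ σ) (a : Fin N × Fin 2) :
    ((Finset.univ.filter fun b : Fin N × Fin 2 => ‖X.x a.1 - X.x b.1‖ ≤ 8 * X.fill).card : ℝ)
      ≤ 2 * (8 * γ + 1) ^ 3 := by
  set s := Finset.univ.filter fun j => ‖X.x a.1 - X.x j‖ ≤ 8 * X.fill
  have hprod : (Finset.univ.filter fun b : Fin N × Fin 2 => ‖X.x a.1 - X.x b.1‖ ≤ 8 * X.fill)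
      = s ×ˢ Finset.univ := by
    ext b
    simp [s]
  have hcard : (s.card : ℝ) ≤ (8 * γ + 1) ^ 3 :=
    hX.card_le_of_norm_sub_le s a.1 (by norm_num) fun j hj =>
      norm_sub_rev (X.x a.1) _ ▸ (Finset.mem_filter.1 hj).2
  rw [hprod, Finset.card_product, Finset.card_univ, Fintype.card_fin]
  push_cast
  linarith

lemma specNorm_symmPart_assemble_sub_le (hX : X.IsFine δ L γ σ)
    (hI : IsConsistent K (1 / (16 * γ ^ 6)) C I) (hK : 16 * L ≤ K) (hf : X.IsFlat K f)
    (hf' : X.IsFlat K f') :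
    specNorm (symmPart (X.assemble I f) - symmPart (X.assemble I f'))
      ≤ 4 * (8 * γ + 1) ^ 9 * C * X.fill := by
  classical
  have hγ := hX.γ_pos
  have hfill := hX.fill_pos
  have hC := hI.nonneg
  rw [← symmPart_sub]
  have hfar (a b : Fin N × Fin 2) (hab : ¬ ‖X.x a.1 - X.x b.1‖ ≤ 8 * X.fill) :
      (X.assemble I f - X.assemble I f') a b = 0 := by
    rw [Matrix.sub_apply, hX.assemble_eq_zero hI f (not_le.1 hab),
      hX.assemble_eq_zero hI f' (not_le.1 hab), sub_zero]
  have hbound := specNorm_symmPart_le_of_sparse (fun a b => by rw [norm_sub_rev]) (by positivity)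
    (by positivity) hX.card_near_le (hX.abs_assemble_sub_le hI hK hf hf') hfar
  exact hbound.trans_eq (by ring)

end IsFine

end CurvedMesh

/-! ### The perturbation bound -/

section Pencil

variable {n : Type*} [Fintype n]

lemma crawford_le_diag (A B : Matrix n n ℝ) (e : n) :
    crawford A B ≤ A e e ^ 2 + B e e ^ 2 := by
  classical
  simpa using crawford_le A B (x := EuclideanSpace.single e (1 : ℝ)) (by simp)

lemma pencilDist_of_isEmpty [DecidableEq n] [IsEmpty n] (A B A' B' : Matrix n n ℝ) :
    pencilDist A B A' B' = 0 := by
  have hzero (E : Matrix n n ℝ) : specNorm E = 0 := by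
    rw [Subsingleton.elim E 0, specNorm, map_zero, norm_zero]
  simp [pencilDist, hzero]

end Pencil

namespace CurvedMesh

open Metric

variable {M : Set E3} {N k : ℕ} {X : CurvedMesh M N k} {δ L γ σ K C : ℝ}

lemma fill_nonneg (X : CurvedMesh M N k) : 0 ≤ X.fill := by
  refine Real.sSup_nonneg ?_
  rintro _ ⟨y, -, rfl⟩
  exact infDist_nonneg

lemma sep_nonneg (X : CurvedMesh M N k) : 0 ≤ X.sep := by
  refine mul_nonneg (by norm_num) (Real.sInf_nonneg ?_)
  rintro _ ⟨i, j, -, rfl⟩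
  exact norm_nonneg _

lemma two_mul_sep_le (X : CurvedMesh M N k) {i j : Fin N} (hij : i ≠ j) :
    2 * X.sep ≤ ‖X.x i - X.x j‖ := by
  have hle : sInf {d | ∃ i j, i ≠ j ∧ d = ‖X.x i - X.x j‖} ≤ ‖X.x i - X.x j‖ := by
    refine csInf_le ⟨0, ?_⟩ ⟨i, j, hij, rfl⟩
    rintro _ ⟨i, j, -, rfl⟩
    exact norm_nonneg _
  unfold sep
  linarith

lemma exists_norm_sub_le_fill [Nonempty (Fin N)] (X : CurvedMesh M N k) (hM : IsCompact M)
    {y : E3} (hy : y ∈ M) : ∃ j, ‖X.x j - y‖ ≤ X.fill := by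
  obtain ⟨_, ⟨j, rfl⟩, hj⟩ := (Set.finite_range X.x).isCompact.exists_infDist_eq_dist
    (Set.range_nonempty X.x) y
  refine ⟨j, ?_⟩
  rw [← dist_eq_norm, dist_comm, ← hj]
  exact le_csSup (hM.image (continuous_infDist_pt _)).bddAbove ⟨y, hy, rfl⟩

/-- A finite point cloud misses some of the distances to `x_i` that occur on the surface. -/
lemma fill_pos (X : CurvedMesh M N k) (hM : IsCompact M) {i : Fin N} {F : E3 → ℝ}
    (hF : IsLocalDefining M δ L (X.x i) F) (hLδ : L * δ ≤ 1 / 4) : 0 < X.fill := by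
  have : Nonempty (Fin N) := ⟨i⟩
  refine X.fill_nonneg.lt_of_ne' fun hfill => ?_
  have hsub : Set.Ioo 0 δ ⊆ Set.range fun j => dist (X.x j) (X.x i) := fun s hs => by
    obtain ⟨y, hy, hys⟩ := hF.exists_mem_dist_eq hLδ (X.t_tangent i) hs.1 hs.2
    obtain ⟨j, hj⟩ := X.exists_norm_sub_le_fill hM hy
    rw [hfill, norm_le_zero_iff, sub_eq_zero] at hj
    exact ⟨j, by simp only [hj, hys]⟩
  exact Set.Ioo_infinite hF.radius_pos ((Set.finite_range _).subset hsub)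

lemma isFine_of_fill_le [Nonempty (Fin N)] (X : CurvedMesh M N k) (hM : IsCompact M) (hL : 1 ≤ L)
    (hLδ : L * δ ≤ 1 / 4) (hF : ∀ x ∈ M, ∃ F, IsLocalDefining M δ L x F) (hγ : 1 ≤ γ)
    (hσ : 1 ≤ σ) (hfill : X.fill ≤ (δ / (6 * σ)) ^ 2) (hquasi : X.fill ≤ γ * X.sep)
    (hrad : ∀ i, X.rad i ^ 2 ≤ σ ^ 2 * X.fill) (hk : (4000 * γ + 1) ^ 3 < k) :
    X.IsFine δ L γ σ := by
  obtain ⟨i⟩ := ‹Nonempty (Fin N)›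
  obtain ⟨F, hFi⟩ := hF _ (X.x_mem i)
  have hδ := hFi.radius_pos
  have hδ_le : δ ≤ 1 / 4 := (le_mul_of_one_le_left hδ.le hL).trans hLδ
  have hsqrt : σ * √X.fill ≤ δ / 6 := by
    grw [hfill, Real.sqrt_sq (by positivity)]
    exact le_of_eq (by field_simp)
  have hfill' : X.fill ≤ (δ / 6) ^ 2 := by
    grw [hfill, ← hσ, mul_one]
  have hrad_le (i : Fin N) : X.rad i ≤ σ * √X.fill := by
    refine Real.le_sqrt_of_sq_le (hrad i) |>.trans_eq ?_
    rw [Real.sqrt_mul (sq_nonneg σ), Real.sqrt_sq (by linarith)]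
  exact {
    one_le_L := hL
    L_mul_δ := hLδ
    localDefining := fun i => hF _ (X.x_mem i)
    one_le_γ := hγ
    one_le_σ := hσ
    fill_pos := X.fill_pos hM hFi hLδ
    fill_le_one := by nlinarith
    fill_lt := by nlinarith
    rad_lt := fun i => by linarith [hrad_le i]
    rad_le := hrad_le
    cover := fun y hy => X.exists_norm_sub_le_fill hM hy
    sep_le := fun i j hij => by
      have hsep : X.fill / γ ≤ X.sep := div_le_of_le_mul₀ (by linarith) X.sep_nonneg (by linarith)
      linarith [X.two_mul_sep_le hij]
    lt_k := hk }

namespace IsFine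

lemma isFlat_z_and_fit (hX : X.IsFine δ L γ σ) (hK : 2 * 10 ^ 8 * (γ * L * σ) ≤ K) :
    16 * L ≤ K ∧ X.IsFlat K X.z ∧ X.IsFlat K X.fit := by
  have hL : L ≤ γ * L * σ := by
    have hL := hX.L_pos
    nlinarith [mul_le_mul hX.one_le_γ hX.one_le_σ zero_le_one hX.γ_pos.le]
  have hLK : 16 * L ≤ K := by linarith [hX.L_pos]
  exact ⟨hLK, hX.isFlat_z.mono hLK, hX.isFlat_fit.mono hK⟩

lemma pencilDist_le (hX : X.IsFine δ L γ σ) (hK : 2 * 10 ^ 8 * (γ * L * σ) ≤ K)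
    (hS : IsConsistent K (1 / (16 * γ ^ 6)) C stiffnessIntegral)
    (hM : IsConsistent K (1 / (16 * γ ^ 6)) C massIntegral) :
    pencilDist X.A X.B X.Ahat X.Bhat ≤ 8 * (8 * γ + 1) ^ 9 * C * X.fill := by
  obtain ⟨hLK, hz, hfit⟩ := hX.isFlat_z_and_fit hK
  rw [A_eq_symmPart, B_eq_symmPart, Ahat_eq_symmPart, Bhat_eq_symmPart]
  grw [pencilDist_le_add, hX.specNorm_symmPart_assemble_sub_le hS hLK hfit hz,
    hX.specNorm_symmPart_assemble_sub_le hM hLK hfit hz]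
  exact le_of_eq (by ring)

lemma crawford_le [Nonempty (Fin N)] (hX : X.IsFine δ L γ σ)
    (hK : 2 * 10 ^ 8 * (γ * L * σ) ≤ K)
    (hS : IsConsistent K (1 / (16 * γ ^ 6)) C stiffnessIntegral)
    (hM : IsConsistent K (1 / (16 * γ ^ 6)) C massIntegral) :
    crawford X.A X.B ≤ 2 * ((8 * γ + 1) ^ 6 * C) ^ 2 := by
  obtain ⟨i⟩ := ‹Nonempty (Fin N)›
  obtain ⟨hLK, hz, -⟩ := hX.isFlat_z_and_fit hK
  have hdiag {I} (hI : IsConsistent K (1 / (16 * γ ^ 6)) C I) (e : Fin N × Fin 2) :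
      symmPart (X.assemble I X.z) e e ^ 2 ≤ ((8 * γ + 1) ^ 6 * C) ^ 2 := by
    rw [symmPart_apply, add_self_div_two, ← sq_abs]
    exact pow_le_pow_left₀ (abs_nonneg _) (hX.abs_assemble_le hI hLK hz e e) 2
  refine (crawford_le_diag X.A X.B (i, 0)).trans ?_
  rw [two_mul]
  exact add_le_add (hdiag hS _) (hdiag hM _)

end IsFine

theorem exists_pencilDist_le_and_crawford_le (hMc : IsCompact M) (hM : IsC3Surface M)
    (cq cr : ℝ) : ∃ (h₀ : ℝ) (k₀ : ℕ) (B D : ℝ), 0 < h₀ ∧ 0 ≤ B ∧ 0 ≤ D ∧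
      ∀ {N k : ℕ} [Nonempty (Fin N)] (X : CurvedMesh M N k), k₀ ≤ k → X.fill ≤ h₀ →
        X.fill ≤ cq * X.sep → (∀ i, X.rad i ^ 2 ≤ cr * X.fill) →
        pencilDist X.A X.B X.Ahat X.Bhat ≤ B * X.fill ∧ crawford X.A X.B ≤ D := by
  obtain ⟨δ, hδ, L, hL, hLδ, hF⟩ := hM.exists_isLocalDefining_mul_le hMc
  obtain ⟨γ, hγ, hcq⟩ : ∃ γ, 1 ≤ γ ∧ cq ≤ γ := ⟨max 1 cq, le_max_left _ _, le_max_right _ _⟩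
  obtain ⟨σ, hσ, hcr⟩ : ∃ σ, 1 ≤ σ ∧ cr ≤ σ ^ 2 :=
    ⟨max 1 cr, le_max_left _ _, (le_max_right _ _).trans
      (le_self_pow₀ (le_max_left _ _) two_ne_zero)⟩
  set K := 2 * 10 ^ 8 * (γ * L * σ) with hK
  have hc : 0 < 1 / (16 * γ ^ 6) := by positivity
  obtain ⟨C₁, hC₁⟩ := exists_isConsistent_stiffnessIntegral K hc
  obtain ⟨C₂, hC₂⟩ := exists_isConsistent_massIntegral K hc
  have hS := hC₁.mono (le_max_left C₁ C₂)
  have hMass := hC₂.mono (le_max_right C₁ C₂)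
  have hC := hS.nonneg
  obtain ⟨k₀, hk₀⟩ := exists_nat_gt ((4000 * γ + 1) ^ 3)
  refine ⟨(δ / (6 * σ)) ^ 2, k₀, 8 * (8 * γ + 1) ^ 9 * max C₁ C₂,
    2 * ((8 * γ + 1) ^ 6 * max C₁ C₂) ^ 2, by positivity, by positivity, by positivity,
    fun X hk hfill hquasi hrad => ?_⟩
  have hX : X.IsFine δ L γ σ := X.isFine_of_fill_le hMc hL hLδ hF hγ hσ hfill
    (hquasi.trans (mul_le_mul_of_nonneg_right hcq X.sep_nonneg))
    (fun i => (hrad i).trans (mul_le_mul_of_nonneg_right hcr X.fill_nonneg))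
    (hk₀.trans_le (Nat.cast_le.2 hk))
  exact ⟨hX.pencilDist_le hK.ge hS hMass, hX.crawford_le hK.ge hS hMass⟩

end CurvedMesh

theorem mainTheorem3 (M : Set E3) (hMc : IsCompact M) (hM : IsC3Surface M) (cq cr : ℝ) :
    ∃ (h₀ : ℝ) (k₀ : ℕ) (C₀ κ : ℝ), 0 < h₀ ∧ 0 < C₀ ∧ 1 ≤ κ ∧
      ∀ (N k : ℕ) (X : CurvedMesh M N k), k₀ ≤ k → X.fill ≤ h₀ →
        X.sep ≤ X.fill → X.fill ≤ cq * X.sep → (∀ i, X.rad i ^ 2 ≤ cr * X.fill) →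
        κ * pencilDist X.A X.B X.Ahat X.Bhat ≤ C₀ * X.fill ∧
        (X.A.PosDef → X.B.PosDef → X.Bhat.PosDef →
          ∀ a b lam lamHat : Fin (2 * N) → ℝ,
            IsPencilSpectrum X.A 1 a → IsPencilSpectrum X.B 1 b →
            IsPencilSpectrum X.A X.B lam → IsPencilSpectrum X.Ahat X.Bhat lamHat →
            ∀ C : ℝ, κ * pencilDist X.A X.B X.Ahat X.Bhat ≤ C * X.fill →
              (∀ l, C ^ 2 * X.fill ^ 2 < a l ^ 2 + b l ^ 2) →
              ∀ l, |lam l - lamHat l| ≤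
                C * X.fill / crawford X.A X.B * |1 + lam l * lamHat l|) := by
  obtain ⟨h₀, k₀, B, D, hh₀, hB, hD, hbound⟩ :=
    CurvedMesh.exists_pencilDist_le_and_crawford_le hMc hM cq cr
  refine ⟨h₀, k₀, √(1 + D) * B + 1, √(1 + D), hh₀, by positivity,
    Real.one_le_sqrt.2 (by linarith), fun N k X hk hfill _ hquasi hrad => ⟨?_, ?_⟩⟩
  · have hdist : pencilDist X.A X.B X.Ahat X.Bhat ≤ B * X.fill := by
      cases isEmpty_or_nonempty (Fin N)
      · rw [pencilDist_of_isEmpty]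
        exact mul_nonneg hB X.fill_nonneg
      · exact (hbound X hk hfill hquasi hrad).1
    calc √(1 + D) * pencilDist X.A X.B X.Ahat X.Bhat ≤ √(1 + D) * (B * X.fill) := by gcongr
      _ ≤ (√(1 + D) * B + 1) * X.fill := by linarith [X.fill_nonneg]
  · intro hA hB hBhat a b lam lamHat ha hb hlam hlamHat C hC hgap l
    have : Nonempty (Fin N) := ⟨0, by have := l.pos; omega⟩
    refine IsPencilSpectrum.abs_sub_le hA hB (isHermitian_symmPart _) hBhat ha hb hlam hlamHat
      (Real.one_le_sqrt.2 (by linarith)) ?_ hC (by simpa only [mul_pow] using hgap) l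
    rw [Real.sq_sqrt (by positivity), add_sub_cancel_left]
    exact (hbound X hk hfill hquasi hrad).2
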